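/- Let $m,n\ge 0$. Write a (not necessarily normalized) pure state in $\mathbb C^2\otimes\mathbb C^m\otimes\mathbb C^n$ as $|\psi\rangle=|0\rangle|R\rangle+|1\rangle|S\rangle$ with $R,S\in\mathbb C^{m\times n}$ the matrices of amplitudes, and let its pencil be $\mathcal P_\psi=\mu R+\lambda S$, a matrix over $\mathbb C[\mu,\lambda]$. Two states are SLOCC equivalent if $|\phi\rangle=(A\otimes B\otimes C)|\psi\rangle$ for some invertible complex matrices $A,B,C$ of sizes $2,m,n$. The rank $r$ of a pencil is the largest size of a minor that is not the zero polynomial. For $k\le r$ let $D_k(\mu,\lambda)$ be the greatest common divisor of the $k\times k$ minors, monic with respect to $\lambda$ (with $D_0=1$), and let $E_k=D_k/D_{k-1}$ for $1\le k\le r$. Let $x_1,\dots,x_q$ be the distinct complex numbers $z$ such that $\mu z+\lambda$ divides $D_r$, and let $e_{ij}$ ($1\le i\le q$, $1\le j\le r$) be the exponent of the largest power of $\mu x_i+\lambda$ dividing $E_j$. The finite elementary divisors are the $(\mu x_i+\lambda)^{e_{ij}}$. The pencil has no infinite elementary divisors if $\mu$ divides none of $E_1,\dots,E_r$. A basis of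 the right null space of a pencil $\mathcal P$ is a family of homogeneous polynomial vectors $v$ with $\mathcal Pv=0$ that is a basis of the kernel of $\mathcal P$ over the field of rational functions, each $v$, of degree $\epsilon$ say, having a nonzero coefficient vector at $\lambda^\epsilon$; its degrees are listed as $\epsilon_1\le\dots\le\epsilon_p$. It is fundamental if its degrees are termwise at most those of any other basis. The minimal indices of $\mathcal P$ are the degrees $\epsilon_1,\dots,\epsilon_p$ of a fundamental basis of the right null space of $\mathcal P$, together with the degrees $\nu_1,\dots,\nu_s$ of one for $\mathcal P^T$. "Same minimal indices" means that both lists agree. **Theorem.** (1) Let $|\psi\rangle,|\phi\rangle$ be two states in $\mathbb C^2\otimes\mathbb C^m\otimes\mathbb C^n$ whose pencils have no infinite elementary divisors and have finite elementary divisors $(\mu x_i+\lambda)^{e_{ij}}$, $1\le i\le q$, and $(\mu y_i+\lambda)^{f_{ij}}$, $1\le i\le q'$, respectively, with the $x_i$ distinct and the $y_i$ distinct. Then $|\psi\rangle$ and $|\phi\rangle$ are SLOCC equivalent if and only if $\mathcal P_\psi$ and $\mathcal P_\phi$ have the same rank and the same minimal indices, $q=q'$, and, after a suitable renumbering of the $y_i$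 (the $f_{ij}$ being renumbered in $i$ accordingly), $e_{ij}=f_{ij}$ for all $i,j$ and there are $a,b,c,d\in\mathbb C$ with $ad-bc\ne0$ such that, for all $i$, $bx_i+d\neq 0$ and $$\frac{ax_i+c}{bx_i+d}=y_i .$$ (2) Every state in $\mathbb C^2\otimes\mathbb C^m\otimes\mathbb C^n$ is SLOCC equivalent to one whose pencil has no infinite elementary divisors, that is, to one of the states that (1) is about. -/

import Mathlib

open scoped Kronecker

noncomputable section

namespace TwoMN

/-- A (not necessarily normalized) pure state of a `2 ⊗ m ⊗ n` system, given by its amplitudes in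
the product basis `|α⟩ ⊗ |i⟩ ⊗ |j⟩`. -/
abbrev State (m n : ℕ) : Type := Fin 2 × Fin m × Fin n → ℂ

/-- SLOCC equivalence: the two states lie in the same orbit of the local invertible operators
`A ⊗ B ⊗ C`. -/
def SLOCCEquiv {m n : ℕ} (ψ φ : State m n) : Prop :=
  ∃ (A : GL (Fin 2) ℂ) (B : GL (Fin m) ℂ) (C : GL (Fin n) ℂ),
    φ = ((A : Matrix (Fin 2) (Fin 2) ℂ) ⊗ₖ
      ((B : Matrix (Fin m) (Fin m) ℂ) ⊗ₖ (C : Matrix (Fin n) (Fin n) ℂ))).mulVec ψ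

/-- The polynomial ring `ℂ[μ, λ]`. -/
abbrev Poly : Type := MvPolynomial (Fin 2) ℂ

/-- The indeterminate `μ`. -/
def mu : Poly := MvPolynomial.X 0

/-- The indeterminate `λ`. -/
def lam : Poly := MvPolynomial.X 1

/-- The pencil `μ R + λ S` of `|ψ⟩ = |0⟩|R⟩ + |1⟩|S⟩`, where `R i j = ψ (0, i, j)` and
`S i j = ψ (1, i, j)`. -/
def pencil {m n : ℕ} (ψ : State m n) : Matrix (Fin m) (Fin n) Poly :=
  Matrix.of fun i j =>
    mu * MvPolynomial.C (ψ (0, i, j)) + lam * MvPolynomial.C (ψ (1, i, j))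

/-! ### Rank, invariant polynomials, elementary divisors -/

/-- The `k × k` minor with rows `f` and columns `g`, both listed increasingly. -/
def minor {m n : ℕ} (P : Matrix (Fin m) (Fin n) Poly) (k : ℕ)
    (f : Fin k ↪o Fin m) (g : Fin k ↪o Fin n) : Poly :=
  (P.submatrix f g).det

/-- The largest `r` such that some `r × r` minor is not the zero polynomial. -/
def pencilRank {m n : ℕ} (P : Matrix (Fin m) (Fin n) Poly) : ℕ :=
  sSup {r : ℕ | ∃ (f : Fin r ↪o Fin m) (g : Fin r ↪o Fin n), minor P r f g ≠ 0}

/-- `D` is the `k`-th determinantal divisor: the greatest common divisor of all `k × k` minors which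
is monic with respect to `λ`, that is, whose leading coefficient in `λ` is `1` once `μ = 1`. -/
structure IsDetDivisor {m n : ℕ} (P : Matrix (Fin m) (Fin n) Poly) (k : ℕ) (D : Poly) : Prop where
  dvd_minor : ∀ (f : Fin k ↪o Fin m) (g : Fin k ↪o Fin n), D ∣ minor P k f g
  greatest : ∀ G : Poly, (∀ (f : Fin k ↪o Fin m) (g : Fin k ↪o Fin n), G ∣ minor P k f g) → G ∣ D
  monic : (MvPolynomial.aeval (![1, Polynomial.X] : Fin 2 → Polynomial ℂ) D).Monic

/-- The determinantal divisor `D_k`, used for `k ≤ pencilRank P`, where it exists for every pencil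
by `isDetDivisor_detDivisor` below. -/
def detDivisor {m n : ℕ} (P : Matrix (Fin m) (Fin n) Poly) (k : ℕ) : Poly :=
  Classical.epsilon (IsDetDivisor P k)

/-- The invariant polynomial `E_{j+1} = D_{j+1} / D_j`, used for `j < pencilRank P`; it is a
polynomial by `detDivisor_succ` below. The index `j` starts at `0`. -/
def invPoly {m n : ℕ} (P : Matrix (Fin m) (Fin n) Poly) (j : ℕ) : Poly :=
  Classical.epsilon fun E => detDivisor P (j + 1) = detDivisor P j * E

/-- `x` lists without repetition the numbers for which `μ x_i + λ` divides `D_r` (`r` the rank), and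
`(μ x_i + λ) ^ e i j` is the largest power of `μ x_i + λ` dividing `E_{j+1}`, for `j < r`. So
the finite elementary divisors are the `(μ x_i + λ) ^ e i j`. -/
structure HasFiniteElementaryDivisors {m n q : ℕ} (P : Matrix (Fin m) (Fin n) Poly)
    (x : Fin q → ℂ) (e : Fin q → ℕ → ℕ) : Prop where
  injective : Function.Injective x
  mem_iff : ∀ z : ℂ,
    (∃ i, x i = z) ↔ mu * MvPolynomial.C z + lam ∣ detDivisor P (pencilRank P)
  exponent : ∀ i, ∀ j < pencilRank P,
    emultiplicity (mu * MvPolynomial.C (x i) + lam) (invPoly P j) = e i j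

/-- No power `μ ^ e'` with `e' > 0` is an (infinite) elementary divisor. -/
def NoInfiniteElementaryDivisors {m n : ℕ} (P : Matrix (Fin m) (Fin n) Poly) : Prop :=
  ∀ j < pencilRank P, ¬ mu ∣ invPoly P j

/-! ### Minimal indices -/

/-- `v` is a homogeneous polynomial vector of degree `d` in the right null space of `P`, with
nonzero coefficient vector at `λ ^ d`. -/
structure IsNullVector {m n : ℕ} (P : Matrix (Fin m) (Fin n) Poly) (d : ℕ) (v : Fin n → Poly) :
    Prop where
  homogeneous : ∀ i, (v i).IsHomogeneous d
  mulVec_eq_zero : P.mulVec v = 0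
  coeff_ne_zero : ∃ i, MvPolynomial.coeff (Finsupp.single 1 d) (v i) ≠ 0

/-- `v` is a basis of the right null space of `P` (linearly independent over the polynomials, and
spanning up to polynomial factors, i.e. a basis over the field of rational functions) whose elements
have degrees `ε 0 ≤ … ≤ ε (p - 1)`. -/
structure IsNullBasis {m n p : ℕ} (P : Matrix (Fin m) (Fin n) Poly) (ε : Fin p → ℕ)
    (v : Fin p → Fin n → Poly) : Prop where
  monotone : Monotone ε
  nullVector : ∀ i, IsNullVector P (ε i) (v i)
  linearIndependent : LinearIndependent Poly v
  spanning : ∀ w : Fin n → Poly, P.mulVec w = 0 →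
    ∃ c : Poly, c ≠ 0 ∧ c • w ∈ Submodule.span Poly (Set.range v)

/-- `ε` is the list of minimal indices for the columns: the degrees of a fundamental basis of the
right null space, i.e. of one whose degrees are termwise at most those of any other basis. -/
def IsRightMinimalIndices {m n p : ℕ} (P : Matrix (Fin m) (Fin n) Poly) (ε : Fin p → ℕ) : Prop :=
  ∃ v, IsNullBasis P ε v ∧
    ∀ (ε' : Fin p → ℕ) (v' : Fin p → Fin n → Poly), IsNullBasis P ε' v' → ∀ i, ε i ≤ ε' i

/-- Two matrices have the same minimal indices: the same `ε_1, …, ε_p` (right null space) and the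
same `ν_1, …, ν_s` (null space of the transpose). -/
def SameMinimalIndices {m n : ℕ} (P Q : Matrix (Fin m) (Fin n) Poly) : Prop :=
  (∃ (p : ℕ) (ε : Fin p → ℕ), IsRightMinimalIndices P ε ∧ IsRightMinimalIndices Q ε) ∧
    ∃ (s : ℕ) (ν : Fin s → ℕ),
      IsRightMinimalIndices P.transpose ν ∧ IsRightMinimalIndices Q.transpose ν

/-! ### Existence of the determinantal divisors and invariant polynomials -/

theorem minor_succ {m n : ℕ} (P : Matrix (Fin m) (Fin n) Poly) (k : ℕ)
    (f : Fin (k + 1) ↪o Fin m) (g : Fin (k + 1) ↪o Fin n) :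
    minor P (k + 1) f g = ∑ j : Fin (k + 1), (-1) ^ (j : ℕ) * P (f 0) (g j) *
      minor P k ((Fin.succOrderEmb k).trans f) ((Fin.succAboveOrderEmb j).trans g) := by
  unfold minor
  rw [Matrix.det_succ_row_zero]
  rfl

theorem exists_minor_ne_zero {m n : ℕ} (P : Matrix (Fin m) (Fin n) Poly) {k : ℕ}
    (hk : k ≤ pencilRank P) :
    ∃ (f : Fin k ↪o Fin m) (g : Fin k ↪o Fin n), minor P k f g ≠ 0 := by
  have hmem : pencilRank P ∈
      {r : ℕ | ∃ (f : Fin r ↪o Fin m) (g : Fin r ↪o Fin n), minor P r f g ≠ 0} := by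
    apply Nat.sSup_mem
    · refine ⟨0, Fin.castLEOrderEmb (Nat.zero_le _), Fin.castLEOrderEmb (Nat.zero_le _), ?_⟩
      simp [minor]
    · refine ⟨m, ?_⟩
      rintro r ⟨f, -, -⟩
      simpa using Fintype.card_le_of_injective f f.injective
  induction hk using Nat.decreasingInduction with
  | self => exact hmem
  | of_succ k _ ih =>
    obtain ⟨f, g, h⟩ := ih
    by_contra! hcon
    exact h (by rw [minor_succ]; exact Finset.sum_eq_zero fun j _ => by rw [hcon, mul_zero])

theorem minor_homogeneous {m n : ℕ} (ψ : State m n) (k : ℕ)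
    (f : Fin k ↪o Fin m) (g : Fin k ↪o Fin n) : (minor (pencil ψ) k f g).IsHomogeneous k := by
  induction k with
  | zero => simpa [minor] using MvPolynomial.isHomogeneous_one (Fin 2) ℂ
  | succ k ih =>
    rw [minor_succ]
    refine MvPolynomial.IsHomogeneous.sum _ _ _ fun j _ => ?_
    have h1 : ((-1 : Poly) ^ (j : ℕ)).IsHomogeneous 0 := by
      simpa using ((MvPolynomial.isHomogeneous_one (Fin 2) ℂ).neg).pow (j : ℕ)
    have h2 : (pencil ψ (f 0) (g j)).IsHomogeneous 1 := by
      refine MvPolynomial.IsHomogeneous.add ?_ ?_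
      · simpa [mu] using (MvPolynomial.isHomogeneous_X ℂ (0 : Fin 2)).mul
          (MvPolynomial.isHomogeneous_C (Fin 2) (ψ (0, f 0, g j)))
      · simpa [lam] using (MvPolynomial.isHomogeneous_X ℂ (1 : Fin 2)).mul
          (MvPolynomial.isHomogeneous_C (Fin 2) (ψ (1, f 0, g j)))
    have h3 := (h1.mul h2).mul
      (ih ((Fin.succOrderEmb k).trans f) ((Fin.succAboveOrderEmb j).trans g))
    have hk : 0 + 1 + k = k + 1 := by omega
    rwa [hk] at h3

theorem aeval_ne_zero {M : Poly} {k : ℕ} (hM : M.IsHomogeneous k) (h0 : M ≠ 0) :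
    MvPolynomial.aeval (![1, Polynomial.X] : Fin 2 → Polynomial ℂ) M ≠ 0 := by
  obtain ⟨d, hd⟩ := MvPolynomial.ne_zero_iff.mp h0
  intro h
  have h1 := congrArg (fun p => Polynomial.coeff p (d 1)) h
  simp only [MvPolynomial.aeval_def, MvPolynomial.eval₂_eq', Fin.prod_univ_two,
    Matrix.cons_val_zero, Matrix.cons_val_one, one_pow, one_mul, Polynomial.algebraMap_eq,
    Polynomial.finsetSum_coeff, Polynomial.coeff_C_mul_X_pow, Polynomial.coeff_zero] at h1
  rw [Finset.sum_eq_single d] at h1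
  · exact hd (by simpa using h1)
  · intro d' hd' hne
    refine if_neg fun h2 => hne ?_
    have e3 : d'.degree = d.degree := by
      by_contra hcon
      have a1 : d'.degree = k := by
        by_contra hk
        exact (MvPolynomial.mem_support_iff.mp hd') (hM.coeff_eq_zero hk)
      have a2 : d.degree = k := by
        by_contra hk
        exact hd (hM.coeff_eq_zero hk)
      exact hcon (a1.trans a2.symm)
    rw [Finsupp.degree_eq_sum, Finsupp.degree_eq_sum, Fin.sum_univ_two, Fin.sum_univ_two] at e3
    ext i
    fin_cases i
    · simp only [Fin.zero_eta, Fin.isValue]; omega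
    · exact h2.symm
  · intro hns
    exact absurd (MvPolynomial.mem_support_iff.mpr hd) hns

theorem exists_gcd {α ι : Type*} [CommRing α] [IsDomain α] [UniqueFactorizationMonoid α]
    [Fintype ι] (F : ι → α) :
    ∃ G, (∀ i, G ∣ F i) ∧ ∀ H, (∀ i, H ∣ F i) → H ∣ G := by
  classical
  let _ : StrongNormalizationMonoid α := UniqueFactorizationMonoid.strongNormalizationMonoid
  let _ : NormalizedGCDMonoid α := UniqueFactorizationMonoid.toNormalizedGCDMonoid α
  exact ⟨Finset.univ.gcd F, fun i => Finset.gcd_dvd (Finset.mem_univ i),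
    fun H hH => Finset.dvd_gcd fun i _ => hH i⟩

theorem exists_isDetDivisor {m n : ℕ} (ψ : State m n) {k : ℕ} (hk : k ≤ pencilRank (pencil ψ)) :
    ∃ D, IsDetDivisor (pencil ψ) k D := by
  obtain ⟨f, g, hfg⟩ := exists_minor_ne_zero _ hk
  obtain ⟨G, hG, hG'⟩ := exists_gcd fun fg : (Fin k ↪o Fin m) × (Fin k ↪o Fin n) =>
    minor (pencil ψ) k fg.1 fg.2
  have hTG : MvPolynomial.aeval (![1, Polynomial.X] : Fin 2 → Polynomial ℂ) G ≠ 0 := fun h =>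
    aeval_ne_zero (minor_homogeneous ψ k f g) hfg
      (zero_dvd_iff.mp (h ▸ map_dvd (MvPolynomial.aeval _) (hG (f, g))))
  generalize hl : (MvPolynomial.aeval (![1, Polynomial.X] : Fin 2 → Polynomial ℂ)
    G).leadingCoeff = l
  have hl0 : l ≠ 0 := hl ▸ Polynomial.leadingCoeff_ne_zero.mpr hTG
  have hu : IsUnit (MvPolynomial.C l⁻¹ : Poly) :=
    (isUnit_iff_ne_zero.mpr (inv_ne_zero hl0)).map _
  refine ⟨G * MvPolynomial.C l⁻¹, ?_, ?_, ?_⟩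
  · exact fun f g => (hu.mul_right_dvd).mpr (hG (f, g))
  · exact fun H hH => (hG' H fun fg => hH fg.1 fg.2).mul_right _
  · rw [map_mul, MvPolynomial.aeval_C, Polynomial.algebraMap_eq, ← hl]
    exact Polynomial.monic_mul_leadingCoeff_inv hTG

theorem isDetDivisor_detDivisor {m n : ℕ} (ψ : State m n) {k : ℕ}
    (hk : k ≤ pencilRank (pencil ψ)) : IsDetDivisor (pencil ψ) k (detDivisor (pencil ψ) k) :=
  Classical.epsilon_spec (exists_isDetDivisor ψ hk)

theorem detDivisor_succ {m n : ℕ} (ψ : State m n) {j : ℕ} (hj : j < pencilRank (pencil ψ)) :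
    detDivisor (pencil ψ) (j + 1) = detDivisor (pencil ψ) j * invPoly (pencil ψ) j := by
  refine Classical.epsilon_spec (p := fun E =>
    detDivisor (pencil ψ) (j + 1) = detDivisor (pencil ψ) j * E) ?_
  refine (isDetDivisor_detDivisor ψ (Nat.succ_le_of_lt hj)).greatest _ fun f g => ?_
  rw [minor_succ]
  exact Finset.dvd_sum fun i _ =>
    ((isDetDivisor_detDivisor ψ hj.le).dvd_minor _ _).mul_left _

end TwoMN

end

/-!
# SLOCC classes of states of type `2 ⊗ m ⊗ n` and matrix pencils

A local operator `A ⊗ B ⊗ C` multiplies the pencil `μ R + λ S` by constant invertible matrices on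
both sides and applies to `μ, λ` the linear substitution given by `A` (`sloccEquiv_iff`).

*Necessity of the conditions.* The substitution maps the greatest common divisors of the minors to
those of the new pencil, up to constants (`MinorsSubst`). It takes `μ x + λ` to a multiple of
`μ y + λ` with `y = (A₀₀ x + A₀₁) / (A₁₀ x + A₁₁)`, so it moves the roots of the finite elementary
divisors by a Möbius transformation and keeps rank and exponents. The denominators do not vanish,
since otherwise `μ` would divide an invariant polynomial of the new pencil. Null vectors are
transformed with their degrees; to see that the minimal indices are kept, they are identified with
the degrees of a homogeneous basis of the null space as a module over `ℂ[μ, λ]`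
(`IsHomogeneousNullBasis`). Such a basis exists because the null space is saturated
(`IsGradedSaturated.exists_basis`): in a maximal independent family of homogeneous null vectors of
smallest total degree, a combination is divisible by a linear form only if its coefficients are.

*Sufficiency.* The Möbius transformation, applied to `ψ`, reduces to the case that all the
invariants agree; then the pencils are strictly equivalent, which is Kronecker's theorem for
pencils without infinite elementary divisors (`LinPencil.iso_of_sameChains`). It is proved for
pairs of linear maps `R, S : V → W` by induction on the dimension, the invariants being the
dimensions of certain spaces of chains of vectors: `LinPencil.nullChains`, the coefficient
sequences of null vectors, and `LinPencil.chains`, the kernels over `ℂ[t]/(t - x)^s`. A null vector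
of minimal degree `n` splits off a block `L_n` (`LinPencil.exists_iso_lBlock_prod`); the same holds
for the dual pencil. If there are no null vectors on either side, the absence of infinite
elementary divisors makes `S` bijective, and a chain of maximal length at an eigenvalue of
`-S⁻¹ R` splits off a Jordan block (`LinPencil.exists_iso_jBlock_prod`). Chains are counted
additively in direct sums, so the complements satisfy the hypotheses again. The absence of infinite
elementary divisors is used in the form that every vector of `ker S` is the coefficient at `λ ^ d`
of a null vector of some degree `d` (`LinPencil.KerLifts`, `kerLifts_ofState`), which passes to
direct summands.

The numbers of chains of a state are determined by its invariants: those of null chains by the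
minimal indices, since homogeneous null vectors have unique homogeneous coordinates in a basis
(`finrank_nullChains_congr`), and those of chains at `x` by the powers of `t - x` dividing the
minors of `R + t S`, by the Smith normal form over `ℂ[t]` (`finrank_chains_congr`).

*The second part.* Only finitely many linear forms divide `D_r`; a substitution taking to `μ`
another one removes the infinite elementary divisors.
-/

noncomputable section

namespace TwoMN

/-! ### Linear pencils between finite-dimensional spaces -/

/-- A pair of linear maps `R, S : V → W` between finite-dimensional complex vector spaces, that is,
the pencil `μ R + λ S` without a choice of bases. -/
structure LinPencil where
  /-- the source -/
  V : Type
  /-- the target -/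
  W : Type
  [addV : AddCommGroup V]
  [addW : AddCommGroup W]
  [modV : Module ℂ V]
  [modW : Module ℂ W]
  [finV : FiniteDimensional ℂ V]
  [finW : FiniteDimensional ℂ W]
  /-- the coefficient of `μ` -/
  R : V →ₗ[ℂ] W
  /-- the coefficient of `λ` -/
  S : V →ₗ[ℂ] W

namespace LinPencil

attribute [instance] addV addW modV modW finV finW

/-- Strict equivalence of pencils. -/
def Iso (P Q : LinPencil) : Prop :=
  ∃ (f : P.V ≃ₗ[ℂ] Q.V) (g : P.W ≃ₗ[ℂ] Q.W),
    (∀ v, g (P.R v) = Q.R (f v)) ∧ ∀ v, g (P.S v) = Q.S (f v)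

/-- The direct sum of two pencils. -/
abbrev prod (P Q : LinPencil) : LinPencil where
  V := P.V × Q.V
  W := P.W × Q.W
  R := P.R.prodMap Q.R
  S := P.S.prodMap Q.S

/-- The transposed pencil, between the dual spaces. -/
abbrev dual (P : LinPencil) : LinPencil where
  V := Module.Dual ℂ P.W
  W := Module.Dual ℂ P.V
  R := P.R.dualMap
  S := P.S.dualMap

theorem Iso.symm {P Q : LinPencil} (h : Iso P Q) : Iso Q P := by
  obtain ⟨f, g, hR, hS⟩ := h
  refine ⟨f.symm, g.symm, fun v => ?_, fun v => ?_⟩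
  · rw [LinearEquiv.symm_apply_eq, hR, LinearEquiv.apply_symm_apply]
  · rw [LinearEquiv.symm_apply_eq, hS, LinearEquiv.apply_symm_apply]

theorem Iso.trans {P Q T : LinPencil} (h : Iso P Q) (h' : Iso Q T) : Iso P T := by
  obtain ⟨f, g, hR, hS⟩ := h
  obtain ⟨f', g', hR', hS'⟩ := h'
  exact ⟨f.trans f', g.trans g', fun v => by simp [hR, hR'], fun v => by simp [hS, hS']⟩

theorem Iso.prod_congr_right {X P Q : LinPencil} (h : Iso P Q) : Iso (X.prod P) (X.prod Q) := by
  obtain ⟨f, g, hR, hS⟩ := h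
  refine ⟨(LinearEquiv.refl ℂ X.V).prodCongr f, (LinearEquiv.refl ℂ X.W).prodCongr g,
    fun v => ?_, fun v => ?_⟩
  · exact Prod.ext rfl (hR v.2)
  · exact Prod.ext rfl (hS v.2)

theorem Iso.dual {P Q : LinPencil} (h : Iso P Q) : Iso P.dual Q.dual := by
  obtain ⟨f, g, hR, hS⟩ := h.symm
  refine ⟨g.dualMap, f.dualMap, fun v => ?_, fun v => ?_⟩
  · exact LinearMap.ext fun w => congrArg (v : P.W →ₗ[ℂ] ℂ) (hR w).symm
  · exact LinearMap.ext fun w => congrArg (v : P.W →ₗ[ℂ] ℂ) (hS w).symm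

theorem iso_dual_dual (P : LinPencil) : Iso P P.dual.dual :=
  ⟨Module.evalEquiv ℂ P.V, Module.evalEquiv ℂ P.W, fun _ => rfl, fun _ => rfl⟩

theorem dual_prod (P Q : LinPencil) : Iso (P.prod Q).dual (P.dual.prod Q.dual) := by
  refine Iso.symm ⟨Module.dualProdDualEquivDual ℂ P.W Q.W,
    Module.dualProdDualEquivDual ℂ P.V Q.V, fun v => ?_, fun v => ?_⟩
  · exact LinearMap.ext fun w => rfl
  · exact LinearMap.ext fun w => rfl

/-! ### Chains of vectors attached to a pencil -/

/-- The sequences `u_0, …, u_{s-1}` (continued by zero) with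
`(R + x S) u_k + S u_{k+1} = 0` for all `k`: the kernel of the pencil over `ℂ[t]/(t - x)^s`. -/
def chains (P : LinPencil) (x : ℂ) (s : ℕ) : Submodule ℂ (ℕ → P.V) where
  carrier := {u | (∀ k, s ≤ k → u k = 0) ∧ ∀ k, P.R (u k) + P.S (x • u k + u (k + 1)) = 0}
  add_mem' := by
    rintro a b ⟨ha, ha'⟩ ⟨hb, hb'⟩
    refine ⟨fun k hk => by simp [ha k hk, hb k hk], fun k => ?_⟩
    have := congrArg₂ (· + ·) (ha' k) (hb' k)
    simp only [Pi.add_apply, map_add, smul_add, add_zero] at this ⊢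
    rw [← this]; abel
  zero_mem' := ⟨fun _ _ => rfl, fun k => by simp⟩
  smul_mem' := by
    rintro c a ⟨ha, ha'⟩
    refine ⟨fun k hk => by simp [ha k hk], fun k => ?_⟩
    have := congrArg (c • ·) (ha' k)
    simp only [smul_add, smul_zero, map_add, map_smul, Pi.smul_apply] at this ⊢
    rw [← this, smul_comm c x]

/-- The coefficient sequences of the null vectors `∑ μ ^ k λ ^ (d - k) u_k` of degree `d`:
`S u_0 = 0`, `R u_k + S u_{k+1} = 0` and `R u_d = 0`. -/
def nullChains (P : LinPencil) (d : ℕ) : Submodule ℂ (ℕ → P.V) :=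
  P.chains 0 (d + 1) ⊓ LinearMap.ker (P.S ∘ₗ LinearMap.proj 0)

theorem mem_chains {P : LinPencil} {x : ℂ} {s : ℕ} {u : ℕ → P.V} :
    u ∈ P.chains x s ↔ (∀ k, s ≤ k → u k = 0) ∧
      ∀ k, P.R (u k) + P.S (x • u k + u (k + 1)) = 0 := Iff.rfl

theorem mem_nullChains {P : LinPencil} {d : ℕ} {u : ℕ → P.V} :
    u ∈ P.nullChains d ↔ (∀ k, d < k → u k = 0) ∧ P.S (u 0) = 0 ∧
      ∀ k, P.R (u k) + P.S (u (k + 1)) = 0 := by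
  unfold nullChains
  rw [Submodule.mem_inf, mem_chains]
  simp only [zero_smul, zero_add, LinearMap.mem_ker, LinearMap.comp_apply, LinearMap.proj_apply,
    Nat.succ_le_iff]
  tauto

instance (P : LinPencil) (x : ℂ) (s : ℕ) : FiniteDimensional ℂ (P.chains x s) := by
  let F : P.chains x s →ₗ[ℂ] (Fin s → P.V) :=
    (LinearMap.funLeft ℂ P.V (fun i : Fin s => (i : ℕ))) ∘ₗ (P.chains x s).subtype
  refine Module.Finite.of_injective F fun u v huv => Subtype.ext (funext fun k => ?_)
  by_cases hk : k < s
  · exact congrFun huv ⟨k, hk⟩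
  · rw [u.2.1 k (not_lt.mp hk), v.2.1 k (not_lt.mp hk)]

instance (P : LinPencil) (d : ℕ) : FiniteDimensional ℂ (P.nullChains d) :=
  Submodule.finiteDimensional_of_le (inf_le_left : P.nullChains d ≤ P.chains 0 (d + 1))

/-- Two pencils have as many chains of every kind. -/
structure SameChains (P Q : LinPencil) : Prop where
  finrank_V : Module.finrank ℂ P.V = Module.finrank ℂ Q.V
  chains : ∀ x s, Module.finrank ℂ (P.chains x s) = Module.finrank ℂ (Q.chains x s)
  nullChains : ∀ d, Module.finrank ℂ (P.nullChains d) = Module.finrank ℂ (Q.nullChains d)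

theorem SameChains.symm {P Q : LinPencil} (h : SameChains P Q) : SameChains Q P :=
  ⟨h.1.symm, fun x s => (h.2 x s).symm, fun d => (h.3 d).symm⟩

theorem SameChains.trans {P Q T : LinPencil} (h : SameChains P Q) (h' : SameChains Q T) :
    SameChains P T :=
  ⟨h.1.trans h'.1, fun x s => (h.2 x s).trans (h'.2 x s), fun d => (h.3 d).trans (h'.3 d)⟩

theorem comp_mem_chains {P Q : LinPencil} {f : P.V →ₗ[ℂ] Q.V} {g : P.W →ₗ[ℂ] Q.W}
    (hR : ∀ v, g (P.R v) = Q.R (f v)) (hS : ∀ v, g (P.S v) = Q.S (f v)) {x : ℂ} {s : ℕ}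
    {u : ℕ → P.V} (hu : u ∈ P.chains x s) : (fun k => f (u k)) ∈ Q.chains x s := by
  refine ⟨fun k hk => by simp [hu.1 k hk], fun k => ?_⟩
  rw [← map_smul, ← map_add, ← hR, ← hS, ← map_add, hu.2, map_zero]

theorem comp_mem_nullChains {P Q : LinPencil} {f : P.V →ₗ[ℂ] Q.V} {g : P.W →ₗ[ℂ] Q.W}
    (hR : ∀ v, g (P.R v) = Q.R (f v)) (hS : ∀ v, g (P.S v) = Q.S (f v)) {d : ℕ}
    {u : ℕ → P.V} (hu : u ∈ P.nullChains d) : (fun k => f (u k)) ∈ Q.nullChains d := by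
  refine ⟨comp_mem_chains hR hS hu.1, ?_⟩
  have := (mem_nullChains.mp hu).2.1
  change Q.S (f (u 0)) = 0
  rw [← hS, this, map_zero]

theorem Iso.sameChains {P Q : LinPencil} (h : Iso P Q) : SameChains P Q := by
  have key : ∀ {P Q : LinPencil}, Iso P Q →
      (Module.finrank ℂ P.V = Module.finrank ℂ Q.V) ∧
      (∀ x s, Module.finrank ℂ (P.chains x s) ≤ Module.finrank ℂ (Q.chains x s)) ∧
      ∀ d, Module.finrank ℂ (P.nullChains d) ≤ Module.finrank ℂ (Q.nullChains d) := by
    rintro P Q ⟨f, g, hR, hS⟩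
    let F : (ℕ → P.V) →ₗ[ℂ] (ℕ → Q.V) := LinearMap.compLeft f.toLinearMap ℕ
    have hF : Function.Injective F := fun a b hab => funext fun k => f.injective (congrFun hab k)
    refine ⟨f.finrank_eq, fun x s => ?_, fun d => ?_⟩
    · refine LinearMap.finrank_le_finrank_of_injective
        (f := F.restrict fun u hu => comp_mem_chains (f := f.toLinearMap) (g := g.toLinearMap)
          hR hS hu) ?_
      exact fun a b hab => Subtype.ext (hF (congrArg Subtype.val hab))
    · refine LinearMap.finrank_le_finrank_of_injective
        (f := F.restrict fun u hu => comp_mem_nullChains (f := f.toLinearMap) (g := g.toLinearMap)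
          hR hS hu) ?_
      exact fun a b hab => Subtype.ext (hF (congrArg Subtype.val hab))
  obtain ⟨h1, h2, h3⟩ := key h
  obtain ⟨-, h2', h3'⟩ := key h.symm
  exact ⟨h1, fun x s => le_antisymm (h2 x s) (h2' x s), fun d => le_antisymm (h3 d) (h3' d)⟩

theorem mem_chains_prod {P Q : LinPencil} {x : ℂ} {s : ℕ} {u : ℕ → (P.prod Q).V} :
    u ∈ (P.prod Q).chains x s ↔
      (fun k => (u k).1) ∈ P.chains x s ∧ (fun k => (u k).2) ∈ Q.chains x s := by
  simp only [mem_chains, prod, Prod.ext_iff, LinearMap.prodMap_apply, Prod.fst_add, Prod.snd_add,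
    Prod.fst_zero, Prod.snd_zero, Prod.smul_fst, Prod.smul_snd, forall_and]
  tauto

theorem mem_nullChains_prod {P Q : LinPencil} {d : ℕ} {u : ℕ → (P.prod Q).V} :
    u ∈ (P.prod Q).nullChains d ↔
      (fun k => (u k).1) ∈ P.nullChains d ∧ (fun k => (u k).2) ∈ Q.nullChains d := by
  simp only [mem_nullChains, prod, Prod.ext_iff, LinearMap.prodMap_apply, Prod.fst_add,
    Prod.snd_add, Prod.fst_zero, Prod.snd_zero, forall_and]
  tauto

theorem finrank_chains_prod (P Q : LinPencil) (x : ℂ) (s : ℕ) :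
    Module.finrank ℂ ((P.prod Q).chains x s) =
      Module.finrank ℂ (P.chains x s) + Module.finrank ℂ (Q.chains x s) := by
  rw [← Module.finrank_prod]
  refine LinearEquiv.finrank_eq
    { toFun := fun u => (⟨_, (mem_chains_prod.mp u.2).1⟩, ⟨_, (mem_chains_prod.mp u.2).2⟩)
      invFun := fun w => ⟨fun k => (w.1.1 k, w.2.1 k), mem_chains_prod.mpr ⟨w.1.2, w.2.2⟩⟩
      map_add' := fun _ _ => rfl
      map_smul' := fun _ _ => rfl
      left_inv := fun _ => rfl
      right_inv := fun _ => rfl }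

theorem finrank_nullChains_prod (P Q : LinPencil) (d : ℕ) :
    Module.finrank ℂ ((P.prod Q).nullChains d) =
      Module.finrank ℂ (P.nullChains d) + Module.finrank ℂ (Q.nullChains d) := by
  rw [← Module.finrank_prod]
  refine LinearEquiv.finrank_eq
    { toFun := fun u => (⟨_, (mem_nullChains_prod.mp u.2).1⟩, ⟨_, (mem_nullChains_prod.mp u.2).2⟩)
      invFun := fun w => ⟨fun k => (w.1.1 k, w.2.1 k), mem_nullChains_prod.mpr ⟨w.1.2, w.2.2⟩⟩
      map_add' := fun _ _ => rfl
      map_smul' := fun _ _ => rfl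
      left_inv := fun _ => rfl
      right_inv := fun _ => rfl }

theorem finrank_V_prod (P Q : LinPencil) : Module.finrank ℂ (P.prod Q).V =
    Module.finrank ℂ P.V + Module.finrank ℂ Q.V := Module.finrank_prod

theorem SameChains.prod_cancel {X P Q : LinPencil} (h : SameChains (X.prod P) (X.prod Q)) :
    SameChains P Q := by
  refine ⟨?_, fun x s => ?_, fun d => ?_⟩
  · have := h.1; rw [finrank_V_prod, finrank_V_prod] at this; omega
  · have := h.2 x s; rw [finrank_chains_prod, finrank_chains_prod] at this; omega
  · have := h.3 d; rw [finrank_nullChains_prod, finrank_nullChains_prod] at this; omega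

/-- Every vector of `ker S` is the coefficient at `λ ^ d` of a null vector. This expresses that
there are no infinite elementary divisors, in a form inherited by direct summands. -/
def KerLifts (P : LinPencil) : Prop :=
  ∀ v, P.S v = 0 → ∃ d, ∃ u ∈ P.nullChains d, u 0 = v

theorem KerLifts.of_iso_prod {P X Q : LinPencil} (h : P.KerLifts) (e : Iso P (X.prod Q)) :
    Q.KerLifts := by
  intro v hv
  obtain ⟨f, g, hR, hS⟩ := e
  obtain ⟨d, u, hu, h0⟩ := h (f.symm (0, v)) (g.injective (by
    rw [hS, LinearEquiv.apply_symm_apply, map_zero]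
    exact Prod.ext (map_zero X.S) hv))
  have := comp_mem_nullChains (f := f.toLinearMap) (g := g.toLinearMap) hR hS hu
  refine ⟨d, _, (mem_nullChains_prod.mp this).2, ?_⟩
  simp [h0]

theorem KerLifts.of_iso {P Q : LinPencil} (h : P.KerLifts) (e : Iso P Q) : Q.KerLifts := by
  intro v hv
  obtain ⟨f, g, hR, hS⟩ := e
  obtain ⟨d, u, hu, h0⟩ := h (f.symm v) (g.injective (by
    rw [hS, LinearEquiv.apply_symm_apply, map_zero, hv]))
  have := comp_mem_nullChains (f := f.toLinearMap) (g := g.toLinearMap) hR hS hu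
  exact ⟨d, _, this, by simp [h0]⟩

/-- A pencil `X` splits off `P` when some morphisms `X → P → X` compose to an injective one. -/
theorem exists_iso_prod_of_retract {X P : LinPencil} (i : X.V →ₗ[ℂ] P.V) (j : X.W →ₗ[ℂ] P.W)
    (hiR : ∀ v, j (X.R v) = P.R (i v)) (hiS : ∀ v, j (X.S v) = P.S (i v))
    (a : P.V →ₗ[ℂ] X.V) (b : P.W →ₗ[ℂ] X.W)
    (haR : ∀ v, b (P.R v) = X.R (a v)) (haS : ∀ v, b (P.S v) = X.S (a v))
    (hV : Function.Injective (a ∘ₗ i)) (hW : Function.Injective (b ∘ₗ j)) :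
    ∃ Q : LinPencil, Iso P (X.prod Q) := by
  have split : ∀ {M N : Type} [AddCommGroup M] [AddCommGroup N] [Module ℂ M] [Module ℂ N]
      [FiniteDimensional ℂ M] (i : M →ₗ[ℂ] N) (a : N →ₗ[ℂ] M),
      Function.Injective (a ∘ₗ i) →
      Function.Bijective (LinearMap.coprod i (LinearMap.ker a).subtype) := by
    intro M N _ _ _ _ _ i a h
    have hs := LinearMap.surjective_of_injective h
    constructor
    · rw [← LinearMap.ker_eq_bot, LinearMap.ker_eq_bot']
      rintro ⟨m, k, hk⟩ hmk
      rw [LinearMap.mem_ker] at hk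
      simp only [LinearMap.coprod_apply, Submodule.subtype_apply] at hmk
      have h1 : a (i m) = 0 := by
        have := congrArg a hmk
        rwa [map_add, hk, add_zero, map_zero] at this
      have h2 : m = 0 := h (by simpa using h1)
      subst h2
      simp only [map_zero, zero_add] at hmk
      subst hmk
      rfl
    · intro v
      obtain ⟨m, hm⟩ := hs (a v)
      refine ⟨(m, ⟨v - i m, ?_⟩), ?_⟩
      · rw [LinearMap.mem_ker, map_sub, ← hm]; simp
      · simp
  have rR : ∀ v ∈ LinearMap.ker a, P.R v ∈ LinearMap.ker b := fun v hv => by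
    rw [LinearMap.mem_ker] at hv ⊢; rw [haR, hv, map_zero]
  have rS : ∀ v ∈ LinearMap.ker a, P.S v ∈ LinearMap.ker b := fun v hv => by
    rw [LinearMap.mem_ker] at hv ⊢; rw [haS, hv, map_zero]
  refine ⟨{ V := LinearMap.ker a, W := LinearMap.ker b, R := P.R.restrict rR,
            S := P.S.restrict rS }, Iso.symm ⟨LinearEquiv.ofBijective _ (split i a hV),
            LinearEquiv.ofBijective _ (split j b hW), ?_, ?_⟩⟩
  · rintro ⟨v, k⟩
    simp [prod, hiR, LinearMap.coprod_apply]
  · rintro ⟨v, k⟩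
    simp [prod, hiS, LinearMap.coprod_apply]

end LinPencil

/-! ### Splitting off a block with a null vector of minimal degree -/

theorem exists_dual_comp_eq {U M : Type*} [AddCommGroup U] [Module ℂ U] [AddCommGroup M]
    [Module ℂ M] (F : U →ₗ[ℂ] M) (τ : U →ₗ[ℂ] ℂ) (h : ∀ u, F u = 0 → τ u = 0) :
    ∃ G : M →ₗ[ℂ] ℂ, ∀ u, G (F u) = τ u := by
  have : τ ∈ LinearMap.range F.dualMap := by
    rw [LinearMap.range_dualMap_eq_dualAnnihilator_ker, Submodule.mem_dualAnnihilator]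
    exact fun u hu => h u hu
  obtain ⟨G, hG⟩ := this
  exact ⟨G, fun u => LinearMap.congr_fun hG u⟩

namespace LinPencil

/-- The `n × (n + 1)` block `L_n`, with null vector `∑ μ ^ k λ ^ (n - k) e_k`. -/
abbrev lBlock (n : ℕ) : LinPencil where
  V := Fin (n + 1) → ℂ
  W := Fin n → ℂ
  R := -LinearMap.funLeft ℂ ℂ Fin.castSucc
  S := LinearMap.funLeft ℂ ℂ Fin.succ

/-- For a null chain `v`, a sequence `y` made of a shifted piece of `v` for which `S y_0`,
`R y_0 + S y_1`, `R y_1 + S y_2`, … vanish except at position `i`, where the value is `S v_{l+1}`.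
According to whether `i ≤ l`, the piece is the end of `v` or the negative of its beginning; so the
support of `y` stays in `[0, n]` if `v` has degree `n + 1` and `i, l ≤ n`. -/
def shiftChain {P : LinPencil} (v : ℕ → P.V) (i l k : ℕ) : P.V :=
  if i ≤ l then if i ≤ k then v (k + l + 1 - i) else 0
  else if k < i ∧ i ≤ k + l + 1 then -v (k + l + 1 - i) else 0

theorem shiftChain_zero {P : LinPencil} {v : ℕ → P.V} (h0 : P.S (v 0) = 0) (i l : ℕ) :
    P.S (shiftChain v i l 0) = if i = 0 then P.S (v (l + 1)) else 0 := by
  unfold shiftChain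
  rcases Nat.eq_zero_or_pos i with rfl | hi
  · simp
  · rw [if_neg hi.ne']
    split_ifs with h1 h2 h3
    · omega
    · simp
    · obtain rfl : i = l + 1 := by omega
      simp [h0]
    · simp

theorem shiftChain_succ {P : LinPencil} {v : ℕ → P.V} (h0 : P.S (v 0) = 0)
    (h : ∀ k, P.R (v k) + P.S (v (k + 1)) = 0) (i l k : ℕ) :
    P.R (shiftChain v i l k) + P.S (shiftChain v i l (k + 1)) =
      if i = k + 1 then P.S (v (l + 1)) else 0 := by
  unfold shiftChain
  by_cases hil : i ≤ l
  · rw [if_pos hil, if_pos hil]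
    rcases lt_trichotomy i (k + 1) with hlt | rfl | hgt
    · rw [if_pos (by omega), if_pos hlt.le, if_neg (by omega),
        show k + 1 + l + 1 - i = (k + l + 1 - i) + 1 by omega]
      exact h _
    · rw [if_neg (by omega), if_pos le_rfl, if_pos rfl, map_zero, zero_add,
        show k + 1 + l + 1 - (k + 1) = l + 1 by omega]
    · rw [if_neg (by omega), if_neg (by omega), if_neg (by omega)]
      simp
  · rw [if_neg hil, if_neg hil]
    rcases lt_trichotomy i (k + 1) with hlt | rfl | hgt
    · rw [if_neg (by omega), if_neg (by omega), if_neg (by omega)]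
      simp
    · rw [if_pos (by omega), if_neg (by omega), if_pos rfl, map_zero, add_zero,
        show k + l + 1 - (k + 1) = l by omega, map_neg]
      exact neg_eq_of_add_eq_zero_right (h l)
    · rw [if_neg hgt.ne']
      by_cases h1 : i ≤ k + l + 1
      · rw [if_pos ⟨by omega, h1⟩, if_pos ⟨hgt, by omega⟩,
          show k + 1 + l + 1 - i = (k + l + 1 - i) + 1 by omega, map_neg, map_neg, ← neg_add,
          h, neg_zero]
      · rw [if_neg (by omega)]
        by_cases h2 : i ≤ k + 1 + l + 1
        · rw [if_pos ⟨hgt, h2⟩, show k + 1 + l + 1 - i = 0 by omega]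
          simp [h0]
        · rw [if_neg (by omega)]
          simp

/-- The dual system to a null chain of minimal degree: functionals `β_i` on `W` that define a
morphism to `L_{n+1}` and are biorthogonal to the vectors `S v_{j+1}`. A linear relation
obstructing their existence would yield a null vector of degree `n`. -/
theorem exists_dual_system {P : LinPencil} {n : ℕ} (hmin : P.nullChains n = ⊥) {v : ℕ → P.V}
    (hv : v ∈ P.nullChains (n + 1)) (hv0 : v (n + 1) ≠ 0) :
    ∃ β : Fin (n + 1) → P.W →ₗ[ℂ] ℂ,
      (∀ (i : Fin n) (w : P.V), β i.castSucc (P.S w) + β i.succ (P.R w) = 0) ∧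
      ∀ i j : Fin (n + 1), β i (P.S (v (j + 1))) = if i = j then 1 else 0 := by
  classical
  obtain ⟨hv1, hv2, hv3⟩ := mem_nullChains.mp hv
  -- The conditions on `β`, as a functional on `W ^ (n + 1)`, prescribe its values `τ` on the image
  -- of the following map `F`; they are consistent if `τ` vanishes on the kernel of `F`.
  let F : (ℕ → P.V) × (Fin (n + 1) → Fin (n + 1) → ℂ) →ₗ[ℂ] (Fin (n + 1) → P.W) :=
    LinearMap.pi fun i =>
      ((if (i : ℕ) < n then P.S ∘ₗ LinearMap.proj (i : ℕ) else 0) +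
        (if (i : ℕ) = 0 then 0 else P.R ∘ₗ LinearMap.proj ((i : ℕ) - 1))) ∘ₗ
          LinearMap.fst ℂ _ _ +
      (∑ j : Fin (n + 1), LinearMap.toSpanSingleton ℂ P.W (P.S (v (j + 1))) ∘ₗ
        (LinearMap.proj j ∘ₗ LinearMap.proj i)) ∘ₗ LinearMap.snd ℂ _ _
  let τ : (ℕ → P.V) × (Fin (n + 1) → Fin (n + 1) → ℂ) →ₗ[ℂ] ℂ :=
    (∑ i : Fin (n + 1), LinearMap.proj i ∘ₗ LinearMap.proj i) ∘ₗ LinearMap.snd ℂ _ _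
  have hF : ∀ a c i, F (a, c) i = (if (i : ℕ) < n then P.S (a i) else 0) +
      (if (i : ℕ) = 0 then 0 else P.R (a ((i : ℕ) - 1))) +
      ∑ j : Fin (n + 1), c i j • P.S (v (j + 1)) := by
    intro a c i
    simp only [F, LinearMap.pi_apply, LinearMap.add_apply, LinearMap.comp_apply,
      LinearMap.fst_apply, LinearMap.snd_apply, LinearMap.sum_apply, LinearMap.proj_apply,
      LinearMap.toSpanSingleton_apply]
    congr 2 <;> split_ifs <;> rfl
  have hτ : ∀ a c, τ (a, c) = ∑ i, c i i := by
    intro a c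
    simp [τ]
  have hker : ∀ u, F u = 0 → τ u = 0 := by
    rintro ⟨a, c⟩ hu
    have hu' : ∀ i : Fin (n + 1), _ := fun i => (hF a c i).symm.trans (congrFun hu i)
    rw [hτ]
    -- An element of the kernel gives a null chain of degree `n`, hence zero; its last vector is
    -- `(∑ c i i) v_{n+1}`.
    let z : ℕ → P.V := fun k => (if k < n then a k else 0) +
      ∑ i : Fin (n + 1), ∑ l : Fin (n + 1), c i l • shiftChain v i l k
    have hz : z ∈ P.nullChains n := by
      rw [mem_nullChains]
      refine ⟨fun k hk => ?_, ?_, fun k => ?_⟩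
      · simp only [z]
        rw [if_neg (by omega), zero_add]
        refine Finset.sum_eq_zero fun i _ => Finset.sum_eq_zero fun l _ => ?_
        have : shiftChain v i l k = 0 := by
          unfold shiftChain
          split_ifs
          · exact hv1 _ (by omega)
          · rfl
          · omega
          · rfl
        rw [this, smul_zero]
      · have h1 := hu' 0
        simp only [z, map_add, map_sum, map_smul, shiftChain_zero hv2]
        simp only [Fin.val_zero, if_true, add_zero, Pi.zero_apply] at h1
        refine Eq.trans ?_ h1
        congr 1
        · rw [apply_ite P.S, map_zero]
          rfl
        · rw [Finset.sum_eq_single 0]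
          · simp
          · intro i _ hi
            simp [hi]
          · simp
      · simp only [z, map_add, map_sum, map_smul]
        rw [add_add_add_comm, ← Finset.sum_add_distrib]
        simp only [← Finset.sum_add_distrib, ← smul_add, shiftChain_succ hv2 hv3]
        by_cases hk : k < n
        · have h1 := hu' ⟨k + 1, by omega⟩
          simp only [Nat.add_eq_zero_iff, one_ne_zero, and_false, if_false, Pi.zero_apply,
            Nat.add_sub_cancel] at h1
          refine Eq.trans ?_ h1
          rw [if_pos hk]
          congr 1
          · rw [add_comm, apply_ite P.S, map_zero]
          · rw [Finset.sum_eq_single ⟨k + 1, by omega⟩]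
            · simp
            · intro i _ hi
              have : (i : ℕ) ≠ k + 1 := fun h => hi (Fin.ext h)
              simp [this]
            · simp
        · rw [if_neg hk, if_neg (by omega), map_zero, map_zero, add_zero, zero_add]
          refine Finset.sum_eq_zero fun i _ => Finset.sum_eq_zero fun l _ => ?_
          rw [if_neg (by omega), smul_zero]
    rw [hmin, Submodule.mem_bot] at hz
    have hzn : z n = (∑ i, c i i) • v (n + 1) := by
      simp only [z, lt_irrefl, if_false, zero_add, Finset.sum_smul]
      refine Finset.sum_congr rfl fun i _ => ?_
      rw [Finset.sum_eq_single i]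
      · unfold shiftChain
        rw [if_pos le_rfl, if_pos (by omega), show n + i + 1 - (i : ℕ) = n + 1 by omega]
      · intro l _ hl
        have hl' : (l : ℕ) ≠ i := fun h => hl (Fin.ext h)
        have : shiftChain v i l n = 0 := by
          unfold shiftChain
          split_ifs
          · exact hv1 _ (by omega)
          · omega
          · omega
          · rfl
        rw [this, smul_zero]
      · simp
    rw [hz] at hzn
    exact (smul_eq_zero.mp hzn.symm).resolve_right hv0
  obtain ⟨G, hG⟩ := exists_dual_comp_eq F τ hker
  refine ⟨fun i => G ∘ₗ LinearMap.single ℂ (fun _ => P.W) i, fun i w => ?_, fun i j => ?_⟩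
  · have h1 := hG (Pi.single (i : ℕ) w, 0)
    rw [hτ] at h1
    simp only [Pi.zero_apply, Finset.sum_const_zero] at h1
    rw [← h1]
    simp only [LinearMap.comp_apply, ← map_add, LinearMap.single_apply]
    congr 1
    ext j
    rw [hF]
    simp only [Pi.zero_apply, zero_smul, Finset.sum_const_zero, add_zero, Pi.add_apply,
      Pi.single_apply, Fin.ext_iff, Fin.val_castSucc, Fin.val_succ]
    congr 1
    · by_cases h : (j : ℕ) = i
      · simp [h]
      · simp [h]
    · by_cases h : (j : ℕ) = i + 1
      · simp [h]
      · rw [if_neg h]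
        split_ifs with h2 h3
        · rfl
        · omega
        · simp
  · have h1 := hG (0, Pi.single i (Pi.single j 1))
    rw [hτ] at h1
    have h2 : (∑ k, (Pi.single i (Pi.single j 1) : Fin (n + 1) → Fin (n + 1) → ℂ) k k) =
        if i = j then 1 else 0 := by
      rw [Finset.sum_eq_single i]
      · simp [Pi.single_apply]
      · intro k _ hk
        simp [hk]
      · simp
    rw [← h2, ← h1]
    simp only [LinearMap.comp_apply, LinearMap.single_apply]
    congr 1
    ext k
    rw [hF]
    by_cases hk : k = i
    · subst hk
      simp
    · simp [hk]

/-- A null chain of minimal degree `n` spans a direct summand `L_n`. -/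
theorem exists_iso_lBlock_prod {P : LinPencil} {n : ℕ} (hmin : ∀ d < n, P.nullChains d = ⊥)
    (hn : P.nullChains n ≠ ⊥) : ∃ Q : LinPencil, Iso P ((lBlock n).prod Q) := by
  obtain ⟨v, hv, hne⟩ := Submodule.exists_mem_ne_zero_of_ne_bot hn
  obtain ⟨hv1, hv2, hv3⟩ := mem_nullChains.mp hv
  have hRn : P.R (v n) = 0 := by
    have := hv3 n
    rwa [hv1 (n + 1) (by omega), map_zero, add_zero] at this
  have hvn : v n ≠ 0 := by
    intro h
    rcases n with _ | n
    · refine hne (funext fun k => ?_)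
      rcases Nat.eq_zero_or_pos k with rfl | hk
      · exact h
      · exact hv1 k hk
    · have : v ∈ P.nullChains n := by
        refine mem_nullChains.mpr ⟨fun k hk => ?_, hv2, hv3⟩
        rcases Nat.lt_or_ge (n + 1) k with h1 | h1
        · exact hv1 k h1
        · obtain rfl : k = n + 1 := by omega
          exact h
      rw [hmin n (by omega)] at this
      exact hne this
  -- The embedding of `L_n` is given by the chain, the retraction by the dual system.
  let i : (Fin (n + 1) → ℂ) →ₗ[ℂ] P.V := Fintype.linearCombination ℂ fun j => v j
  let j : (Fin n → ℂ) →ₗ[ℂ] P.W := Fintype.linearCombination ℂ fun j => P.S (v (j + 1))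
  have hi : ∀ c, i c = ∑ k : Fin (n + 1), c k • v k := fun c =>
    Fintype.linearCombination_apply ℂ _ c
  have hj : ∀ c, j c = ∑ k : Fin n, c k • P.S (v (k + 1)) := fun c =>
    Fintype.linearCombination_apply ℂ _ c
  have hiS : ∀ c, j ((lBlock n).S c) = P.S (i c) := by
    intro c
    rw [hi, hj, Fin.sum_univ_succ]
    simp [hv2]
  have hiR : ∀ c, j ((lBlock n).R c) = P.R (i c) := by
    intro c
    rw [hi, hj, Fin.sum_univ_castSucc]
    simp only [map_add, map_sum, map_smul, Fin.val_last, hRn, smul_zero, add_zero]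
    refine Finset.sum_congr rfl fun k _ => ?_
    rw [Fin.val_castSucc, eq_neg_of_add_eq_zero_left (hv3 k)]
    simp
  rcases n with _ | n
  · obtain ⟨φ, hφ⟩ := exists_dual_comp_eq (LinearMap.toSpanSingleton ℂ P.V (v 0)) LinearMap.id
      (fun u hu => by simpa [hvn] using hu)
    have hφ1 : φ (v 0) = 1 := by simpa using hφ 1
    refine exists_iso_prod_of_retract i j hiR hiS (LinearMap.pi fun _ => φ) 0
      (fun _ => Subsingleton.elim _ _) (fun _ => Subsingleton.elim _ _) ?_
      (fun _ _ _ => Subsingleton.elim _ _)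
    intro c c' h
    have := congrFun h 0
    simp only [LinearMap.comp_apply, hi, LinearMap.pi_apply] at this
    funext k
    fin_cases k
    simpa [hφ1] using this
  · obtain ⟨β, hβ1, hβ2⟩ := exists_dual_system (hmin n (by omega)) hv hvn
    let b : P.W →ₗ[ℂ] (Fin (n + 1) → ℂ) := LinearMap.pi β
    let a : P.V →ₗ[ℂ] (Fin (n + 2) → ℂ) :=
      LinearMap.pi (Fin.cons (-(β 0 ∘ₗ P.R)) fun k => β k ∘ₗ P.S)
    have ha0 : ∀ w, a w 0 = -β 0 (P.R w) := fun w => rfl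
    have ha1 : ∀ w (k : Fin (n + 1)), a w k.succ = β k (P.S w) := fun w k => rfl
    have hbj : ∀ c, b (j c) = c := by
      intro c
      rw [hj]
      funext k
      simp [b, hβ2]
    have haS : ∀ w, b (P.S w) = (lBlock (n + 1)).S (a w) := fun w => rfl
    have haR : ∀ w, b (P.R w) = (lBlock (n + 1)).R (a w) := by
      intro w
      funext k
      change β k (P.R w) = -a w k.castSucc
      induction k using Fin.cases with
      | zero => rw [Fin.castSucc_zero, ha0, neg_neg]
      | succ k =>
        rw [← Fin.succ_castSucc, ha1]
        exact (neg_eq_of_add_eq_zero_right (hβ1 k w)).symm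
    have hai : ∀ c, a (i c) = c := by
      intro c
      have h1 : ∀ k : Fin (n + 1), a (i c) k.succ = c k.succ := fun k => by
        have := congrFun (haS (i c)) k
        rw [← hiS, hbj] at this
        exact this.symm
      have h2 : a (i c) 0 = c 0 := by
        have := congrFun (haR (i c)) 0
        rw [← hiR, hbj] at this
        exact (neg_injective this).symm
      funext k
      induction k using Fin.cases with
      | zero => exact h2
      | succ k => exact h1 k
    refine exists_iso_prod_of_retract i j hiR hiS a b haR haS ?_ ?_
    · exact fun c c' h => by rw [← hai c, ← hai c']; exact h
    · exact fun c c' h => by rw [← hbj c, ← hbj c']; exact h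

/-! ### Splitting off a Jordan block -/

/-- The Jordan block of size `s` to the eigenvalue `x`, as the pencil with `S = 1` and
`R = -(x + N)`. -/
abbrev jBlock (x : ℂ) (s : ℕ) : LinPencil where
  V := Fin s → ℂ
  W := Fin s → ℂ
  R := -LinearMap.pi fun k : Fin s => x • LinearMap.proj k +
    if h : (k : ℕ) = 0 then 0 else LinearMap.proj (⟨k - 1, by omega⟩ : Fin s)
  S := LinearMap.id

theorem chains_le_succ (P : LinPencil) (x : ℂ) (s : ℕ) :
    P.chains x s ≤ P.chains x (s + 1) := fun _ hu => ⟨fun k hk => hu.1 k (by omega), hu.2⟩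

/-- If `S` is bijective, a chain of maximal length spans a direct summand that is a Jordan block. -/
theorem exists_iso_jBlock_prod {P : LinPencil} (hS : Function.Bijective P.S) {x : ℂ} {s : ℕ}
    (h1 : P.chains x (s + 1) ≠ P.chains x s) (h2 : P.chains x (s + 2) = P.chains x (s + 1)) :
    ∃ Q : LinPencil, Iso P ((jBlock x (s + 1)).prod Q) := by
  obtain ⟨u, hu, hus⟩ : ∃ u ∈ P.chains x (s + 1), u s ≠ 0 := by
    by_contra! hcon
    refine h1 (le_antisymm (fun u hu => ⟨fun k hk => ?_, hu.2⟩) (chains_le_succ P x s))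
    rcases hk.eq_or_lt with rfl | hk
    · exact hcon u hu
    · exact hu.1 k hk
  let E : P.V ≃ₗ[ℂ] P.W := LinearEquiv.ofBijective P.S hS
  let T : P.V →ₗ[ℂ] P.V := -(E.symm.toLinearMap ∘ₗ P.R)
  have hT : ∀ v, P.R v = -P.S (T v) := by
    intro v
    have : P.S (E.symm (P.R v)) = P.R v := E.apply_symm_apply (P.R v)
    simp [T, this]
  let D : Module.End ℂ P.V := T - x • LinearMap.id
  have hD : ∀ v, T v = x • v + D v := fun v => by simp [D]
  have hchain : ∀ v w, P.R v + P.S (x • v + w) = 0 ↔ w = D v := by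
    intro v w
    rw [hT, neg_add_eq_zero, hS.1.eq_iff, hD, add_right_inj, eq_comm]
  have hu1 : ∀ k, u (k + 1) = D (u k) := fun k => (hchain _ _).mp (hu.2 k)
  have hpow : ∀ m k, (D ^ m) (u k) = u (k + m) := by
    intro m
    induction m with
    | zero => intro k; simp
    | succ m ih => intro k; rw [pow_succ', Module.End.mul_apply, ih, ← hu1]; rfl
  have hrange : ∀ z, (D ^ (s + 1)) z ≠ u s := by
    intro z hz
    have hz2 : (fun k => (D ^ k) z) ∈ P.chains x (s + 2) := by
      refine ⟨fun k hk => ?_, fun k => (hchain _ _).mpr ?_⟩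
      · obtain ⟨m, rfl⟩ := Nat.exists_eq_add_of_le hk
        change (D ^ (s + 2 + m)) z = 0
        rw [show s + 2 + m = (m + 1) + (s + 1) by omega, pow_add, Module.End.mul_apply, hz, hpow]
        exact hu.1 _ (by omega)
      · change (D ^ (k + 1)) z = D ((D ^ k) z)
        rw [pow_succ', Module.End.mul_apply]
    rw [h2] at hz2
    exact hus (hz ▸ hz2.1 (s + 1) le_rfl)
  -- With `φ (u s) = 1` and `φ ∘ D ^ (s + 1) = 0`, the functionals `φ ∘ D ^ (s - k)` form a
  -- morphism to the Jordan block, triangular on the chain.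
  obtain ⟨φ, hφ⟩ := exists_dual_comp_eq
    (LinearMap.coprod (LinearMap.toSpanSingleton ℂ P.V (u s)) (D ^ (s + 1)))
    (LinearMap.fst ℂ ℂ P.V) (by
      rintro ⟨c, z⟩ hcz
      simp only [LinearMap.coprod_apply, LinearMap.toSpanSingleton_apply] at hcz
      by_contra hc
      simp only [LinearMap.fst_apply] at hc
      refine hrange (-c⁻¹ • z) ?_
      rw [map_smul, eq_neg_of_add_eq_zero_right hcz, smul_neg, neg_smul, neg_neg, smul_smul,
        inv_mul_cancel₀ hc, one_smul])
  have hφ1 : φ (u s) = 1 := by simpa using hφ (1, 0)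
  have hφ0 : ∀ z, φ ((D ^ (s + 1)) z) = 0 := fun z => by simpa using hφ (0, z)
  let i : (Fin (s + 1) → ℂ) →ₗ[ℂ] P.V := Fintype.linearCombination ℂ fun j => u j
  have hi : ∀ c, i c = ∑ k : Fin (s + 1), c k • u k := fun c =>
    Fintype.linearCombination_apply ℂ _ c
  let a : P.V →ₗ[ℂ] (Fin (s + 1) → ℂ) := LinearMap.pi fun k => φ ∘ₗ (D ^ (s - (k : ℕ)))
  have ha : ∀ v k, a v k = φ ((D ^ (s - (k : ℕ))) v) := fun v k => rfl
  have hinj : Function.Injective (a ∘ₗ i) := by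
    rw [← LinearMap.ker_eq_bot, LinearMap.ker_eq_bot']
    intro c hc
    have key : ∀ m, ∀ k : Fin (s + 1), (k : ℕ) = m → c k = 0 := by
      intro m
      induction m using Nat.strong_induction_on with
      | _ m ih =>
        intro k hk
        have h3 := congrFun hc k
        rw [LinearMap.comp_apply, ha, hi, map_sum, map_sum, Finset.sum_eq_single k] at h3
        · rw [map_smul, map_smul, hpow, show (k : ℕ) + (s - k) = s by omega, hφ1] at h3
          simpa using h3
        · intro j _ hj
          rcases lt_or_gt_of_ne (Fin.val_ne_of_ne hj) with hlt | hgt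
          · rw [ih j (hk ▸ hlt) j rfl, zero_smul, map_zero, map_zero]
          · rw [map_smul, hpow, hu.1 _ (by omega), smul_zero, map_zero]
        · simp
    exact funext fun k => key k k rfl
  have haT : ∀ v k, (jBlock x (s + 1)).R (a v) k = -a (T v) k := by
    intro v k
    simp only [LinearMap.neg_apply, Pi.neg_apply, LinearMap.pi_apply, LinearMap.add_apply,
      LinearMap.smul_apply, LinearMap.proj_apply, ha, hD, map_add, map_smul]
    congr 2
    rw [← Module.End.mul_apply, ← pow_succ]
    split_ifs with h
    · rw [h, Nat.sub_zero, hφ0]; rfl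
    · simp only [LinearMap.proj_apply, ha]
      rw [show s - ((k : ℕ) - 1) = s - k + 1 by omega]
  have hiT : ∀ c, i ((jBlock x (s + 1)).R c) = -T (i c) := by
    intro c
    rw [hi, hi, map_sum]
    simp only [map_smul, hD, ← hu1, Finset.sum_add_distrib]
    simp only [LinearMap.neg_apply, Pi.neg_apply, LinearMap.pi_apply, LinearMap.add_apply,
      LinearMap.smul_apply, LinearMap.proj_apply, neg_smul, add_smul, Finset.sum_neg_distrib,
      Finset.sum_add_distrib]
    congr 2
    · exact Finset.sum_congr rfl fun k _ => smul_assoc x (c k) _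
    · rw [Fin.sum_univ_succ, Fin.sum_univ_castSucc]
      simp [hu.1 (s + 1) le_rfl]
      rfl
  refine exists_iso_prod_of_retract i (P.S ∘ₗ i) (fun c => ?_) (fun c => rfl) a
    (a ∘ₗ E.symm.toLinearMap) (fun v => ?_) (fun v => ?_) hinj ?_
  · rw [LinearMap.comp_apply, hiT, hT, map_neg]
  · funext k
    rw [haT, hT, map_neg, LinearMap.comp_apply]
    have : E.symm (P.S (T v)) = T v := E.symm_apply_apply (T v)
    simp [this]
  · have : E.symm (P.S v) = v := E.symm_apply_apply v
    simp [this]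
  · have : (a ∘ₗ E.symm.toLinearMap) ∘ₗ (P.S ∘ₗ i) = a ∘ₗ i := by
      refine LinearMap.ext fun c => ?_
      exact congrArg a (E.symm_apply_apply (i c))
    rw [this]
    exact hinj

/-! ### Classification by the numbers of chains -/

theorem SameChains.nullChains_eq_bot_iff {P Q : LinPencil} (h : SameChains P Q) (d : ℕ) :
    P.nullChains d = ⊥ ↔ Q.nullChains d = ⊥ := by
  rw [← Submodule.finrank_eq_zero, ← Submodule.finrank_eq_zero, h.nullChains]

theorem SameChains.chains_succ_eq_iff {P Q : LinPencil} (h : SameChains P Q) (x : ℂ) (s : ℕ) :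
    P.chains x (s + 1) = P.chains x s ↔ Q.chains x (s + 1) = Q.chains x s := by
  have key : ∀ P : LinPencil, P.chains x (s + 1) = P.chains x s ↔
      Module.finrank ℂ (P.chains x s) = Module.finrank ℂ (P.chains x (s + 1)) := fun P =>
    ⟨fun h => by rw [h], fun h =>
      (Submodule.eq_of_le_of_finrank_eq (chains_le_succ P x s) h).symm⟩
  rw [key, key, h.chains, h.chains]

/-- If two pencils have as many chains, likewise their transposes, and the same block `X ≠ 0`
splits off both, then the complements inherit all hypotheses of the classification, and the
induction hypothesis applies to them. -/
theorem iso_of_iso_prod {X P Q P' Q' : LinPencil}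
    (IH : ∀ P' Q' : LinPencil,
      Module.finrank ℂ P'.V + Module.finrank ℂ P'.W <
        Module.finrank ℂ P.V + Module.finrank ℂ P.W →
      SameChains P' Q' → SameChains P'.dual Q'.dual → P'.KerLifts → P'.dual.KerLifts →
      Q'.KerLifts → Q'.dual.KerLifts → Iso P' Q')
    (h : SameChains P Q) (h' : SameChains P.dual Q.dual) (hP : P.KerLifts)
    (hP' : P.dual.KerLifts) (hQ : Q.KerLifts) (hQ' : Q.dual.KerLifts)
    (hX : 0 < Module.finrank ℂ X.V) (eP : Iso P (X.prod P')) (eQ : Iso Q (X.prod Q')) :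
    Iso P Q := by
  have eP' := eP.dual.trans (dual_prod X P')
  have eQ' := eQ.dual.trans (dual_prod X Q')
  have hlt : Module.finrank ℂ P'.V + Module.finrank ℂ P'.W <
      Module.finrank ℂ P.V + Module.finrank ℂ P.W := by
    obtain ⟨f, g, -, -⟩ := eP
    have h1 : Module.finrank ℂ P.V = Module.finrank ℂ X.V + Module.finrank ℂ P'.V :=
      f.finrank_eq.trans Module.finrank_prod
    have h2 : Module.finrank ℂ P.W = Module.finrank ℂ X.W + Module.finrank ℂ P'.W :=
      g.finrank_eq.trans Module.finrank_prod
    omega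
  have := IH P' Q' hlt
    ((eP.symm.sameChains.trans h).trans eQ.sameChains).prod_cancel
    ((eP'.symm.sameChains.trans h').trans eQ'.sameChains).prod_cancel
    (hP.of_iso_prod eP) (hP'.of_iso_prod eP') (hQ.of_iso_prod eQ) (hQ'.of_iso_prod eQ')
  exact (eP.trans this.prod_congr_right).trans eQ.symm

/-- The kernel of `S` consists of coefficients of null vectors; without null vectors it vanishes. -/
theorem KerLifts.injective {P : LinPencil} (h : P.KerLifts) (h0 : ∀ d, P.nullChains d = ⊥) :
    Function.Injective P.S := by
  rw [← LinearMap.ker_eq_bot, LinearMap.ker_eq_bot']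
  intro v hv
  obtain ⟨d, u, hu, rfl⟩ := h v hv
  rw [h0, Submodule.mem_bot] at hu
  rw [hu]
  rfl

/-- Pencils without infinite elementary divisors are strictly equivalent if they have as many
chains of every kind, and so do their transposes. -/
theorem iso_of_sameChains (N : ℕ) : ∀ P Q : LinPencil,
    Module.finrank ℂ P.V + Module.finrank ℂ P.W = N →
    SameChains P Q → SameChains P.dual Q.dual → P.KerLifts → P.dual.KerLifts →
    Q.KerLifts → Q.dual.KerLifts → Iso P Q := by
  induction N using Nat.strong_induction_on with
  | _ N IH =>
    -- A null vector of minimal degree splits off both pencils.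
    have step : ∀ P Q : LinPencil, Module.finrank ℂ P.V + Module.finrank ℂ P.W = N →
        SameChains P Q → SameChains P.dual Q.dual → P.KerLifts → P.dual.KerLifts →
        Q.KerLifts → Q.dual.KerLifts → (∃ d, P.nullChains d ≠ ⊥) → Iso P Q := by
      intro P Q hN h h' hP hP' hQ hQ' hd
      classical
      have hmin := fun d hd' => not_not.mp (Nat.find_min hd (m := d) hd')
      obtain ⟨P', eP⟩ := exists_iso_lBlock_prod hmin (Nat.find_spec hd)
      obtain ⟨Q', eQ⟩ := exists_iso_lBlock_prod (P := Q)
        (fun d hd' => (h.nullChains_eq_bot_iff d).mp (hmin d hd'))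
        (fun hb => Nat.find_spec hd ((h.nullChains_eq_bot_iff _).mpr hb))
      refine iso_of_iso_prod (fun P' Q' hlt => IH _ (hN ▸ hlt) P' Q' rfl) h h' hP hP' hQ hQ' ?_
        eP eQ
      simp
    intro P Q hN h h' hP hP' hQ hQ'
    by_cases hd : ∃ d, P.nullChains d ≠ ⊥
    · exact step P Q hN h h' hP hP' hQ hQ' hd
    by_cases hd' : ∃ d, P.dual.nullChains d ≠ ⊥
    · refine (iso_dual_dual P).trans (Iso.trans (Iso.dual ?_) (iso_dual_dual Q).symm)
      refine (step P.dual Q.dual ?_ h' ?_ hP' (hP.of_iso (iso_dual_dual P)) hQ'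
        (hQ.of_iso (iso_dual_dual Q)) hd')
      · rw [Subspace.dual_finrank_eq, Subspace.dual_finrank_eq, add_comm, hN]
      · exact ((iso_dual_dual P).symm.sameChains.trans h).trans (iso_dual_dual Q).sameChains
    push Not at hd hd'
    have hSP : Function.Bijective P.S :=
      ⟨hP.injective hd, LinearMap.dualMap_injective_iff.mp (hP'.injective hd')⟩
    have hSQ : Function.Bijective Q.S :=
      ⟨hQ.injective fun d => (h.nullChains_eq_bot_iff d).mp (hd d),
        LinearMap.dualMap_injective_iff.mp
          (hQ'.injective fun d => (h'.nullChains_eq_bot_iff d).mp (hd' d))⟩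
    rcases subsingleton_or_nontrivial P.V with hV | hV
    · have hQV : Subsingleton Q.V := by
        rw [← Module.finrank_zero_iff (R := ℂ), ← h.finrank_V, Module.finrank_zero_iff]
        exact hV
      have hPW : Subsingleton P.W := hSP.2.subsingleton
      have hQW : Subsingleton Q.W := hSQ.2.subsingleton
      exact ⟨0, 0, fun _ => Subsingleton.elim _ _, fun _ => Subsingleton.elim _ _⟩
    -- Now `S` is bijective in both pencils. A chain of maximal length at an eigenvalue `x` of
    -- `-S⁻¹ R` splits off both.
    let T : Module.End ℂ P.V := -((LinearEquiv.ofBijective P.S hSP).symm.toLinearMap ∘ₗ P.R)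
    obtain ⟨x, hx⟩ := Module.End.exists_eigenvalue T
    obtain ⟨v, hv⟩ := hx.exists_hasEigenvector
    have hv1 : P.R v + P.S (x • v) = 0 := by
      have h3 : P.S ((LinearEquiv.ofBijective P.S hSP).symm (P.R v)) = P.R v :=
        (LinearEquiv.ofBijective P.S hSP).apply_symm_apply (P.R v)
      rw [← hv.apply_eq_smul]
      simp [T, h3]
    have h01 : P.chains x 1 ≠ P.chains x 0 := by
      intro heq
      have : (Pi.single 0 v : ℕ → P.V) ∈ P.chains x 1 := by
        refine ⟨fun k hk => Pi.single_eq_of_ne (by omega) _, fun k => ?_⟩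
        rcases Nat.eq_zero_or_pos k with rfl | hk
        · simpa using hv1
        · simp [hk.ne']
      rw [heq] at this
      exact hv.2 (by simpa using this.1 0 le_rfl)
    have hstab : ∃ s, P.chains x (s + 1) = P.chains x s := by
      by_contra! hcon
      have hgrow : ∀ s, s ≤ Module.finrank ℂ (P.chains x s) := by
        intro s
        induction s with
        | zero => exact Nat.zero_le _
        | succ s ih =>
          exact Nat.succ_le_of_lt (lt_of_le_of_lt ih (Submodule.finrank_lt_finrank_of_lt
            (lt_of_le_of_ne (chains_le_succ P x s) (hcon s).symm)))
      let F : ∀ s, P.chains x s →ₗ[ℂ] P.V := fun s =>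
        LinearMap.proj 0 ∘ₗ (P.chains x s).subtype
      have hF : ∀ s, Function.Injective (F s) := by
        intro s a b hab
        refine Subtype.ext (funext fun k => ?_)
        induction k with
        | zero => exact hab
        | succ k ih =>
          refine hSP.1 ?_
          have ha := a.2.2 k
          have hb := b.2.2 k
          rw [map_add, ← add_assoc] at ha hb
          rw [eq_neg_of_add_eq_zero_right ha, eq_neg_of_add_eq_zero_right hb, ih]
      have := LinearMap.finrank_le_finrank_of_injective (hF (Module.finrank ℂ P.V + 1))
      have := hgrow (Module.finrank ℂ P.V + 1)
      omega
    classical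
    obtain ⟨s, hs⟩ : ∃ s, Nat.find hstab = s + 1 :=
      Nat.exists_eq_succ_of_ne_zero fun h0 => h01 ((Nat.find_eq_zero hstab).mp h0)
    have hs1 : P.chains x (s + 1) ≠ P.chains x s := Nat.find_min hstab (by omega)
    have hs2 : P.chains x (s + 2) = P.chains x (s + 1) := by
      have := Nat.find_spec hstab
      rwa [hs] at this
    obtain ⟨P', eP⟩ := exists_iso_jBlock_prod hSP hs1 hs2
    obtain ⟨Q', eQ⟩ := exists_iso_jBlock_prod hSQ (mt (h.chains_succ_eq_iff x s).mpr hs1)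
      ((h.chains_succ_eq_iff x (s + 1)).mp hs2)
    refine iso_of_iso_prod (fun P' Q' hlt => IH _ (hN ▸ hlt) P' Q' rfl) h h' hP hP' hQ hQ' ?_
      eP eQ
    simp

end LinPencil

/-! ### Divisibility of minors -/

/-- `G` divides all `k × k` minors of `P`; rows and columns may be listed in any order and with
repetitions. For `G = 0` this says that the minors vanish. -/
def DvdMinors {A ι κ : Type*} [CommRing A] (G : A) (k : ℕ) (P : Matrix ι κ A) : Prop :=
  ∀ (f : Fin k → ι) (g : Fin k → κ), G ∣ (P.submatrix f g).det

section

variable {A ι κ : Type*} [CommRing A]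

theorem DvdMinors.transpose {G : A} {k : ℕ} {P : Matrix ι κ A} (h : DvdMinors G k P) :
    DvdMinors G k P.transpose := by
  intro f g
  rw [← Matrix.det_transpose]
  exact h g f

theorem dvdMinors_transpose_iff {G : A} {k : ℕ} {P : Matrix ι κ A} :
    DvdMinors G k P.transpose ↔ DvdMinors G k P :=
  ⟨fun h => by simpa using h.transpose, DvdMinors.transpose⟩

/-- Expansion by multilinearity in the rows, as in the Cauchy–Binet formula. -/
theorem det_sum_rows {k : ℕ} {l : Type*} [Fintype l] (X : Fin k → l → A) (P : l → Fin k → A) :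
    (Matrix.of fun i j => ∑ a, X i a * P a j).det =
      ∑ r : Fin k → l, (∏ i, X i (r i)) * (Matrix.of fun i j => P (r i) j).det := by
  classical
  have h := (Matrix.detRowAlternating (n := Fin k) (R := A)).toMultilinearMap.map_sum
    (fun i (a : l) => X i a • P a)
  have h2 : (fun i => ∑ a, X i a • P a) = (Matrix.of fun i j => ∑ a, X i a * P a j) := by
    ext i j
    simp [Finset.sum_apply]
  rw [h2] at h
  refine h.trans (Finset.sum_congr rfl fun r _ => ?_)
  rw [MultilinearMap.map_smul_univ]
  rfl

theorem DvdMinors.mul_left {G : A} {k : ℕ} {ι' : Type*} [Fintype ι] {P : Matrix ι κ A}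
    (h : DvdMinors G k P) (X : Matrix ι' ι A) : DvdMinors G k (X * P) := by
  intro f g
  have : (X * P).submatrix f g = Matrix.of fun i j => ∑ a, X (f i) a * P a (g j) := by
    ext i j
    simp [Matrix.mul_apply]
  rw [this, det_sum_rows (fun i a => X (f i) a) (fun a j => P a (g j))]
  exact Finset.dvd_sum fun r _ => (h r g).mul_left _

theorem DvdMinors.mul_right {G : A} {k : ℕ} {κ' : Type*} [Fintype κ] {P : Matrix ι κ A}
    (h : DvdMinors G k P) (Y : Matrix κ κ' A) : DvdMinors G k (P * Y) := by
  rw [← dvdMinors_transpose_iff, Matrix.transpose_mul]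
  exact h.transpose.mul_left _

theorem DvdMinors.map {A' : Type*} [CommRing A'] {G : A} {k : ℕ} {P : Matrix ι κ A}
    (h : DvdMinors G k P) (θ : A →+* A') : DvdMinors (θ G) k (P.map θ) := by
  intro f g
  have : (P.map θ).submatrix f g = θ.mapMatrix (P.submatrix f g) := rfl
  rw [this, ← RingHom.map_det]
  exact map_dvd θ (h f g)

/-- Rows and columns in increasing order suffice, since sorting changes the sign of a minor only and
a repetition makes it vanish. -/
theorem dvdMinors_of_orderEmb {m n : ℕ} {G : A} {k : ℕ} {P : Matrix (Fin m) (Fin n) A}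
    (h : ∀ (f : Fin k ↪o Fin m) (g : Fin k ↪o Fin n), G ∣ (P.submatrix f g).det) :
    DvdMinors G k P := by
  intro f g
  by_cases hf : Function.Injective f
  · by_cases hg : Function.Injective g
    · have sorted : ∀ {l : ℕ} (f : Fin k → Fin l), Function.Injective f →
          ∃ (e : Fin k ↪o Fin l) (σ : Equiv.Perm (Fin k)), f = e ∘ σ := by
        intro l f hf
        refine ⟨OrderEmbedding.ofStrictMono (f ∘ Tuple.sort f)
          ((Tuple.monotone_sort f).strictMono_of_injective (hf.comp (Equiv.injective _))),
          (Tuple.sort f).symm, ?_⟩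
        ext i
        simp
      obtain ⟨e, σ, rfl⟩ := sorted f hf
      obtain ⟨e', σ', rfl⟩ := sorted g hg
      have : P.submatrix (e ∘ σ) (e' ∘ σ') = ((P.submatrix e e').submatrix σ id).submatrix id σ' :=
        rfl
      rw [this, Matrix.det_permute', Matrix.det_permute]
      exact ((h e e').mul_left _).mul_left _
    · obtain ⟨i, j, hij, hne⟩ := Function.not_injective_iff.mp hg
      rw [Matrix.det_zero_of_column_eq hne fun a => by simp [hij]]
      exact dvd_zero _
  · obtain ⟨i, j, hij, hne⟩ := Function.not_injective_iff.mp hf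
    rw [Matrix.det_zero_of_row_eq hne (by ext a; simp [hij])]
    exact dvd_zero _

end

theorem dvdMinors_iff {m n : ℕ} {G : Poly} {k : ℕ} {P : Matrix (Fin m) (Fin n) Poly} :
    DvdMinors G k P ↔ ∀ (f : Fin k ↪o Fin m) (g : Fin k ↪o Fin n), G ∣ minor P k f g :=
  ⟨fun h f g => h f g, dvdMinors_of_orderEmb⟩

theorem le_pencilRank_iff {m n : ℕ} {P : Matrix (Fin m) (Fin n) Poly} {k : ℕ} :
    k ≤ pencilRank P ↔ ¬ DvdMinors 0 k P := by
  simp only [dvdMinors_iff, zero_dvd_iff]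
  push Not
  refine ⟨exists_minor_ne_zero P, fun h => le_csSup ⟨m, ?_⟩ h⟩
  rintro r ⟨f, -, -⟩
  simpa using Fintype.card_le_of_injective f f.injective

theorem dvdMinors_pencil_iff {m n : ℕ} {ψ : State m n} {k : ℕ} (hk : k ≤ pencilRank (pencil ψ))
    {G : Poly} : DvdMinors G k (pencil ψ) ↔ G ∣ detDivisor (pencil ψ) k := by
  have h := isDetDivisor_detDivisor ψ hk
  rw [dvdMinors_iff]
  exact ⟨h.greatest G, fun hG f g => hG.trans (h.dvd_minor f g)⟩

theorem detDivisor_ne_zero {m n : ℕ} {ψ : State m n} {k : ℕ}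
    (hk : k ≤ pencilRank (pencil ψ)) : detDivisor (pencil ψ) k ≠ 0 := fun h =>
  le_pencilRank_iff.mp hk ((dvdMinors_pencil_iff hk).mpr h.symm.dvd)

theorem detDivisor_zero {m n : ℕ} (ψ : State m n) : IsUnit (detDivisor (pencil ψ) 0) := by
  have h := isDetDivisor_detDivisor ψ (Nat.zero_le _)
  have := h.dvd_minor (Fin.castLEOrderEmb (Nat.zero_le m)) (Fin.castLEOrderEmb (Nat.zero_le n))
  rw [minor, Matrix.det_fin_zero] at this
  exact isUnit_of_dvd_one this

theorem pencilRank_congr {m n m' n' : ℕ} {P : Matrix (Fin m) (Fin n) Poly}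
    {Q : Matrix (Fin m') (Fin n') Poly} (h : ∀ k, DvdMinors 0 k P ↔ DvdMinors 0 k Q) :
    pencilRank P = pencilRank Q :=
  eq_of_forall_le_iff fun k => by rw [le_pencilRank_iff, le_pencilRank_iff, h]

/-! ### Linear substitutions and local equivalence -/

/-- The substitution `X_j ↦ ∑ A i j X_i` in `ℂ[μ, λ]`. -/
def linSubst (A : Matrix (Fin 2) (Fin 2) ℂ) : Poly →ₐ[ℂ] Poly :=
  MvPolynomial.aeval fun j => ∑ i, MvPolynomial.C (A i j) * MvPolynomial.X i

theorem linSubst_X (A : Matrix (Fin 2) (Fin 2) ℂ) (j : Fin 2) :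
    linSubst A (MvPolynomial.X j) = ∑ i, MvPolynomial.C (A i j) * MvPolynomial.X i := by
  simp [linSubst]

theorem linSubst_C (A : Matrix (Fin 2) (Fin 2) ℂ) (c : ℂ) :
    linSubst A (MvPolynomial.C c) = MvPolynomial.C c := (linSubst A).commutes c

theorem linSubst_comp (A B : Matrix (Fin 2) (Fin 2) ℂ) (p : Poly) :
    linSubst A (linSubst B p) = linSubst (A * B) p := by
  have : (linSubst A).comp (linSubst B) = linSubst (A * B) := by
    refine MvPolynomial.algHom_ext fun j => ?_
    rw [AlgHom.comp_apply, linSubst_X, linSubst_X]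
    simp only [map_add, map_mul, linSubst_C, linSubst_X, Matrix.mul_apply, Fin.sum_univ_two]
    ring
  rw [← this, AlgHom.comp_apply]

theorem linSubst_one (p : Poly) : linSubst 1 p = p := by
  have : linSubst 1 = AlgHom.id ℂ Poly := by
    refine MvPolynomial.algHom_ext fun j => ?_
    rw [linSubst_X]
    rw [Finset.sum_eq_single j]
    · simp
    · intro i _ hi
      simp [Matrix.one_apply_ne hi]
    · simp
  rw [this, AlgHom.id_apply]

/-- The substitution `linSubst A` for invertible `A`, as an automorphism. -/
def linSubstEquiv (A : GL (Fin 2) ℂ) : Poly ≃ₐ[ℂ] Poly :=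
  AlgEquiv.ofAlgHom (linSubst A) (linSubst (A⁻¹ : GL (Fin 2) ℂ))
    (AlgHom.ext fun p => by
      rw [AlgHom.comp_apply, linSubst_comp, ← Units.val_mul, mul_inv_cancel, Units.val_one,
        linSubst_one, AlgHom.id_apply])
    (AlgHom.ext fun p => by
      rw [AlgHom.comp_apply, linSubst_comp, ← Units.val_mul, inv_mul_cancel, Units.val_one,
        linSubst_one, AlgHom.id_apply])

theorem linSubstEquiv_apply (A : GL (Fin 2) ℂ) (p : Poly) : linSubstEquiv A p = linSubst A p := rfl

theorem pencil_apply {m n : ℕ} (ψ : State m n) (i : Fin m) (j : Fin n) :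
    pencil ψ i j = ∑ α, MvPolynomial.X α * MvPolynomial.C (ψ (α, i, j)) := by
  simp [pencil, mu, lam, Fin.sum_univ_two]

theorem coeff_pencil {m n : ℕ} (ψ : State m n) (α : Fin 2) (i : Fin m) (j : Fin n) :
    MvPolynomial.coeff (Finsupp.single α 1) (pencil ψ i j) = ψ (α, i, j) := by
  rw [pencil_apply, MvPolynomial.coeff_sum]
  simp only [mul_comm (MvPolynomial.X _), MvPolynomial.coeff_C_mul, MvPolynomial.coeff_X]
  rw [Finset.sum_eq_single α]
  · simp
  · intro β _ hβ
    rw [if_neg, mul_zero]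
    exact fun h => hβ (Finsupp.single_left_injective one_ne_zero h)
  · simp

theorem pencil_injective {m n : ℕ} : Function.Injective (pencil : State m n → _) := by
  intro ψ φ h
  funext ⟨α, i, j⟩
  rw [← coeff_pencil ψ, h, coeff_pencil]

/-- A constant matrix, over `ℂ[μ, λ]`. -/
def constMat {ι κ : Type*} (B : Matrix ι κ ℂ) : Matrix ι κ Poly := B.map MvPolynomial.C

/-- The local operators `B`, `D` multiply the pencil on the left and on the right, while `A` acts by
the substitution `μ ↦ A₀₀ μ + A₁₀ λ`, `λ ↦ A₀₁ μ + A₁₁ λ`. -/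
theorem pencil_mulVec {m n : ℕ} (ψ : State m n) (A : Matrix (Fin 2) (Fin 2) ℂ)
    (B : Matrix (Fin m) (Fin m) ℂ) (D : Matrix (Fin n) (Fin n) ℂ) :
    pencil ((A ⊗ₖ (B ⊗ₖ D)).mulVec ψ) =
      constMat B * (pencil ψ).map (linSubst A) * (constMat D).transpose := by
  ext1 i j
  simp only [pencil_apply, Matrix.mulVec, dotProduct, Fintype.sum_prod_type,
    Matrix.kroneckerMap_apply, Matrix.mul_apply, constMat, Matrix.map_apply,
    Matrix.transpose_apply, map_sum, map_mul, linSubst_C, linSubst_X, Finset.sum_mul,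
    Finset.mul_sum]
  have h1 : ∀ F : Fin 2 → Fin 2 → Fin m → Fin n → Poly,
      (∑ a, ∑ b, ∑ k, ∑ l, F a b k l) = ∑ l, ∑ k, ∑ b, ∑ a, F a b k l := by
    intro F
    calc _ = ∑ a, ∑ b, ∑ l, ∑ k, F a b k l := by
          refine Finset.sum_congr rfl fun a _ => Finset.sum_congr rfl fun b _ => Finset.sum_comm
      _ = ∑ a, ∑ l, ∑ b, ∑ k, F a b k l := Finset.sum_congr rfl fun a _ => Finset.sum_comm
      _ = ∑ l, ∑ a, ∑ b, ∑ k, F a b k l := Finset.sum_comm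
      _ = ∑ l, ∑ a, ∑ k, ∑ b, F a b k l :=
          Finset.sum_congr rfl fun l _ => Finset.sum_congr rfl fun a _ => Finset.sum_comm
      _ = ∑ l, ∑ k, ∑ a, ∑ b, F a b k l := Finset.sum_congr rfl fun l _ => Finset.sum_comm
      _ = _ := Finset.sum_congr rfl fun l _ => Finset.sum_congr rfl fun k _ => Finset.sum_comm
  rw [h1]
  refine Finset.sum_congr rfl fun l _ => Finset.sum_congr rfl fun k _ =>
    Finset.sum_congr rfl fun b _ => Finset.sum_congr rfl fun a _ => ?_
  ring

theorem sloccEquiv_iff {m n : ℕ} {ψ φ : State m n} : SLOCCEquiv ψ φ ↔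
    ∃ (A : GL (Fin 2) ℂ) (B : GL (Fin m) ℂ) (D : GL (Fin n) ℂ),
      pencil φ = constMat (B : Matrix (Fin m) (Fin m) ℂ) * (pencil ψ).map (linSubst A) *
        (constMat (D : Matrix (Fin n) (Fin n) ℂ)).transpose := by
  refine exists_congr fun A => exists_congr fun B => exists_congr fun D => ?_
  rw [← pencil_mulVec, pencil_injective.eq_iff]

theorem constMat_mul {ι κ l : Type*} [Fintype κ] (B : Matrix ι κ ℂ) (D : Matrix κ l ℂ) :
    constMat (B * D) = constMat B * constMat D := Matrix.map_mul

theorem constMat_one {ι : Type*} [DecidableEq ι] : constMat (1 : Matrix ι ι ℂ) = 1 :=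
  Matrix.map_one _ (map_zero _) (map_one _)

theorem constMat_inv_mul {k : ℕ} (B : GL (Fin k) ℂ) :
    constMat ((B⁻¹ : GL (Fin k) ℂ) : Matrix (Fin k) (Fin k) ℂ) *
      constMat (B : Matrix (Fin k) (Fin k) ℂ) = 1 := by
  rw [← constMat_mul, ← Units.val_mul, inv_mul_cancel, Units.val_one, constMat_one]

theorem dvdMinors_linSubst_iff {m n : ℕ} {ψ φ : State m n} {A : GL (Fin 2) ℂ} {B : GL (Fin m) ℂ}
    {D : GL (Fin n) ℂ}
    (h : pencil φ = constMat (B : Matrix (Fin m) (Fin m) ℂ) * (pencil ψ).map (linSubst A) *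
        (constMat (D : Matrix (Fin n) (Fin n) ℂ)).transpose) (G : Poly) (k : ℕ) :
    DvdMinors (linSubst A G) k (pencil φ) ↔ DvdMinors G k (pencil ψ) := by
  constructor
  · intro hG
    have h1 : (pencil ψ).map (linSubst A) =
        constMat ((B⁻¹ : GL (Fin m) ℂ) : Matrix (Fin m) (Fin m) ℂ) * pencil φ *
          (constMat ((D⁻¹ : GL (Fin n) ℂ) : Matrix (Fin n) (Fin n) ℂ)).transpose := by
      rw [h, ← Matrix.mul_assoc, ← Matrix.mul_assoc, constMat_inv_mul, Matrix.one_mul,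
        Matrix.mul_assoc, ← Matrix.transpose_mul, constMat_inv_mul, Matrix.transpose_one,
        Matrix.mul_one]
    have h2 := (hG.mul_left (constMat ((B⁻¹ : GL (Fin m) ℂ) : Matrix (Fin m) (Fin m) ℂ))).mul_right
      (constMat ((D⁻¹ : GL (Fin n) ℂ) : Matrix (Fin n) (Fin n) ℂ)).transpose
    rw [← h1] at h2
    have h3 := h2.map (linSubstEquiv A).symm.toRingEquiv.toRingHom
    have h4 : ∀ p, (linSubstEquiv A).symm.toRingEquiv.toRingHom (linSubst A p) = p :=
      (linSubstEquiv A).symm_apply_apply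
    rw [h4] at h3
    convert h3 using 1
    ext1 i j
    exact (h4 _).symm
  · intro hG
    rw [h]
    exact ((hG.map (linSubst A).toRingHom).mul_left _).mul_right _

/-! ### Linear forms and elementary divisors -/

/-- The linear form `μ x + λ`. -/
def rootForm (x : ℂ) : Poly := mu * MvPolynomial.C x + lam

theorem prime_mu : Prime mu := MvPolynomial.X_prime

theorem linSubst_mu (A : Matrix (Fin 2) (Fin 2) ℂ) :
    linSubst A mu = mu * MvPolynomial.C (A 0 0) + lam * MvPolynomial.C (A 1 0) := by
  rw [mu, linSubst_X, Fin.sum_univ_two, lam]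
  ring

theorem linSubst_rootForm (A : Matrix (Fin 2) (Fin 2) ℂ) (x : ℂ) :
    linSubst A (rootForm x) = mu * MvPolynomial.C (A 0 0 * x + A 0 1) +
      lam * MvPolynomial.C (A 1 0 * x + A 1 1) := by
  rw [rootForm, map_add, map_mul, linSubst_C, linSubst_mu, lam, linSubst_X, Fin.sum_univ_two, mu]
  simp only [map_add, map_mul]
  ring

theorem linForm_eq (a b : ℂ) (hb : b ≠ 0) :
    mu * MvPolynomial.C a + lam * MvPolynomial.C b = rootForm (a / b) * MvPolynomial.C b := by
  rw [rootForm, add_mul, mul_assoc, ← map_mul, div_mul_cancel₀ a hb]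

theorem isUnit_C {b : ℂ} (hb : b ≠ 0) : IsUnit (MvPolynomial.C b : Poly) :=
  (isUnit_iff_ne_zero.mpr hb).map _

theorem associated_linForm (a b : ℂ) (hb : b ≠ 0) :
    Associated (mu * MvPolynomial.C a + lam * MvPolynomial.C b) (rootForm (a / b)) := by
  rw [linForm_eq a b hb]
  exact associated_mul_unit_left _ _ (isUnit_C hb)

theorem prime_rootForm (x : ℂ) : Prime (rootForm x) := by
  let A : GL (Fin 2) ℂ := Matrix.GeneralLinearGroup.mkOfDetNeZero !![1, x; 0, 1] (by simp)
  have : linSubstEquiv A lam = rootForm x := by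
    rw [linSubstEquiv_apply, lam, linSubst_X, Fin.sum_univ_two, rootForm, mu, lam]
    simp [A, Matrix.GeneralLinearGroup.mkOfDetNeZero]
    ring
  rw [← this, MulEquiv.prime_iff]
  exact MvPolynomial.X_prime

theorem eval_rootForm (x a b : ℂ) : MvPolynomial.eval ![a, b] (rootForm x) = a * x + b := by
  simp [rootForm, mu, lam]

theorem eq_of_rootForm_dvd {x y : ℂ} (h : rootForm x ∣ rootForm y) : x = y := by
  have := map_dvd (MvPolynomial.eval ![1, -x]) h
  rw [eval_rootForm, eval_rootForm] at this
  have h2 : (1 : ℂ) * x + -x = 0 := by ring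
  rw [h2, zero_dvd_iff] at this
  linear_combination -this

theorem not_rootForm_dvd_mu (x : ℂ) : ¬ rootForm x ∣ mu := by
  intro h
  have := map_dvd (MvPolynomial.eval ![1, -x]) h
  rw [eval_rootForm] at this
  have h2 : (1 : ℂ) * x + -x = 0 := by ring
  rw [h2, zero_dvd_iff] at this
  simp [mu] at this

variable {m n : ℕ}

theorem invPoly_ne_zero {ψ : State m n} {j : ℕ} (hj : j < pencilRank (pencil ψ)) :
    invPoly (pencil ψ) j ≠ 0 := by
  intro h
  have := detDivisor_succ ψ hj
  rw [h, mul_zero] at this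
  exact detDivisor_ne_zero (Nat.succ_le_of_lt hj) this

/-- Multiplicities add up, as `D_k` is the product of the first `k` invariant polynomials up
to a unit. -/
theorem emultiplicity_detDivisor {p : Poly} (hp : Prime p) (ψ : State m n) {k : ℕ}
    (hk : k ≤ pencilRank (pencil ψ)) : emultiplicity p (detDivisor (pencil ψ) k) =
      ∑ j ∈ Finset.range k, emultiplicity p (invPoly (pencil ψ) j) := by
  induction k with
  | zero =>
    rw [Finset.sum_range_zero, emultiplicity_eq_zero]
    exact fun h => hp.not_isUnit (isUnit_of_dvd_unit h (detDivisor_zero ψ))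
  | succ k ih =>
    rw [detDivisor_succ ψ hk, emultiplicity_mul hp, ih (by omega), Finset.sum_range_succ]

theorem invPoly_dvd_detDivisor (ψ : State m n) {j : ℕ} (hj : j < pencilRank (pencil ψ)) :
    invPoly (pencil ψ) j ∣ detDivisor (pencil ψ) (pencilRank (pencil ψ)) := by
  have h1 : invPoly (pencil ψ) j ∣ detDivisor (pencil ψ) (j + 1) := by
    rw [detDivisor_succ ψ hj]
    exact dvd_mul_left _ _
  have h2 : ∀ k, j + 1 ≤ k → k ≤ pencilRank (pencil ψ) →
      invPoly (pencil ψ) j ∣ detDivisor (pencil ψ) k := by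
    intro k hk
    induction k, hk using Nat.le_induction with
    | base => exact fun _ => h1
    | succ k _ ih =>
      intro hk
      rw [detDivisor_succ ψ hk]
      exact (ih (by omega)).mul_right _
  exact h2 _ hj le_rfl

theorem noInfiniteElementaryDivisors_iff {ψ : State m n} :
    NoInfiniteElementaryDivisors (pencil ψ) ↔
      ¬ mu ∣ detDivisor (pencil ψ) (pencilRank (pencil ψ)) := by
  constructor
  · intro h
    rw [← emultiplicity_eq_zero, emultiplicity_detDivisor prime_mu ψ le_rfl]
    exact Finset.sum_eq_zero fun j hj => emultiplicity_eq_zero.mpr (h j (Finset.mem_range.mp hj))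
  · exact fun h j hj hmu => h (hmu.trans (invPoly_dvd_detDivisor ψ hj))

/-- The finite elementary divisors are unique up to renumbering. -/
theorem HasFiniteElementaryDivisors.exists_equiv {P : Matrix (Fin m) (Fin n) Poly} {q q' : ℕ}
    {x : Fin q → ℂ} {e : Fin q → ℕ → ℕ} {y : Fin q' → ℂ} {f : Fin q' → ℕ → ℕ}
    (h : HasFiniteElementaryDivisors P x e) (h' : HasFiniteElementaryDivisors P y f) :
    ∃ σ : Fin q ≃ Fin q', (∀ i, y (σ i) = x i) ∧ ∀ i, ∀ j < pencilRank P, e i j = f (σ i) j := by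
  have hr : Set.range x = Set.range y := by
    ext z
    exact (h.mem_iff z).trans (h'.mem_iff z).symm
  let σ : Fin q ≃ Fin q' := (Equiv.ofInjective x h.injective).trans
    ((Equiv.setCongr hr).trans (Equiv.ofInjective y h'.injective).symm)
  have hσ : ∀ i, y (σ i) = x i := fun i => by
    simp only [σ, Equiv.trans_apply]
    exact Equiv.apply_ofInjective_symm h'.injective _
  refine ⟨σ, hσ, fun i j hj => ?_⟩
  have h1 := h.exponent i j hj
  have h2 := h'.exponent (σ i) j hj
  rw [hσ, h1] at h2
  exact_mod_cast h2

/-- The local invariants at every `x` are determined by the finite elementary divisors. -/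
theorem dvdMinors_rootForm_pow_iff {ψ φ : State m n} {q : ℕ} {x : Fin q → ℂ}
    {e f : Fin q → ℕ → ℕ} (h : HasFiniteElementaryDivisors (pencil ψ) x e)
    (h' : HasFiniteElementaryDivisors (pencil φ) x f)
    (hr : pencilRank (pencil ψ) = pencilRank (pencil φ))
    (hef : ∀ i, ∀ j < pencilRank (pencil ψ), e i j = f i j) (z : ℂ) (s k : ℕ) :
    DvdMinors (rootForm z ^ s) k (pencil ψ) ↔ DvdMinors (rootForm z ^ s) k (pencil φ) := by
  have key : ∀ j < pencilRank (pencil ψ), emultiplicity (rootForm z) (invPoly (pencil ψ) j) =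
      emultiplicity (rootForm z) (invPoly (pencil φ) j) := by
    intro j hj
    by_cases hz : ∃ i, x i = z
    · obtain ⟨i, rfl⟩ := hz
      exact (h.exponent i j hj).trans ((congrArg _ (hef i j hj)).trans
        (h'.exponent i j (hr ▸ hj)).symm)
    · rw [emultiplicity_eq_zero.mpr, emultiplicity_eq_zero.mpr]
      · exact fun hd => hz ((h'.mem_iff z).mpr (hd.trans (invPoly_dvd_detDivisor φ (hr ▸ hj))))
      · exact fun hd => hz ((h.mem_iff z).mpr (hd.trans (invPoly_dvd_detDivisor ψ hj)))
  by_cases hk : k ≤ pencilRank (pencil ψ)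
  · rw [dvdMinors_pencil_iff hk, dvdMinors_pencil_iff (hr ▸ hk), pow_dvd_iff_le_emultiplicity,
      pow_dvd_iff_le_emultiplicity, emultiplicity_detDivisor (prime_rootForm z) ψ hk,
      emultiplicity_detDivisor (prime_rootForm z) φ (hr ▸ hk),
      Finset.sum_congr rfl fun j hj => key j (by have := Finset.mem_range.mp hj; omega)]
  · have h1 : DvdMinors 0 k (pencil ψ) := not_not.mp (mt le_pencilRank_iff.mpr hk)
    have h2 : DvdMinors 0 k (pencil φ) := not_not.mp (mt le_pencilRank_iff.mpr (hr ▸ hk))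
    exact ⟨fun _ f g => (zero_dvd_iff.mp (h2 f g)) ▸ dvd_zero _,
      fun _ f g => (zero_dvd_iff.mp (h1 f g)) ▸ dvd_zero _⟩

section Transport

variable {ψ φ : State m n} {A : GL (Fin 2) ℂ}

/-- The minors of the pencil of `φ` have the divisors that the substitution `A` makes of those of
the pencil of `ψ`. This holds when `φ` arises from `ψ` by local operators `A`, `B`, `C`. -/
def MinorsSubst (A : GL (Fin 2) ℂ) (ψ φ : State m n) : Prop :=
  ∀ (G : Poly) (k : ℕ), DvdMinors (linSubst A G) k (pencil φ) ↔ DvdMinors G k (pencil ψ)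

theorem MinorsSubst.pencilRank_eq (h : MinorsSubst A ψ φ) :
    pencilRank (pencil φ) = pencilRank (pencil ψ) :=
  pencilRank_congr fun k => by rw [← h, map_zero]

theorem linSubst_linSubst_inv (A : GL (Fin 2) ℂ) (G : Poly) :
    linSubst A (linSubst (A⁻¹ : GL (Fin 2) ℂ) G) = G :=
  (linSubstEquiv A).apply_symm_apply G

theorem linSubst_inv_linSubst (A : GL (Fin 2) ℂ) (G : Poly) :
    linSubst (A⁻¹ : GL (Fin 2) ℂ) (linSubst A G) = G :=
  (linSubstEquiv A).symm_apply_apply G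

theorem MinorsSubst.dvd_detDivisor_iff (h : MinorsSubst A ψ φ) {k : ℕ}
    (hk : k ≤ pencilRank (pencil ψ)) (G : Poly) :
    linSubst A G ∣ detDivisor (pencil φ) k ↔ G ∣ detDivisor (pencil ψ) k := by
  rw [← dvdMinors_pencil_iff hk, ← dvdMinors_pencil_iff (h.pencilRank_eq ▸ hk), h]

theorem MinorsSubst.associated_detDivisor (h : MinorsSubst A ψ φ) {k : ℕ}
    (hk : k ≤ pencilRank (pencil ψ)) :
    Associated (detDivisor (pencil φ) k) (linSubst A (detDivisor (pencil ψ) k)) := by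
  refine associated_of_dvd_dvd ?_ ((h.dvd_detDivisor_iff hk _).mpr dvd_rfl)
  rw [← linSubst_linSubst_inv A (detDivisor (pencil φ) k)]
  refine map_dvd (linSubst A) ?_
  rw [← h.dvd_detDivisor_iff hk, linSubst_linSubst_inv]

theorem MinorsSubst.associated_invPoly (h : MinorsSubst A ψ φ) {j : ℕ}
    (hj : j < pencilRank (pencil ψ)) :
    Associated (invPoly (pencil φ) j) (linSubst A (invPoly (pencil ψ) j)) := by
  have hj' : j < pencilRank (pencil φ) := h.pencilRank_eq ▸ hj
  have h1 := h.associated_detDivisor (Nat.succ_le_of_lt hj)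
  rw [Nat.succ_eq_add_one, detDivisor_succ ψ hj, detDivisor_succ φ hj', map_mul] at h1
  exact Associated.of_mul_left h1 (h.associated_detDivisor hj.le) (detDivisor_ne_zero hj'.le)

theorem MinorsSubst.emultiplicity_invPoly (h : MinorsSubst A ψ φ) {j : ℕ}
    (hj : j < pencilRank (pencil ψ)) (p : Poly) :
    emultiplicity (linSubst A p) (invPoly (pencil φ) j) =
      emultiplicity p (invPoly (pencil ψ) j) := by
  rw [emultiplicity_eq_of_associated_right (h.associated_invPoly hj)]
  exact emultiplicity_map_eq (linSubstEquiv A)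

theorem det_ne_zero (A : GL (Fin 2) ℂ) : A 0 0 * A 1 1 - A 0 1 * A 1 0 ≠ 0 := by
  rw [← Matrix.det_fin_two]
  exact A.det.ne_zero

/-- A linear form dividing the last determinantal divisor is proportional to some `μ x_i + λ`, if
there are no infinite elementary divisors. -/
theorem exists_associated_rootForm {q : ℕ} {x : Fin q → ℂ} {e : Fin q → ℕ → ℕ}
    (h : HasFiniteElementaryDivisors (pencil ψ) x e)
    (hI : NoInfiniteElementaryDivisors (pencil ψ)) {a b : ℂ} (hab : b = 0 → a ≠ 0)
    (hd : mu * MvPolynomial.C a + lam * MvPolynomial.C b ∣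
      detDivisor (pencil ψ) (pencilRank (pencil ψ))) :
    ∃ i, Associated (mu * MvPolynomial.C a + lam * MvPolynomial.C b) (rootForm (x i)) := by
  rw [noInfiniteElementaryDivisors_iff] at hI
  by_cases hb : b = 0
  · subst hb
    rw [map_zero, mul_zero, add_zero] at hd
    exact absurd ((dvd_mul_right _ _).trans hd) hI
  · have h1 := associated_linForm a b hb
    obtain ⟨i, hi⟩ := (h.mem_iff (a / b)).mpr ((h1.dvd_iff_dvd_left).mp hd)
    exact ⟨i, hi ▸ h1⟩

/-- A root with vanishing denominator would be moved to infinity, that is, `μ x_i + λ` would be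
mapped to a multiple of `μ`. -/
theorem MinorsSubst.denom_ne_zero (h : MinorsSubst A ψ φ) {q : ℕ} {x : Fin q → ℂ}
    {e : Fin q → ℕ → ℕ} (hx : HasFiniteElementaryDivisors (pencil ψ) x e)
    (hI : NoInfiniteElementaryDivisors (pencil φ)) (i : Fin q) : A 1 0 * x i + A 1 1 ≠ 0 := by
  intro h0
  rw [noInfiniteElementaryDivisors_iff, h.pencilRank_eq] at hI
  have h1 := (h.dvd_detDivisor_iff le_rfl _).mpr ((hx.mem_iff (x i)).mp ⟨i, rfl⟩)
  have h2 := linSubst_rootForm A (x i)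
  rw [h0, map_zero, mul_zero, add_zero] at h2
  refine hI (((Associated.dvd_iff_dvd_left ?_).mp h1))
  change Associated (linSubst A (rootForm (x i))) mu
  rw [h2]
  refine associated_mul_unit_left _ _ (isUnit_C fun h3 => det_ne_zero A ?_)
  rw [eq_neg_of_add_eq_zero_right h0, eq_neg_of_add_eq_zero_right h3]
  ring

/-- An invertible `A` does not annihilate `(x, 1)`. -/
theorem linForm_coeff_inv (A : GL (Fin 2) ℂ) (x : ℂ) :
    A 1 0 * x + A 1 1 = 0 → A 0 0 * x + A 0 1 ≠ 0 := by
  intro h0 h1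
  refine det_ne_zero A ?_
  rw [eq_neg_of_add_eq_zero_right h0, eq_neg_of_add_eq_zero_right h1]
  ring

theorem associated_linSubst_rootForm {x : ℂ} (hx : A 1 0 * x + A 1 1 ≠ 0) :
    Associated (linSubst A (rootForm x))
      (rootForm ((A 0 0 * x + A 0 1) / (A 1 0 * x + A 1 1))) := by
  rw [linSubst_rootForm]
  exact associated_linForm _ _ hx

/-- The Möbius transformation given by `A` moves the roots of the elementary divisors and keeps
their exponents. -/
theorem MinorsSubst.hasFiniteElementaryDivisors (h : MinorsSubst A ψ φ) {q : ℕ} {x : Fin q → ℂ}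
    {e : Fin q → ℕ → ℕ} (hx : HasFiniteElementaryDivisors (pencil ψ) x e)
    (hI : NoInfiniteElementaryDivisors (pencil ψ)) (hd : ∀ i, A 1 0 * x i + A 1 1 ≠ 0) :
    HasFiniteElementaryDivisors (pencil φ)
      (fun i => (A 0 0 * x i + A 0 1) / (A 1 0 * x i + A 1 1)) e := by
  refine ⟨fun i i' hii => ?_, fun z => ⟨?_, fun hz => ?_⟩, fun i j hj => ?_⟩
  · refine hx.injective ?_
    have h1 := (associated_linSubst_rootForm (hd i)).trans
      ((congrArg rootForm hii ▸ Associated.refl _ : Associated (rootForm _) (rootForm _)).trans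
      (associated_linSubst_rootForm (hd i')).symm)
    have h2 := map_dvd (linSubst (A⁻¹ : GL (Fin 2) ℂ)) h1.dvd
    rw [linSubst_inv_linSubst, linSubst_inv_linSubst] at h2
    exact eq_of_rootForm_dvd h2
  · rintro ⟨i, rfl⟩
    have h1 := (h.dvd_detDivisor_iff le_rfl _).mpr ((hx.mem_iff (x i)).mp ⟨i, rfl⟩)
    rw [h.pencilRank_eq]
    exact ((associated_linSubst_rootForm (hd i)).dvd_iff_dvd_left).mp h1
  · change rootForm z ∣ _ at hz
    rw [h.pencilRank_eq, ← linSubst_linSubst_inv A (rootForm z), h.dvd_detDivisor_iff le_rfl,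
      linSubst_rootForm] at hz
    obtain ⟨i, hi⟩ := exists_associated_rootForm hx hI (linForm_coeff_inv A⁻¹ z) hz
    rw [← linSubst_rootForm] at hi
    have h2 := map_dvd (linSubst A) hi.symm.dvd
    rw [linSubst_linSubst_inv] at h2
    exact ⟨i, eq_of_rootForm_dvd
      ((associated_linSubst_rootForm (hd i)).dvd_iff_dvd_left.mp h2)⟩
  · rw [h.pencilRank_eq] at hj
    have h1 := h.emultiplicity_invPoly hj (rootForm (x i))
    change emultiplicity (rootForm ((A 0 0 * x i + A 0 1) / (A 1 0 * x i + A 1 1))) _ = _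
    rw [emultiplicity_eq_of_associated_left (associated_linSubst_rootForm (hd i)), h1]
    exact hx.exponent i j hj

theorem MinorsSubst.noInfiniteElementaryDivisors (h : MinorsSubst A ψ φ) {q : ℕ} {x : Fin q → ℂ}
    {e : Fin q → ℕ → ℕ} (hx : HasFiniteElementaryDivisors (pencil ψ) x e)
    (hI : NoInfiniteElementaryDivisors (pencil ψ)) (hd : ∀ i, A 1 0 * x i + A 1 1 ≠ 0) :
    NoInfiniteElementaryDivisors (pencil φ) := by
  rw [noInfiniteElementaryDivisors_iff]
  intro hmu
  rw [h.pencilRank_eq, ← linSubst_linSubst_inv A mu, h.dvd_detDivisor_iff le_rfl,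
    linSubst_mu] at hmu
  obtain ⟨i, hi⟩ := exists_associated_rootForm hx hI (fun h10 h00 => det_ne_zero A⁻¹ (by
    rw [h10, h00]; ring)) hmu
  rw [← linSubst_mu] at hi
  have h2 := map_dvd (linSubst A) hi.symm.dvd
  rw [linSubst_linSubst_inv] at h2
  exact not_rootForm_dvd_mu _ ((associated_linSubst_rootForm (hd i)).dvd_iff_dvd_left.mp h2)

end Transport

/-- The dehomogenization `μ = 1`, `λ = t`. -/
def dehom : Poly →ₐ[ℂ] Polynomial ℂ := MvPolynomial.aeval ![1, Polynomial.X]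

theorem dehom_rootForm (x : ℂ) : dehom (rootForm x) = Polynomial.X - Polynomial.C (-x) := by
  simp only [dehom, rootForm, mu, lam, map_add, map_mul, MvPolynomial.aeval_X, Matrix.cons_val_zero,
    Matrix.cons_val_one, MvPolynomial.aeval_C, Polynomial.algebraMap_eq, map_neg]
  ring

theorem isRoot_of_rootForm_dvd {x : ℂ} {D : Poly} (h : rootForm x ∣ D) : (dehom D).IsRoot (-x) := by
  rw [← Polynomial.dvd_iff_isRoot, ← dehom_rootForm]
  exact map_dvd dehom h

theorem dehom_detDivisor_ne_zero {ψ : State m n} {k : ℕ} (hk : k ≤ pencilRank (pencil ψ)) :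
    dehom (detDivisor (pencil ψ) k) ≠ 0 :=
  (isDetDivisor_detDivisor ψ hk).monic.ne_zero

theorem exists_hasFiniteElementaryDivisors (ψ : State m n) :
    ∃ (q : ℕ) (x : Fin q → ℂ) (e : Fin q → ℕ → ℕ),
      HasFiniteElementaryDivisors (pencil ψ) x e := by
  classical
  set D := detDivisor (pencil ψ) (pencilRank (pencil ψ)) with hD
  have hfin : {z : ℂ | rootForm z ∣ D}.Finite := by
    refine ((dehom D).roots.toFinset.finite_toSet.image Neg.neg).subset fun z hz => ?_
    refine ⟨-z, ?_, neg_neg z⟩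
    rw [Finset.mem_coe, Multiset.mem_toFinset,
      Polynomial.mem_roots (dehom_detDivisor_ne_zero le_rfl)]
    exact isRoot_of_rootForm_dvd hz
  let E := hfin.toFinset.equivFin
  refine ⟨hfin.toFinset.card, fun i => E.symm i,
    fun i j => multiplicity (rootForm (E.symm i)) (invPoly (pencil ψ) j), ?_, ?_, ?_⟩
  · exact Subtype.val_injective.comp E.symm.injective
  · intro z
    constructor
    · rintro ⟨i, rfl⟩
      exact hfin.mem_toFinset.mp (E.symm i).2
    · intro hz
      exact ⟨E ⟨z, hfin.mem_toFinset.mpr hz⟩, by simp⟩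
  · intro i j hj
    exact (FiniteMultiplicity.of_prime_left (prime_rootForm _)
      (invPoly_ne_zero hj)).emultiplicity_eq_multiplicity

theorem minorsSubst_mulVec (ψ : State m n) (A : GL (Fin 2) ℂ) (B : GL (Fin m) ℂ)
    (D : GL (Fin n) ℂ) :
    MinorsSubst A ψ (((A : Matrix (Fin 2) (Fin 2) ℂ) ⊗ₖ
      ((B : Matrix (Fin m) (Fin m) ℂ) ⊗ₖ (D : Matrix (Fin n) (Fin n) ℂ))).mulVec ψ) :=
  dvdMinors_linSubst_iff (pencil_mulVec ψ A B D)

theorem SLOCCEquiv.exists_minorsSubst {ψ φ : State m n} (h : SLOCCEquiv ψ φ) :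
    ∃ A, MinorsSubst A ψ φ := by
  obtain ⟨A, B, D, rfl⟩ := h
  exact ⟨A, minorsSubst_mulVec ψ A B D⟩

/-- A coordinate change moving a linear form that does not divide `D_r` to `μ` removes the infinite
elementary divisors. -/
theorem exists_sloccEquiv_noInfiniteElementaryDivisors (χ : State m n) :
    ∃ χ' : State m n, SLOCCEquiv χ χ' ∧ NoInfiniteElementaryDivisors (pencil χ') := by
  set D := detDivisor (pencil χ) (pencilRank (pencil χ)) with hD
  obtain ⟨t, ht⟩ : ∃ t, ¬ (dehom D).IsRoot t := by
    by_contra! hcon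
    exact dehom_detDivisor_ne_zero (ψ := χ) le_rfl
      (Polynomial.eq_zero_of_infinite_isRoot _ (Set.infinite_univ.mono fun t _ => hcon t))
  let A : GL (Fin 2) ℂ := Matrix.GeneralLinearGroup.mkOfDetNeZero !![0, 1; 1, t] (by simp)
  have hA : linSubst A (rootForm (-t)) = mu := by
    rw [linSubst_rootForm]
    simp [A, Matrix.GeneralLinearGroup.mkOfDetNeZero]
  have h := minorsSubst_mulVec χ A 1 1
  refine ⟨_, ⟨A, 1, 1, rfl⟩, ?_⟩
  rw [noInfiniteElementaryDivisors_iff]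
  intro hmu
  rw [h.pencilRank_eq, ← hA, h.dvd_detDivisor_iff le_rfl] at hmu
  have := isRoot_of_rootForm_dvd hmu
  rw [neg_neg] at this
  exact ht this

/-! ### Dehomogenized minors -/

section Graded

attribute [local instance] MvPolynomial.gradedAlgebra

theorem homogeneousComponent_mul_of_le {p q : Poly} {e d : ℕ} (hp : p.IsHomogeneous e)
    (h : e ≤ d) : MvPolynomial.homogeneousComponent d (p * q) =
      p * MvPolynomial.homogeneousComponent (d - e) q :=
  (MvPolynomial.decomposition.decompose'_apply (p * q) d).symm.trans
    ((DirectSum.coe_decompose_mul_of_left_mem_of_le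
      (MvPolynomial.homogeneousSubmodule (Fin 2) ℂ) (a := p) (b := q) hp h).trans
      (congrArg (p * ·) (MvPolynomial.decomposition.decompose'_apply q (d - e))))

theorem homogeneousComponent_mul_of_lt {p q : Poly} {e d : ℕ} (hp : p.IsHomogeneous e)
    (h : d < e) : MvPolynomial.homogeneousComponent d (p * q) = 0 :=
  (MvPolynomial.decomposition.decompose'_apply (p * q) d).symm.trans
    (DirectSum.coe_decompose_mul_of_left_mem_of_not_le
      (MvPolynomial.homogeneousSubmodule (Fin 2) ℂ) (a := p) (b := q) hp (not_le.mpr h))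

end Graded

theorem isHomogeneous_of_mul {p q : Poly} {e d : ℕ} (hp : p.IsHomogeneous e) (hp0 : p ≠ 0)
    (h : (p * q).IsHomogeneous (e + d)) : q.IsHomogeneous d := by
  have h1 := homogeneousComponent_mul_of_le (q := q) hp (Nat.le_add_right e d)
  rw [MvPolynomial.homogeneousComponent_eq_self h, Nat.add_sub_cancel_left] at h1
  rw [mul_left_cancel₀ hp0 h1]
  exact MvPolynomial.homogeneousComponent_isHomogeneous _ _

theorem isHomogeneous_rootForm (x : ℂ) : (rootForm x).IsHomogeneous 1 := by
  refine MvPolynomial.IsHomogeneous.add ?_ (MvPolynomial.isHomogeneous_X ℂ 1)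
  exact (MvPolynomial.isHomogeneous_X ℂ (0 : Fin 2)).mul
    (MvPolynomial.isHomogeneous_C (Fin 2) x)

theorem add_eq_of_mem_support {M : Poly} {k : ℕ} (hM : M.IsHomogeneous k) {d : Fin 2 →₀ ℕ}
    (hd : d ∈ M.support) : d 0 + d 1 = k := by
  have := hM.degree_eq_sum_deg_support hd
  rw [this, ← Finsupp.degree_apply, Finsupp.degree_eq_sum, Fin.sum_univ_two]

/-- Modulo `μ x + λ` a homogeneous `M` is congruent to `M(1, -x) μ ^ k`. -/
theorem rootForm_dvd_of_isRoot {M : Poly} {k : ℕ} (hM : M.IsHomogeneous k) {x : ℂ}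
    (h : (dehom M).IsRoot (-x)) : rootForm x ∣ M := by
  have h1 : MvPolynomial.aeval ![mu, MvPolynomial.C (-x) * mu] M =
      MvPolynomial.C ((dehom M).eval (-x)) * mu ^ k := by
    rw [dehom, MvPolynomial.aeval_def, MvPolynomial.aeval_def, MvPolynomial.eval₂_eq',
      MvPolynomial.eval₂_eq', Polynomial.eval_finsetSum, map_sum, Finset.sum_mul]
    refine Finset.sum_congr rfl fun d hd => ?_
    rw [← add_eq_of_mem_support hM hd]
    simp [Fin.prod_univ_two, MvPolynomial.algebraMap_eq]
    ring
  have h2 : (Ideal.Quotient.mkₐ ℂ (Ideal.span {rootForm x})) M =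
      (Ideal.Quotient.mkₐ ℂ (Ideal.span {rootForm x}))
        (MvPolynomial.aeval ![mu, MvPolynomial.C (-x) * mu] M) := by
    rw [← AlgHom.comp_apply]
    congr 1
    refine MvPolynomial.algHom_ext fun i => ?_
    fin_cases i
    · simp [mu]
    · rw [AlgHom.comp_apply]
      refine Ideal.Quotient.eq.mpr (Ideal.mem_span_singleton.mpr ?_)
      simp [rootForm, mu, lam, mul_comm, add_comm]
  rw [h1, Polynomial.IsRoot.def.mp h, map_zero, zero_mul, map_zero] at h2
  exact Ideal.mem_span_singleton.mp (Ideal.Quotient.eq_zero_iff_mem.mp h2)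

theorem rootForm_pow_dvd_iff {M : Poly} {k : ℕ} (hM : M.IsHomogeneous k) {x : ℂ} (s : ℕ) :
    rootForm x ^ s ∣ M ↔ (Polynomial.X - Polynomial.C (-x)) ^ s ∣ dehom M := by
  constructor
  · intro h
    have := map_dvd dehom h
    rwa [map_pow, dehom_rootForm] at this
  · intro h
    by_cases hM0 : M = 0
    · rw [hM0]; exact dvd_zero _
    induction s generalizing M k with
    | zero => simp
    | succ s ih =>
      have hroot : (dehom M).IsRoot (-x) :=
        Polynomial.dvd_iff_isRoot.mp ((dvd_pow_self _ s.succ_ne_zero).trans h)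
      obtain ⟨M', rfl⟩ := rootForm_dvd_of_isRoot hM hroot
      rw [pow_succ', map_mul, dehom_rootForm] at h
      have h' := (mul_dvd_mul_iff_left (Polynomial.X_sub_C_ne_zero _)).mp h
      have hk : 1 ≤ k := by
        by_contra hk
        have := homogeneousComponent_mul_of_lt (q := M') (d := k) (isHomogeneous_rootForm x)
          (by omega)
        rw [MvPolynomial.homogeneousComponent_eq_self hM] at this
        exact hM0 this
      obtain ⟨k, rfl⟩ := Nat.exists_eq_add_of_le hk
      rw [pow_succ']
      exact mul_dvd_mul_left _ (ih (isHomogeneous_of_mul (isHomogeneous_rootForm x)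
        (prime_rootForm x).ne_zero hM) h' (right_ne_zero_of_mul hM0))

theorem det_submatrix_homogeneous (ψ : State m n) {k : ℕ} (f : Fin k → Fin m)
    (g : Fin k → Fin n) : ((pencil ψ).submatrix f g).det.IsHomogeneous k := by
  rw [Matrix.det_apply]
  refine MvPolynomial.IsHomogeneous.sum _ _ _ fun σ _ => ?_
  have h1 : (∏ i, (pencil ψ).submatrix f g (σ i) i).IsHomogeneous k := by
    have := MvPolynomial.IsHomogeneous.prod Finset.univ
      (fun i => (pencil ψ).submatrix f g (σ i) i) (fun _ => 1) fun i _ => by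
        rw [Matrix.submatrix_apply, pencil_apply]
        refine MvPolynomial.IsHomogeneous.sum _ _ _ fun α _ => ?_
        simpa using (MvPolynomial.isHomogeneous_X ℂ α).mul
          (MvPolynomial.isHomogeneous_C (Fin 2) (ψ (α, f (σ i), g i)))
    simpa using this
  rcases Int.units_eq_one_or (Equiv.Perm.sign σ) with h | h
  · rw [h, one_smul]; exact h1
  · rw [h, Units.neg_smul, one_smul]; exact h1.neg

/-- The pencil `R + t S` over `ℂ[t]`. -/
def polyPencil (ψ : State m n) : Matrix (Fin m) (Fin n) (Polynomial ℂ) := (pencil ψ).map dehom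

theorem dvdMinors_polyPencil_iff (ψ : State m n) (x : ℂ) (s k : ℕ) :
    DvdMinors ((Polynomial.X - Polynomial.C (-x)) ^ s) k (polyPencil ψ) ↔
      DvdMinors (rootForm x ^ s) k (pencil ψ) := by
  refine forall_congr' fun f => forall_congr' fun g => ?_
  have : (polyPencil ψ).submatrix f g = dehom.toRingHom.mapMatrix ((pencil ψ).submatrix f g) := rfl
  rw [this, ← RingHom.map_det, rootForm_pow_dvd_iff (det_submatrix_homogeneous ψ f g)]
  rfl

/-! ### Smith normal form and the numbers of chains -/

theorem dvdMinors_diagonal {A : Type*} [CommRing A] {r k : ℕ} {G : A} {a : Fin r → A}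
    (h : ∀ l : Fin k → Fin r, Function.Injective l → G ∣ ∏ i, a (l i)) :
    DvdMinors G k (Matrix.diagonal a) := by
  intro f g
  by_cases hf : Function.Injective f
  · have : (Matrix.diagonal a).submatrix f g =
        Matrix.of fun i j => a (f i) * (1 : Matrix (Fin r) (Fin r) A).submatrix f g i j := by
      ext i j
      simp [Matrix.diagonal_apply, Matrix.one_apply]
    rw [this, Matrix.det_mul_column]
    exact (h f hf).mul_right _
  · obtain ⟨i, j, hij, hne⟩ := Function.not_injective_iff.mp hf
    rw [Matrix.det_zero_of_row_eq hne (by ext a; simp [hij])]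
    exact dvd_zero _

/-- The minors of a matrix in terms of the Smith normal form of its row module. -/
theorem dvdMinors_iff_smith {A : Type*} [CommRing A] {P : Matrix (Fin m) (Fin n) A} {r : ℕ}
    (B : Module.Basis.SmithNormalForm (Submodule.span A (Set.range P)) (Fin n) r)
    {G : A} {k : ℕ} :
    DvdMinors G k P ↔ ∀ l : Fin k → Fin r, Function.Injective l → G ∣ ∏ i, B.a (l i) := by
  constructor
  · intro h l hl
    have h1 : ∀ i, ∃ c : Fin m → A, ∑ a, c a • P a = (B.bN (l i) : Fin n → A) := fun i =>
      Submodule.mem_span_range_iff_exists_fun A |>.mp (B.bN (l i)).2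
    choose X hX using h1
    let Y : Matrix (Fin n) (Fin k) A := Matrix.of fun j c => B.bM.coord (B.f (l c)) (Pi.single j 1)
    have h2 := (h.mul_left (Matrix.of X)).mul_right Y id id
    have h3 : (Matrix.of X * P * Y) = Matrix.diagonal fun i => B.a (l i) := by
      ext i c
      have h4 : (Matrix.of X * P) i = (B.bN (l i) : Fin n → A) := by
        rw [← hX]
        ext j
        simp [Matrix.mul_apply]
      have h5 : ∀ w : Fin n → A, ∑ j, w j * Y j c = B.bM.coord (B.f (l c)) w := by
        intro w
        conv_rhs => rw [pi_eq_sum_univ' w, map_sum]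
        refine Finset.sum_congr rfl fun j _ => ?_
        rw [map_smul, smul_eq_mul]
        congr 1
      rw [Matrix.mul_apply, h4, h5, B.snf, map_smul, Module.Basis.coord_apply,
        Module.Basis.repr_self, Matrix.diagonal_apply, smul_eq_mul]
      by_cases hic : i = c
      · simp [hic]
      · have : B.f (l i) ≠ B.f (l c) := fun h => hic (hl (B.f.injective h))
        simp [hic, this]
    rw [h3, Matrix.submatrix_id_id, Matrix.det_diagonal] at h2
    exact h2
  · intro h
    have h1 : ∀ i, ∃ c : Fin r → A, P i = ∑ l, (c l * B.a l) • B.bM (B.f l) := by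
      intro i
      let y : Submodule.span A (Set.range P) := ⟨P i, Submodule.subset_span ⟨i, rfl⟩⟩
      refine ⟨fun l => B.bN.repr y l, ?_⟩
      have h2 := congrArg Subtype.val (B.bN.sum_repr y)
      rw [Submodule.coe_sum] at h2
      refine h2.symm.trans (Finset.sum_congr rfl fun l _ => ?_)
      rw [Submodule.coe_smul, B.snf, smul_smul]
    choose c hc using h1
    have h2 : P = Matrix.of c * Matrix.diagonal B.a * Matrix.of fun l => B.bM (B.f l) := by
      ext i j
      rw [hc]
      simp [Matrix.mul_apply, Matrix.diagonal_apply]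
    rw [h2]
    exact ((dvdMinors_diagonal h).mul_left _).mul_right _

/-- The sum `∑ min s e_l` is monotone in the sums of the `k` smallest exponents, `k ≤ r`: it is the
minimum over `k` of such a sum plus `(r - k) s`. -/
theorem sum_min_le {r : ℕ} {e e' : Fin r → ℕ}
    (H : ∀ s k, (∀ l : Fin k → Fin r, Function.Injective l → s ≤ ∑ i, e (l i)) →
      ∀ l : Fin k → Fin r, Function.Injective l → s ≤ ∑ i, e' (l i)) (s : ℕ) :
    ∑ l, min s (e l) ≤ ∑ l, min s (e' l) := by
  classical
  set I : Finset (Fin r) := Finset.univ.filter fun l => e' l < s with hI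
  let l' : Fin I.card → Fin r := fun i => I.equivFin.symm i
  have hl' : Function.Injective l' := Subtype.val_injective.comp I.equivFin.symm.injective
  have hsum' : ∑ i, e' (l' i) = ∑ l ∈ I, e' l := by
    rw [← Finset.sum_coe_sort I]
    exact Equiv.sum_comp I.equivFin.symm fun i : I => e' i
  obtain ⟨l, hl, hle⟩ : ∃ l : Fin I.card → Fin r, Function.Injective l ∧
      ∑ i, e (l i) ≤ ∑ l ∈ I, e' l := by
    by_contra! hcon
    have := H (∑ l ∈ I, e' l + 1) I.card (fun l hl => hcon l hl) l' hl'
    omega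
  let J : Finset (Fin r) := Finset.univ.map ⟨l, hl⟩
  have hJ : J.card = I.card := by simp [J]
  have h1 : ∑ l, min s (e l) ≤ ∑ l ∈ J, e l + Jᶜ.card * s := by
    rw [← Finset.sum_add_sum_compl J, ← smul_eq_mul]
    exact Nat.add_le_add (Finset.sum_le_sum fun _ _ => min_le_right _ _)
      (Finset.sum_le_card_nsmul _ _ _ fun _ _ => min_le_left _ _)
  have h2 : ∑ l, min s (e' l) = ∑ l ∈ I, e' l + Iᶜ.card * s := by
    rw [← Finset.sum_add_sum_compl I]
    congr 1
    · exact Finset.sum_congr rfl fun l hl => min_eq_right (Finset.mem_filter.mp hl).2.le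
    · rw [Finset.sum_congr rfl (g := fun _ => s), Finset.sum_const, smul_eq_mul]
      intro l hl
      rw [Finset.mem_compl, Finset.mem_filter] at hl
      exact min_eq_left (not_lt.mp fun h => hl ⟨Finset.mem_univ _, h⟩)
  have h3 : ∑ l ∈ J, e l = ∑ i, e (l i) := by simp [J]
  rw [h2]
  refine h1.trans ?_
  rw [h3, Finset.card_compl, Finset.card_compl, hJ]
  omega

/-- For `k > r'` there are no `k` distinct indices and every `s` is a bound, hence `k > r`. -/
theorem card_le_of_sum_iff {r r' : ℕ} {e : Fin r → ℕ} {e' : Fin r' → ℕ}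
    (H : ∀ s k, (∀ l : Fin k → Fin r', Function.Injective l → s ≤ ∑ i, e' (l i)) →
      ∀ l : Fin k → Fin r, Function.Injective l → s ≤ ∑ i, e (l i)) : r ≤ r' := by
  by_contra! hlt
  have := H (∑ i, e i + 1) r (fun l hl => by
    have := Fintype.card_le_of_injective l hl
    simp at this
    omega) id Function.injective_id
  simp at this

/-- The operator `x + N` on sequences, `N` being the shift `u_k ↦ u_{k+1}`. -/
def shiftOp (x : ℂ) : Module.End ℂ (ℕ → ℂ) :=
  x • LinearMap.id + LinearMap.funLeft ℂ ℂ Nat.succ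

/-- The space of sequences as a `ℂ[t]`-module, with `t` acting by `shiftOp x`. -/
abbrev SeqModule (x : ℂ) : Type := Module.AEval' (shiftOp x)

/-- A sequence as an element of `SeqModule x`. -/
abbrev toSeq (x : ℂ) : (ℕ → ℂ) ≃ₗ[ℂ] SeqModule x := Module.AEval'.of (shiftOp x)

/-- The operator `t - x` shifts the sequence by one. -/
theorem X_sub_C_pow_smul (x : ℂ) (s : ℕ) (v : ℕ → ℂ) :
    (Polynomial.X - Polynomial.C x : Polynomial ℂ) ^ s • toSeq x v =
      toSeq x fun k => v (k + s) := by
  induction s generalizing v with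
  | zero => simp
  | succ s ih =>
    have h1 : (Polynomial.X - Polynomial.C x : Polynomial ℂ) • toSeq x v =
        toSeq x fun k => v (k + 1) := by
      have h2 : (Polynomial.X : Polynomial ℂ) • toSeq x v =
          x • toSeq x v + toSeq x fun k => v (k + 1) := by
        rw [Module.AEval'.X_smul_of, ← map_smul, ← map_add]
        rfl
      rw [sub_smul (M := SeqModule x) Polynomial.X (Polynomial.C x) (toSeq x v), h2,
        Polynomial.C_eq_algebraMap, algebraMap_smul, add_sub_cancel_left]
    rw [pow_succ, mul_smul, h1, ih]
    congr 1

/-- Sequences supported below `d`. -/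
def seqBelow (d : ℕ) : Submodule ℂ (ℕ → ℂ) where
  carrier := {v | ∀ k, d ≤ k → v k = 0}
  add_mem' ha hb k hk := by simp [ha k hk, hb k hk]
  zero_mem' _ _ := rfl
  smul_mem' c a ha k hk := by simp [ha k hk]

theorem mem_seqBelow_iff {x : ℂ} {d : ℕ} {v : ℕ → ℂ} : v ∈ seqBelow d ↔
    (Polynomial.X - Polynomial.C x : Polynomial ℂ) ^ d • toSeq x v = 0 := by
  rw [X_sub_C_pow_smul, LinearEquiv.map_eq_zero_iff]
  constructor
  · intro h
    funext k
    exact h _ (Nat.le_add_left d k)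
  · intro h k hk
    have := congrFun h (k - d)
    simpa [Nat.sub_add_cancel hk] using this

theorem finrank_seqBelow (d : ℕ) : Module.finrank ℂ (seqBelow d) = d := by
  have e : seqBelow d ≃ₗ[ℂ] (Fin d → ℂ) :=
    { toFun := fun v i => v.1 i
      invFun := fun w => ⟨fun k => if h : k < d then w ⟨k, h⟩ else 0,
        fun k hk => dif_neg (not_lt.mpr hk)⟩
      map_add' := fun _ _ => rfl
      map_smul' := fun _ _ => rfl
      left_inv := fun v => by
        ext k
        by_cases h : k < d
        · simp [h]
        · simp [h, v.2 k (not_lt.mp h)]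
      right_inv := fun w => by ext i; simp }
  rw [e.finrank_eq, Module.finrank_fin_fun]

instance (d : ℕ) : Module.Finite ℂ (seqBelow d) := by
  refine Module.Finite.of_injective
    ((LinearMap.funLeft ℂ ℂ (fun i : Fin d => (i : ℕ))) ∘ₗ (seqBelow d).subtype) fun u v huv => ?_
  ext k
  by_cases hk : k < d
  · exact congrFun huv ⟨k, hk⟩
  · rw [u.2 k (not_lt.mp hk), v.2 k (not_lt.mp hk)]

/-- For `a = (t - x) ^ e b` with `b` prime to `t - x`, the kernel of `a` on the kernel of
`(t - x) ^ s` is that of `(t - x) ^ min s e`. -/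
theorem mem_seqBelow_min_iff {x : ℂ} {s e : ℕ} {b : Polynomial ℂ} (hb : ¬ b.IsRoot x)
    {v : ℕ → ℂ} : v ∈ seqBelow (min s e) ↔
      v ∈ seqBelow s ∧ ((Polynomial.X - Polynomial.C x) ^ e * b) • toSeq x v = 0 := by
  constructor
  · intro h
    refine ⟨fun k hk => h k ((min_le_left _ _).trans hk), ?_⟩
    rw [mul_comm, mul_smul, mem_seqBelow_iff.mp fun k hk => h k ((min_le_right _ _).trans hk),
      smul_zero]
  · rintro ⟨hs, ha⟩
    have hcop : IsCoprime ((Polynomial.X - Polynomial.C x) ^ s) b := by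
      refine IsCoprime.pow_left ?_
      exact ((Polynomial.irreducible_X_sub_C x).coprime_iff_not_dvd).mpr
        (mt Polynomial.dvd_iff_isRoot.mp hb)
    have he : v ∈ seqBelow e := by
      obtain ⟨α, β, hαβ⟩ := hcop
      rw [mem_seqBelow_iff (x := x), ← one_smul (Polynomial ℂ) (toSeq x v), ← hαβ, add_smul,
        smul_add, smul_smul, smul_smul,
        show (Polynomial.X - Polynomial.C x) ^ e * (α * (Polynomial.X - Polynomial.C x) ^ s) =
          ((Polynomial.X - Polynomial.C x) ^ e * α) * (Polynomial.X - Polynomial.C x) ^ s by ring,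
        show (Polynomial.X - Polynomial.C x) ^ e * (β * b) =
          β * ((Polynomial.X - Polynomial.C x) ^ e * b) by ring,
        mul_smul, mem_seqBelow_iff.mp hs, smul_zero, mul_smul, ha, smul_zero, add_zero]
    intro k hk
    rcases min_le_iff.mp hk with h | h
    · exact hs k h
    · exact he k h

/-- The pencil of a state as a linear pencil. -/
abbrev ofState (ψ : State m n) : LinPencil where
  V := Fin n → ℂ
  W := Fin m → ℂ
  R := (Matrix.of fun i j => ψ (0, i, j)).mulVecLin
  S := (Matrix.of fun i j => ψ (1, i, j)).mulVecLin

theorem polyPencil_apply (ψ : State m n) (i : Fin m) (j : Fin n) :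
    polyPencil ψ i j = Polynomial.C (ψ (0, i, j)) + Polynomial.X * Polynomial.C (ψ (1, i, j)) := by
  simp [polyPencil, pencil, dehom, mu, lam, Polynomial.algebraMap_eq]

/-- A chain is a solution of the pencil `R + t S` in sequences. -/
theorem sum_smul_toSeq (ψ : State m n) (x : ℂ) (u : ℕ → Fin n → ℂ) (i : Fin m) :
    ∑ j, polyPencil ψ i j • toSeq x (fun k => u k j) = toSeq x fun k =>
      ((ofState ψ).R (u k) + (ofState ψ).S (x • u k + u (k + 1))) i := by
  have h1 : ∀ j, polyPencil ψ i j • toSeq x (fun k => u k j) =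
      toSeq x fun k => ψ (0, i, j) * u k j + ψ (1, i, j) * (x * u k j + u (k + 1) j) := by
    intro j
    rw [polyPencil_apply, add_smul, mul_comm, mul_smul, Module.AEval'.X_smul_of,
      Polynomial.C_eq_algebraMap, Polynomial.C_eq_algebraMap, algebraMap_smul, algebraMap_smul,
      ← map_smul, ← map_smul,
      ← map_add]
    congr 1
  rw [Finset.sum_congr rfl fun j _ => h1 j, ← map_sum]
  congr 1
  funext k
  simp [Matrix.mulVec, dotProduct, Finset.sum_add_distrib]

/-- The homomorphisms into the sequences killed by `(t - x) ^ s` that vanish on `N`. -/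
def homsBelow (x : ℂ) (s : ℕ) (N : Submodule (Polynomial ℂ) (Fin n → Polynomial ℂ)) :
    Submodule ℂ ((Fin n → Polynomial ℂ) →ₗ[Polynomial ℂ] SeqModule x) where
  carrier := {h | (∀ y ∈ N, h y = 0) ∧
    ∀ y, (Polynomial.X - Polynomial.C x : Polynomial ℂ) ^ s • h y = 0}
  add_mem' ha hb := ⟨fun y hy => by simp [ha.1 y hy, hb.1 y hy],
    fun y => by simp [ha.2 y, hb.2 y]⟩
  zero_mem' := ⟨fun _ _ => rfl, fun _ => by simp⟩
  smul_mem' c a ha := ⟨fun y hy => by simp [ha.1 y hy], fun y => by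
    rw [LinearMap.smul_apply, smul_comm, ha.2 y, smul_zero]⟩

theorem basis_smul_zero {M N : Type*} [AddCommGroup M] [Module (Polynomial ℂ) M] [AddCommGroup N]
    [Module (Polynomial ℂ) N] (b : Module.Basis (Fin n) (Polynomial ℂ) M)
    (h : M →ₗ[Polynomial ℂ] N) (p : Polynomial ℂ) (hp : ∀ i, p • h (b i) = 0) (y : M) :
    p • h y = 0 := by
  have : p • h = 0 := b.ext fun i => by simpa using hp i
  exact LinearMap.congr_fun this y

/-- Chains are the homomorphisms from `ℂ[t] ^ n` to the sequences of length `s` that vanish on the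
rows of the pencil. -/
theorem finrank_chains_eq_homsBelow (ψ : State m n) (x : ℂ) (s : ℕ) :
    Module.finrank ℂ ((ofState ψ).chains x s) =
      Module.finrank ℂ (homsBelow x s (Submodule.span _ (Set.range (polyPencil ψ)))) := by
  let b := Pi.basisFun (Polynomial ℂ) (Fin n)
  have hrow : ∀ (h : (Fin n → Polynomial ℂ) →ₗ[Polynomial ℂ] SeqModule x) i,
      h (polyPencil ψ i) = ∑ j, polyPencil ψ i j • h (b j) := by
    intro h i
    conv_lhs => rw [← b.sum_repr (polyPencil ψ i), map_sum]
    simp [b]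
  refine LinearEquiv.finrank_eq
    { toFun := fun u => ⟨b.constr ℂ fun j => toSeq x fun k => u.1 k j, ?_, ?_⟩
      invFun := fun h => ⟨fun k j => (toSeq x).symm (h.1 (b j)) k, ?_, ?_⟩
      map_add' := fun u v => ?_
      map_smul' := fun c u => ?_
      left_inv := fun u => ?_
      right_inv := fun h => ?_ }
  · intro y hy
    induction hy using Submodule.span_induction with
    | mem y hy =>
      obtain ⟨i, rfl⟩ := hy
      rw [hrow]
      simp only [Module.Basis.constr_basis]
      rw [sum_smul_toSeq]
      simp only [u.2.2]
      exact map_zero _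
    | zero => exact map_zero _
    | add a c _ _ ha hc => rw [map_add, ha, hc, add_zero]
    | smul p a _ ha => rw [map_smul, ha, smul_zero]
  · refine basis_smul_zero b _ _ fun j => ?_
    rw [Module.Basis.constr_basis, ← mem_seqBelow_iff]
    exact fun k hk => congrFun (u.2.1 k hk) j
  · refine Subtype.ext (b.ext fun j => ?_)
    simp only [Submodule.coe_add, LinearMap.add_apply, Module.Basis.constr_basis]
    rw [← map_add]
    rfl
  · refine Subtype.ext (b.ext fun j => ?_)
    simp only [Submodule.coe_smul, LinearMap.smul_apply, Module.Basis.constr_basis,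
      RingHom.id_apply]
    rw [← map_smul]
    rfl
  · intro k hk
    funext j
    have := h.2.2 (b j)
    rw [← (toSeq x).apply_symm_apply (h.1 (b j)), ← mem_seqBelow_iff] at this
    exact this k hk
  · intro k
    funext i
    have := h.2.1 _ (Submodule.subset_span ⟨i, rfl⟩)
    rw [hrow] at this
    have h2 := sum_smul_toSeq ψ x (fun k j => (toSeq x).symm (h.1 (b j)) k) i
    have h3 : ∀ j, toSeq x (fun k => (toSeq x).symm (h.1 (b j)) k) = h.1 (b j) := fun j =>
      (toSeq x).apply_symm_apply _
    simp only [h3, this] at h2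
    exact congrFun ((LinearEquiv.map_eq_zero_iff _).mp h2.symm) k
  · refine Subtype.ext (funext fun k => funext fun j => ?_)
    simp
  · refine Subtype.ext (b.ext fun j => ?_)
    simp only [Module.Basis.constr_basis]
    exact (toSeq x).apply_symm_apply _

/-- In a basis adapted to `N`, a homomorphism is given by sequences of length `s` annihilated by the
invariant factors. -/
theorem finrank_homsBelow {x : ℂ} {s r : ℕ} {N : Submodule (Polynomial ℂ) (Fin n → Polynomial ℂ)}
    (B : Module.Basis.SmithNormalForm N (Fin n) r) {e : Fin r → ℕ} {b : Fin r → Polynomial ℂ}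
    (ha : ∀ l, B.a l = (Polynomial.X - Polynomial.C x) ^ e l * b l)
    (hb : ∀ l, ¬ (b l).IsRoot x) :
    Module.finrank ℂ (homsBelow x s N) = ∑ l, min s (e l) + (n - r) * s := by
  classical
  let d : Fin n → ℕ := fun i => if h : ∃ l, B.f l = i then min s (e h.choose) else s
  have hd : ∀ l, d (B.f l) = min s (e l) := by
    intro l
    have h : ∃ l', B.f l' = B.f l := ⟨l, rfl⟩
    simp only [d, dif_pos h]
    rw [B.f.injective h.choose_spec]
  have hd' : ∀ i, i ∉ Finset.univ.map B.f → d i = s := by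
    intro i hi
    refine dif_neg fun h => hi ?_
    obtain ⟨l, rfl⟩ := h
    simp
  have key : ∀ h : (Fin n → Polynomial ℂ) →ₗ[Polynomial ℂ] SeqModule x, h ∈ homsBelow x s N ↔
      ∀ i, (toSeq x).symm (h (B.bM i)) ∈ seqBelow (d i) := by
    intro h
    have e1 : ∀ i, toSeq x ((toSeq x).symm (h (B.bM i))) = h (B.bM i) := fun i =>
      (toSeq x).apply_symm_apply _
    have e2 : ∀ l, h (B.bN l) = B.a l • h (B.bM (B.f l)) := fun l => by rw [B.snf, map_smul]
    constructor
    · rintro ⟨h1, h2⟩ i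
      have hs : (toSeq x).symm (h (B.bM i)) ∈ seqBelow s := by
        rw [mem_seqBelow_iff (x := x), e1]
        exact h2 _
      by_cases hi : i ∈ Finset.univ.map B.f
      · obtain ⟨l, -, rfl⟩ := Finset.mem_map.mp hi
        rw [hd, mem_seqBelow_min_iff (hb l), e1, ← ha, ← e2]
        exact ⟨hs, h1 _ (B.bN l).2⟩
      · rw [hd' i hi]
        exact hs
    · intro H
      refine ⟨fun y hy => ?_, basis_smul_zero B.bM h _ fun i => ?_⟩
      · have : h ∘ₗ N.subtype = 0 := B.bN.ext fun l => by
          have := H (B.f l)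
          rw [hd, mem_seqBelow_min_iff (hb l), e1, ← ha, ← e2] at this
          exact this.2
        exact LinearMap.congr_fun this ⟨y, hy⟩
      · rw [← e1, ← mem_seqBelow_iff]
        by_cases hi : i ∈ Finset.univ.map B.f
        · obtain ⟨l, -, rfl⟩ := Finset.mem_map.mp hi
          have := H (B.f l)
          rw [hd] at this
          exact fun k hk => this k ((min_le_left _ _).trans hk)
        · have := H i
          rwa [hd' i hi] at this
  have E : homsBelow x s N ≃ₗ[ℂ] ∀ i, seqBelow (d i) :=
    { toFun := fun h i => ⟨_, (key h.1).mp h.2 i⟩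
      invFun := fun w => ⟨B.bM.constr ℂ fun i => toSeq x (w i), (key _).mpr fun i => by
        rw [Module.Basis.constr_basis, LinearEquiv.symm_apply_apply]
        exact (w i).2⟩
      map_add' := fun _ _ => rfl
      map_smul' := fun _ _ => rfl
      left_inv := fun h => Subtype.ext (B.bM.ext fun i => by
        rw [Module.Basis.constr_basis]
        exact (toSeq x).apply_symm_apply _)
      right_inv := fun w => by
        funext i
        refine Subtype.ext ?_
        simp }
  rw [E.finrank_eq, Module.finrank_pi_fintype]
  simp only [finrank_seqBelow]
  rw [← Finset.sum_add_sum_compl (Finset.univ.map B.f), Finset.sum_map]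
  simp only [hd]
  rw [Finset.sum_congr rfl (g := fun _ => s) fun i hi => hd' i (Finset.mem_compl.mp hi),
    Finset.sum_const, Finset.card_compl]
  simp

/-- The minors of a pencil, up to factors prime to `t - x`, determine the numbers of chains. -/
theorem finrank_chains_congr {ψ φ : State m n} {x : ℂ}
    (H : ∀ s k, DvdMinors ((Polynomial.X - Polynomial.C x) ^ s) k (polyPencil ψ) ↔
      DvdMinors ((Polynomial.X - Polynomial.C x) ^ s) k (polyPencil φ)) (s : ℕ) :
    Module.finrank ℂ ((ofState ψ).chains x s) = Module.finrank ℂ ((ofState φ).chains x s) := by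
  have hsnf : ∀ ψ : State m n, ∃ (r : ℕ) (e : Fin r → ℕ),
      (∀ s k, DvdMinors ((Polynomial.X - Polynomial.C x) ^ s) k (polyPencil ψ) ↔
        ∀ l : Fin k → Fin r, Function.Injective l → s ≤ ∑ i, e (l i)) ∧
      ∀ s, Module.finrank ℂ ((ofState ψ).chains x s) = ∑ l, min s (e l) + (n - r) * s := by
    intro ψ
    obtain ⟨r, B⟩ := Submodule.smithNormalForm (Pi.basisFun (Polynomial ℂ) (Fin n))
      (Submodule.span (Polynomial ℂ) (Set.range (polyPencil ψ)))
    have ha0 : ∀ l, B.a l ≠ 0 := by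
      intro l h
      refine B.bN.ne_zero l (Subtype.ext ?_)
      rw [B.snf, h, zero_smul]
      rfl
    have h1 : ∀ l, ∃ b, B.a l =
        (Polynomial.X - Polynomial.C x) ^ (B.a l).rootMultiplicity x * b ∧ ¬ b.IsRoot x := by
      intro l
      obtain ⟨b, hb, hb'⟩ := Polynomial.exists_eq_pow_rootMultiplicity_mul_and_not_dvd (B.a l)
        (ha0 l) x
      exact ⟨b, hb, mt Polynomial.dvd_iff_isRoot.mpr hb'⟩
    choose b hb hb' using h1
    refine ⟨r, fun l => (B.a l).rootMultiplicity x, fun s k => ?_, fun s => ?_⟩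
    · rw [dvdMinors_iff_smith B]
      refine forall_congr' fun l => forall_congr' fun _ => ?_
      have hprod : (∏ i, B.a (l i)) ≠ 0 := Finset.prod_ne_zero_iff.mpr fun i _ => ha0 _
      rw [pow_dvd_iff_le_emultiplicity,
        Finset.emultiplicity_prod (Polynomial.prime_X_sub_C x)]
      have : ∀ i, emultiplicity (Polynomial.X - Polynomial.C x) (B.a (l i)) =
          ((B.a (l i)).rootMultiplicity x : ℕ) := by
        intro i
        rw [Polynomial.rootMultiplicity_eq_multiplicity, if_neg (ha0 _)]
        exact (Polynomial.finiteMultiplicity_X_sub_C x (ha0 _)).emultiplicity_eq_multiplicity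
      simp only [this]
      rw [← Nat.cast_sum]
      exact Nat.cast_le
    · rw [finrank_chains_eq_homsBelow, finrank_homsBelow B hb hb']
  obtain ⟨r, e, h1, h2⟩ := hsnf ψ
  obtain ⟨r', e', h1', h2'⟩ := hsnf φ
  have H1 := fun s k => ((h1 s k).symm.trans (H s k)).trans (h1' s k)
  obtain rfl : r = r' := le_antisymm (card_le_of_sum_iff fun s k => (H1 s k).mpr)
    (card_le_of_sum_iff fun s k => (H1 s k).mp)
  rw [h2, h2', le_antisymm (sum_min_le (fun s k => (H1 s k).mp) s)
    (sum_min_le (fun s k => (H1 s k).mpr) s)]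

/-! ### Homogeneous bases of graded kernels -/

/-- The component of `c` that contributes to degree `d` of a product with a homogeneous polynomial
of degree `e`. -/
def shiftComp (d e : ℕ) (c : Poly) : Poly :=
  if e ≤ d then MvPolynomial.homogeneousComponent (d - e) c else 0

theorem homogeneousComponent_mul {p : Poly} {e : ℕ} (hp : p.IsHomogeneous e) (c : Poly) (d : ℕ) :
    MvPolynomial.homogeneousComponent d (c * p) = shiftComp d e c * p := by
  unfold shiftComp
  split_ifs with h
  · rw [mul_comm, homogeneousComponent_mul_of_le hp h, mul_comm]
  · rw [mul_comm, homogeneousComponent_mul_of_lt hp (not_le.mp h), zero_mul]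

theorem homogeneousComponent_sum_smul {κ : Type*} {p : ℕ} {ε : Fin p → ℕ}
    {v : Fin p → κ → Poly} (hv : ∀ i j, (v i j).IsHomogeneous (ε i)) (c : Fin p → Poly) (d : ℕ)
    (j : κ) : MvPolynomial.homogeneousComponent d ((∑ i, c i • v i) j) =
      (∑ i, shiftComp d (ε i) (c i) • v i) j := by
  simp only [Finset.sum_apply, map_sum, Pi.smul_apply, smul_eq_mul]
  exact Finset.sum_congr rfl fun i _ => homogeneousComponent_mul (hv i j) _ _

/-- A prime linear form `l` and a linear form `h` that generates `ℂ[μ, λ]` modulo `l`. -/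
structure IsLinePair (l h : Poly) : Prop where
  prime : Prime l
  isHomogeneous_left : l.IsHomogeneous 1
  isHomogeneous_right : h.IsHomogeneous 1
  not_dvd : ¬ l ∣ h
  exists_dvd_sub : ∀ {k : ℕ} {c : Poly}, c.IsHomogeneous k →
    ∃ a : ℂ, l ∣ c - MvPolynomial.C a * h ^ k

theorem isHomogeneous_C_mul_pow {l : Poly} (hl : l.IsHomogeneous 1) (a : ℂ) (k : ℕ) :
    (MvPolynomial.C a * l ^ k).IsHomogeneous k := by
  have := (MvPolynomial.isHomogeneous_C (Fin 2) a).mul (hl.pow k)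
  rwa [show 0 + 1 * k = k by omega] at this

theorem isHomogeneous_mu : mu.IsHomogeneous 1 := MvPolynomial.isHomogeneous_X ℂ 0

theorem isHomogeneous_lam : lam.IsHomogeneous 1 := MvPolynomial.isHomogeneous_X ℂ 1

theorem dehom_mu : dehom mu = 1 := by simp [dehom, mu]

theorem isLinePair_rootForm (x : ℂ) : IsLinePair (rootForm x) mu where
  prime := prime_rootForm x
  isHomogeneous_left := isHomogeneous_rootForm x
  isHomogeneous_right := isHomogeneous_mu
  not_dvd := not_rootForm_dvd_mu x
  exists_dvd_sub := fun {k c} hc => by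
    refine ⟨(dehom c).eval (-x), ?_⟩
    refine rootForm_dvd_of_isRoot (hc.sub (isHomogeneous_C_mul_pow isHomogeneous_mu _ k)) ?_
    rw [map_sub, map_mul, map_pow, dehom_mu, one_pow, mul_one, Polynomial.IsRoot.def,
      Polynomial.eval_sub]
    simp [dehom]

/-- Modulo `μ` a homogeneous polynomial is its leading term in `λ`. -/
theorem mu_dvd_sub {k : ℕ} {c : Poly} (hc : c.IsHomogeneous k) :
    mu ∣ c - MvPolynomial.C (c.coeff (Finsupp.single 1 k)) * lam ^ k := by
  rw [mu, lam, MvPolynomial.X_dvd_iff_modMonomial_eq_zero]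
  ext d
  rw [MvPolynomial.coeff_zero]
  by_cases h0 : Finsupp.single 0 1 ≤ d
  · exact MvPolynomial.coeff_modMonomial_of_le _ h0
  · rw [MvPolynomial.coeff_modMonomial_of_not_le _ h0, MvPolynomial.coeff_sub,
      MvPolynomial.coeff_C_mul, MvPolynomial.coeff_X_pow]
    have hd0 : d 0 = 0 := by
      rw [Finsupp.single_le_iff] at h0
      omega
    split_ifs with h
    · rw [h, mul_one, sub_self]
    · rw [mul_zero, sub_zero]
      by_contra hne
      have := add_eq_of_mem_support hc (MvPolynomial.mem_support_iff.mpr hne)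
      refine h ?_
      ext i
      fin_cases i
      · simp [hd0]
      · simp; omega

theorem isLinePair_mu : IsLinePair mu lam where
  prime := prime_mu
  isHomogeneous_left := isHomogeneous_mu
  isHomogeneous_right := isHomogeneous_lam
  not_dvd := by
    rw [mu, lam, MvPolynomial.X_dvd_X]
    decide
  exists_dvd_sub := fun hc => ⟨_, mu_dvd_sub hc⟩

/-- A homogeneous polynomial of positive degree in two variables has a linear factor. -/
theorem exists_linear_factor {c : Poly} {k : ℕ} (hc : c.IsHomogeneous (k + 1)) :
    ∃ l h, IsLinePair l h ∧ l ∣ c := by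
  by_cases hd : (dehom c).degree = 0
  · refine ⟨mu, lam, isLinePair_mu, ?_⟩
    have hdC := Polynomial.eq_C_of_degree_le_zero hd.le
    have h0 : c - MvPolynomial.C ((dehom c).coeff 0) * mu ^ (k + 1) = 0 := by
      by_contra hne
      refine aeval_ne_zero (hc.sub (isHomogeneous_C_mul_pow isHomogeneous_mu _ _)) hne ?_
      change dehom _ = 0
      rw [map_sub, map_mul, map_pow, dehom_mu, one_pow, mul_one, sub_eq_zero]
      conv_lhs => rw [hdC]
      simp [dehom]
    rw [sub_eq_zero.mp h0, pow_succ]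
    exact (dvd_mul_left _ _).mul_left _
  · obtain ⟨z, hz⟩ := IsAlgClosed.exists_root (dehom c) hd
    refine ⟨rootForm (-z), mu, isLinePair_rootForm _, rootForm_dvd_of_isRoot hc ?_⟩
    rwa [neg_neg]

/-- A linearly independent family of homogeneous elements of given degrees in a submodule. -/
structure IsGradedFamily {p : ℕ} (K : Submodule Poly (Fin n → Poly)) (ε : Fin p → ℕ)
    (v : Fin p → Fin n → Poly) : Prop where
  homogeneous : ∀ i j, (v i j).IsHomogeneous (ε i)
  mem : ∀ i, v i ∈ K
  linearIndependent : LinearIndependent Poly v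

/-- A submodule that contains the homogeneous components of its elements and all the elements that
have a nonzero multiple in it. -/
structure IsGradedSaturated (K : Submodule Poly (Fin n → Poly)) : Prop where
  component_mem : ∀ {w}, w ∈ K → ∀ d,
    (fun j => MvPolynomial.homogeneousComponent d (w j)) ∈ K
  mem_of_smul_mem : ∀ {c : Poly} {w}, c ≠ 0 → c • w ∈ K → w ∈ K

section GradedBasis

variable {p : ℕ} {K : Submodule Poly (Fin n → Poly)} {ε : Fin p → ℕ} {v : Fin p → Fin n → Poly}

/-- If a combination of the members of a family of smallest total degree is divisible by a linear
form, then so are the coefficients: otherwise, a quotient by the linear form could replace a member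
of the family and lower the total degree. -/
theorem IsGradedFamily.dvd_of_dvd_sum (hv : IsGradedFamily K ε v) (hK : IsGradedSaturated K)
    (hmin : ∀ (ε' : Fin p → ℕ) (v' : Fin p → Fin n → Poly), IsGradedFamily K ε' v' →
      ∑ i, ε i ≤ ∑ i, ε' i)
    {l h : Poly} (hl : IsLinePair l h) {d : ℕ} {c : Fin p → Poly}
    (hc : ∀ i, (ε i ≤ d ∧ (c i).IsHomogeneous (d - ε i)) ∨ c i = 0)
    (hdvd : ∀ j, l ∣ (∑ i, c i • v i) j) (i : Fin p) : l ∣ c i := by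
  classical
  by_contra hi
  let I := Finset.univ.filter fun i => ¬ l ∣ c i
  obtain ⟨i₀, hi₀, hmax⟩ := Finset.exists_max_image I ε ⟨i, by simp [I, hi]⟩
  have hI : ∀ i ∈ I, ε i ≤ d ∧ (c i).IsHomogeneous (d - ε i) := fun i hi =>
    (hc i).resolve_right fun h0 => (Finset.mem_filter.mp hi).2 (h0 ▸ dvd_zero l)
  have ha : ∀ i, ∃ a : ℂ, i ∈ I → a ≠ 0 ∧ l ∣ c i - MvPolynomial.C a * h ^ (d - ε i) := by
    intro i
    by_cases hi : i ∈ I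
    · obtain ⟨a, ha⟩ := hl.exists_dvd_sub (hI i hi).2
      refine ⟨a, fun _ => ⟨?_, ha⟩⟩
      rintro rfl
      rw [map_zero, zero_mul, sub_zero] at ha
      exact (Finset.mem_filter.mp hi).2 ha
    · exact ⟨0, fun h => absurd h hi⟩
  choose a ha using ha
  -- Modulo `l`, the combination is a multiple of the following one, whose coefficient at `i₀`
  -- is a constant.
  let b : Fin p → Poly := fun i =>
    if i ∈ I then MvPolynomial.C (a i) * h ^ (ε i₀ - ε i) else 0
  have hb : ∀ j, l ∣ (∑ i, b i • v i) j := by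
    intro j
    have h1 : l ∣ h ^ (d - ε i₀) * (∑ i, b i • v i) j := by
      have h2 : l ∣ (∑ i, c i • v i) j - h ^ (d - ε i₀) * (∑ i, b i • v i) j := by
        simp only [Finset.sum_apply, Finset.mul_sum, ← Finset.sum_sub_distrib, Pi.smul_apply,
          smul_eq_mul, ← mul_assoc, ← sub_mul]
        refine Finset.dvd_sum fun i _ => Dvd.dvd.mul_right ?_ _
        by_cases hi : i ∈ I
        · simp only [b, if_pos hi]
          have := (ha i hi).2
          rwa [show d - ε i = (d - ε i₀) + (ε i₀ - ε i) by
            have := (hI i₀ hi₀).1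
            have := hmax i hi
            omega, pow_add, mul_left_comm] at this
        · simp only [b, if_neg hi, mul_zero, sub_zero]
          by_contra hcon
          exact hi (Finset.mem_filter.mpr ⟨Finset.mem_univ i, hcon⟩)
      exact (dvd_iff_dvd_of_dvd_sub h2).mp (hdvd j)
    exact (hl.prime.dvd_or_dvd h1).resolve_left fun h3 => hl.not_dvd (hl.prime.dvd_of_dvd_pow h3)
  choose w hw using hb
  have hw' : l • w = ∑ i, b i • v i := funext fun j => (hw j).symm
  have hb0 : b i₀ = MvPolynomial.C (a i₀) := by simp [b, hi₀]
  have hbhom : ∀ j, ((∑ i, b i • v i) j).IsHomogeneous (ε i₀) := by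
    intro j
    rw [Finset.sum_apply]
    refine MvPolynomial.IsHomogeneous.sum _ _ _ fun i _ => ?_
    by_cases hi : i ∈ I
    · have h1 := ((MvPolynomial.isHomogeneous_C (Fin 2) (a i)).mul
        (hl.isHomogeneous_right.pow (ε i₀ - ε i))).mul (hv.homogeneous i j)
      simp only [b, if_pos hi, Pi.smul_apply, smul_eq_mul]
      have h2 := hmax i hi
      rwa [show 0 + 1 * (ε i₀ - ε i) + ε i = ε i₀ by omega] at h1
    · simpa [b, if_neg hi] using MvPolynomial.isHomogeneous_zero (Fin 2) ℂ (ε i₀)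
  have hli := Fintype.linearIndependent_iff.mp hv.linearIndependent
  have hb0' : b i₀ ≠ 0 := by
    rw [hb0]
    exact (isUnit_C (ha i₀ hi₀).1).ne_zero
  have hpos : 1 ≤ ε i₀ := by
    by_contra hcon
    refine hb0' (hli b ?_ i₀)
    funext j
    have h1 := homogeneousComponent_mul_of_lt (q := w j) (d := ε i₀) hl.isHomogeneous_left
      (by omega)
    rw [← hw j, MvPolynomial.homogeneousComponent_eq_self (hbhom j)] at h1
    exact h1
  have hnew : IsGradedFamily K (Function.update ε i₀ (ε i₀ - 1)) (Function.update v i₀ w) := by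
    refine ⟨fun i j => ?_, fun i => ?_, Fintype.linearIndependent_iff.mpr fun g hg => ?_⟩
    · by_cases hi : i = i₀
      · subst hi
        simp only [Function.update_self]
        refine isHomogeneous_of_mul hl.isHomogeneous_left hl.prime.ne_zero ?_
        rw [← hw j, Nat.add_sub_cancel' hpos]
        exact hbhom j
      · simp only [Function.update_of_ne hi]
        exact hv.homogeneous i j
    · by_cases hi : i = i₀
      · subst hi
        rw [Function.update_self]
        refine hK.mem_of_smul_mem hl.prime.ne_zero ?_
        rw [hw']
        exact K.sum_mem fun i _ => K.smul_mem _ (hv.mem i)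
      · rw [Function.update_of_ne hi]
        exact hv.mem i
    · have h1 : ∑ i, (if i = i₀ then g i₀ * b i₀ else l * g i + g i₀ * b i) • v i = 0 := by
        have h2 : ∑ i, g i • Function.update v i₀ w i =
            (∑ i ∈ Finset.univ.erase i₀, g i • v i) + g i₀ • w := by
          rw [← Finset.sum_erase_add _ _ (Finset.mem_univ i₀), Function.update_self]
          congr 1
          refine Finset.sum_congr rfl fun i hi => ?_
          rw [Function.update_of_ne (Finset.ne_of_mem_erase hi)]
        have h3 := congrArg (l • ·) (h2.symm.trans hg)
        simp only [smul_add, smul_zero] at h3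
        rw [smul_comm l, hw', ← Finset.sum_erase_add _ _ (Finset.mem_univ i₀), smul_add,
          Finset.smul_sum, Finset.smul_sum, ← add_assoc, ← Finset.sum_add_distrib] at h3
        rw [← Finset.sum_erase_add _ _ (Finset.mem_univ i₀), if_pos rfl, ← h3, smul_smul]
        congr 1
        refine Finset.sum_congr rfl fun i hi => ?_
        rw [if_neg (Finset.ne_of_mem_erase hi), add_smul, mul_smul, mul_smul]
      have h4 := hli _ h1
      have h5 : g i₀ = 0 := by
        have := h4 i₀
        rw [if_pos rfl] at this
        exact (mul_eq_zero.mp this).resolve_right hb0'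
      intro i
      by_cases hi : i = i₀
      · rw [hi, h5]
      · have := h4 i
        rw [if_neg hi, h5, zero_mul, add_zero] at this
        exact (mul_eq_zero.mp this).resolve_left hl.prime.ne_zero
  have hrest : ∀ i ∈ Finset.univ.erase i₀, Function.update ε i₀ (ε i₀ - 1) i = ε i := fun i hi =>
    Function.update_of_ne (Finset.ne_of_mem_erase hi) _ _
  have := hmin _ _ hnew
  rw [← Finset.sum_erase_add _ _ (Finset.mem_univ i₀),
    ← Finset.sum_erase_add Finset.univ (Function.update ε _ _) (Finset.mem_univ i₀),
    Function.update_self, Finset.sum_congr rfl hrest] at this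
  have := Nat.le_of_add_le_add_left this
  omega

/-- A maximal graded family generates up to multiples. -/
theorem IsGradedFamily.exists_smul_mem_span (hv : IsGradedFamily K ε v)
    (hmax : ∀ (ε' : Fin (p + 1) → ℕ) (v' : Fin (p + 1) → Fin n → Poly), ¬ IsGradedFamily K ε' v')
    {d : ℕ} {w : Fin n → Poly} (hw : w ∈ K) (hd : ∀ j, (w j).IsHomogeneous d) :
    ∃ (e : ℕ) (c : Poly), c ≠ 0 ∧ c.IsHomogeneous e ∧
      c • w ∈ Submodule.span Poly (Set.range v) := by
  have h1 : ∃ c : Poly, c ≠ 0 ∧ c • w ∈ Submodule.span Poly (Set.range v) := by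
    by_contra! hcon
    refine hmax (Fin.cons d ε) (Fin.cons w v) ⟨?_, ?_, ?_⟩
    · exact fun i => Fin.cases hd hv.homogeneous i
    · exact fun i => Fin.cases hw hv.mem i
    · refine LinearIndependent.finCons' w v hv.linearIndependent fun c y hy hcy => ?_
      by_contra hc
      refine hcon c hc ?_
      rw [eq_neg_of_add_eq_zero_left hcy]
      exact Submodule.neg_mem _ hy
  obtain ⟨c, hc, hcw⟩ := h1
  obtain ⟨e, he⟩ : ∃ e, MvPolynomial.homogeneousComponent e c ≠ 0 := by
    by_contra! hcon
    rw [← MvPolynomial.sum_homogeneousComponent c, Finset.sum_eq_zero fun i _ => hcon i] at hc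
    exact hc rfl
  refine ⟨e, _, he, MvPolynomial.homogeneousComponent_isHomogeneous e c, ?_⟩
  obtain ⟨b, hb⟩ := (Submodule.mem_span_range_iff_exists_fun Poly).mp hcw
  refine (Submodule.mem_span_range_iff_exists_fun Poly).mpr
    ⟨fun i => shiftComp (e + d) (ε i) (b i), funext fun j => ?_⟩
  have h2 := homogeneousComponent_sum_smul hv.homogeneous b (e + d) j
  rw [← h2, hb, Pi.smul_apply, Pi.smul_apply, smul_eq_mul, homogeneousComponent_mul (hd j),
    shiftComp, if_pos (Nat.le_add_left d e), Nat.add_sub_cancel, smul_eq_mul]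

theorem isHomogeneous_shiftComp (d e : ℕ) (c : Poly) :
    (e ≤ d ∧ (shiftComp d e c).IsHomogeneous (d - e)) ∨ shiftComp d e c = 0 := by
  unfold shiftComp
  split_ifs with h
  · exact Or.inl ⟨h, MvPolynomial.homogeneousComponent_isHomogeneous _ _⟩
  · exact Or.inr rfl

/-- A graded family of maximal size and, for this size, of smallest total degree generates: a
homogeneous element has a multiple in the span, and linear factors of the multiplier cancel. -/
theorem IsGradedFamily.le_span (hv : IsGradedFamily K ε v) (hK : IsGradedSaturated K)
    (hmin : ∀ (ε' : Fin p → ℕ) (v' : Fin p → Fin n → Poly), IsGradedFamily K ε' v' →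
      ∑ i, ε i ≤ ∑ i, ε' i)
    (hmax : ∀ (ε' : Fin (p + 1) → ℕ) (v' : Fin (p + 1) → Fin n → Poly), ¬ IsGradedFamily K ε' v') :
    K ≤ Submodule.span Poly (Set.range v) := by
  have key : ∀ (e d : ℕ) (c : Poly) (w : Fin n → Poly), c ≠ 0 → c.IsHomogeneous e → w ∈ K →
      (∀ j, (w j).IsHomogeneous d) → c • w ∈ Submodule.span Poly (Set.range v) →
      w ∈ Submodule.span Poly (Set.range v) := by
    intro e d
    induction e with
    | zero =>
      intro c w hc hce _ _ h
      obtain ⟨a, rfl⟩ : ∃ a, c = MvPolynomial.C a :=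
        ⟨_, MvPolynomial.totalDegree_eq_zero_iff_eq_C.mp (Nat.le_zero.mp hce.totalDegree_le)⟩
      have ha : a ≠ 0 := fun h => hc (by rw [h, map_zero])
      exact (Submodule.smul_mem_iff_of_isUnit _ (isUnit_C ha)).mp h
    | succ e ih =>
      intro c w hc hce hw hwd h
      obtain ⟨l, h', hl, c', rfl⟩ := exists_linear_factor hce
      have hc' := right_ne_zero_of_mul hc
      have hce' : c'.IsHomogeneous e :=
        isHomogeneous_of_mul hl.isHomogeneous_left hl.prime.ne_zero (by rwa [add_comm])
      obtain ⟨b, hb⟩ := (Submodule.mem_span_range_iff_exists_fun Poly).mp h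
      have hb' : ∑ i, shiftComp (e + 1 + d) (ε i) (b i) • v i = (l * c') • w := by
        funext j
        rw [← homogeneousComponent_sum_smul hv.homogeneous, hb]
        refine MvPolynomial.homogeneousComponent_eq_self ?_
        exact hce.mul (hwd j)
      have hdvd := hv.dvd_of_dvd_sum hK hmin hl (d := e + 1 + d)
        (fun i => isHomogeneous_shiftComp _ _ (b i)) fun j => by
          rw [hb', Pi.smul_apply, smul_eq_mul, mul_assoc]
          exact dvd_mul_right _ _
      choose b' hb'' using hdvd
      refine ih c' w hc' hce' hw hwd ?_
      refine (Submodule.mem_span_range_iff_exists_fun Poly).mpr ⟨b', ?_⟩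
      refine smul_right_injective _ hl.prime.ne_zero ?_
      simp only [Finset.smul_sum, smul_smul, ← hb'']
      exact hb'
  intro w hw
  have hw' : w = ∑ d ∈ Finset.range (Finset.univ.sup (fun j => (w j).totalDegree) + 1),
      fun j => MvPolynomial.homogeneousComponent d (w j) := by
    funext j
    rw [Finset.sum_apply]
    conv_lhs => rw [← MvPolynomial.sum_homogeneousComponent (w j)]
    refine Finset.sum_subset (Finset.range_mono (Nat.succ_le_succ
      (Finset.le_sup (f := fun j => (w j).totalDegree) (Finset.mem_univ j)))) fun d _ hd => ?_
    rw [Finset.mem_range, not_lt] at hd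
    exact MvPolynomial.homogeneousComponent_eq_zero _ _ hd
  rw [hw']
  refine Submodule.sum_mem _ fun d _ => ?_
  have hd : ∀ j, (MvPolynomial.homogeneousComponent d (w j)).IsHomogeneous d := fun j =>
    MvPolynomial.homogeneousComponent_isHomogeneous d (w j)
  obtain ⟨e, c, hc, hce, hcw⟩ := hv.exists_smul_mem_span hmax (hK.component_mem hw d) hd
  exact key e d c _ hc hce (hK.component_mem hw d) hd hcw

theorem IsGradedFamily.comp_equiv (hv : IsGradedFamily K ε v) (σ : Equiv.Perm (Fin p)) :
    IsGradedFamily K (ε ∘ σ) (v ∘ σ) :=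
  ⟨fun i => hv.homogeneous (σ i), fun i => hv.mem (σ i),
    hv.linearIndependent.comp σ σ.injective⟩

/-- A graded saturated submodule is free on homogeneous generators. -/
theorem IsGradedSaturated.exists_basis (hK : IsGradedSaturated K) :
    ∃ (p : ℕ) (ε : Fin p → ℕ) (v : Fin p → Fin n → Poly), Monotone ε ∧ IsGradedFamily K ε v ∧
      K ≤ Submodule.span Poly (Set.range v) := by
  classical
  let Q : ℕ → Prop := fun p =>
    ∃ (ε : Fin p → ℕ) (v : Fin p → Fin n → Poly), IsGradedFamily K ε v
  have hQ0 : Q 0 := ⟨Fin.elim0, Fin.elim0, ⟨fun i => i.elim0, fun i => i.elim0,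
    linearIndependent_empty_type⟩⟩
  have hQn : ∀ p, Q p → p ≤ n := by
    rintro p ⟨ε, v, hv⟩
    simpa using hv.linearIndependent.fintype_card_le_finrank
  obtain ⟨p, hp, hp'⟩ : ∃ p, Q p ∧ ¬ Q (p + 1) := by
    by_contra! hcon
    have h1 : ∀ p, Q p := fun p => Nat.rec hQ0 hcon p
    exact absurd (hQn _ (h1 (n + 1))) (by omega)
  have hs : ∃ s, ∃ (ε : Fin p → ℕ) (v : Fin p → Fin n → Poly), IsGradedFamily K ε v ∧
      ∑ i, ε i = s := by
    obtain ⟨ε, v, hv⟩ := hp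
    exact ⟨_, ε, v, hv, rfl⟩
  obtain ⟨ε, v, hv, hsum⟩ := Nat.find_spec hs
  have hspan := hv.le_span hK
    (fun ε' v' hv' => hsum.trans_le (Nat.find_min' hs ⟨ε', v', hv', rfl⟩))
    fun ε' v' hv' => hp' ⟨ε', v', hv'⟩
  refine ⟨p, ε ∘ Tuple.sort ε, v ∘ Tuple.sort ε, Tuple.monotone_sort ε, hv.comp_equiv _, ?_⟩
  rwa [Set.range_comp, (Tuple.sort ε).surjective.range_eq, Set.image_univ]

end GradedBasis

/-! ### Minimal indices -/

/-- The right null space of a matrix, over the polynomials. -/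
def nullModule (P : Matrix (Fin m) (Fin n) Poly) : Submodule Poly (Fin n → Poly) :=
  LinearMap.ker P.mulVecLin

theorem mem_nullModule {P : Matrix (Fin m) (Fin n) Poly} {w : Fin n → Poly} :
    w ∈ nullModule P ↔ P.mulVec w = 0 := Iff.rfl

theorem isHomogeneous_pencil (ψ : State m n) (i : Fin m) (j : Fin n) :
    (pencil ψ i j).IsHomogeneous 1 := by
  rw [pencil_apply]
  refine MvPolynomial.IsHomogeneous.sum _ _ _ fun α _ => ?_
  exact (MvPolynomial.isHomogeneous_X ℂ α).mul
    (MvPolynomial.isHomogeneous_C (Fin 2) (ψ (α, i, j)))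

theorem isGradedSaturated_nullModule (ψ : State m n) :
    IsGradedSaturated (nullModule (pencil ψ)) where
  component_mem := fun {w} hw d => by
    rw [mem_nullModule] at hw ⊢
    funext i
    have h1 := congrArg (MvPolynomial.homogeneousComponent (d + 1)) (congrFun hw i)
    simp only [Matrix.mulVec, dotProduct, map_sum, Pi.zero_apply, map_zero] at h1 ⊢
    rw [← h1]
    refine Finset.sum_congr rfl fun j _ => ?_
    rw [homogeneousComponent_mul_of_le (isHomogeneous_pencil ψ i j) (Nat.le_add_left 1 d),
      Nat.add_sub_cancel]
  mem_of_smul_mem := fun {c w} hc hw => by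
    rw [mem_nullModule, Matrix.mulVec_smul] at hw
    exact (smul_eq_zero.mp hw).resolve_left hc

/-- A basis of the null space over the polynomials, with homogeneous members listed by increasing
degree. -/
structure IsHomogeneousNullBasis {p : ℕ} (P : Matrix (Fin m) (Fin n) Poly) (ε : Fin p → ℕ)
    (v : Fin p → Fin n → Poly) : Prop where
  monotone : Monotone ε
  family : IsGradedFamily (nullModule P) ε v
  le_span : nullModule P ≤ Submodule.span Poly (Set.range v)

theorem exists_isHomogeneousNullBasis (ψ : State m n) :
    ∃ (p : ℕ) (ε : Fin p → ℕ) (v : Fin p → Fin n → Poly),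
      IsHomogeneousNullBasis (pencil ψ) ε v := by
  obtain ⟨p, ε, v, h1, h2, h3⟩ := (isGradedSaturated_nullModule ψ).exists_basis
  exact ⟨p, ε, v, h1, h2, h3⟩

theorem card_le_of_mem_span {M : Type*} [AddCommGroup M] [Module Poly M] {k l : ℕ}
    {u : Fin k → M} {w : Fin l → M} (hu : LinearIndependent Poly u)
    (h : ∀ i, u i ∈ Submodule.span Poly (Set.range w)) : k ≤ l := by
  classical
  have h1 := linearIndependent_le_span' u hu (Set.range w) (by
    rintro _ ⟨i, rfl⟩
    exact h i)
  rw [Cardinal.mk_fin, Nat.cast_le] at h1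
  exact h1.trans ((Fintype.card_range_le w).trans_eq (Fintype.card_fin l))

section

variable {p : ℕ} {P : Matrix (Fin m) (Fin n) Poly} {ε : Fin p → ℕ} {v : Fin p → Fin n → Poly}

theorem IsHomogeneousNullBasis.exists_sum (h : IsHomogeneousNullBasis P ε v) {w : Fin n → Poly}
    (hw : P.mulVec w = 0) : ∃ c : Fin p → Poly, ∑ i, c i • v i = w :=
  (Submodule.mem_span_range_iff_exists_fun Poly).mp (h.le_span hw)

/-- A homogeneous null vector is a combination of the basis vectors with homogeneous coefficients;
in particular, only basis vectors of smaller or equal degree occur. -/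
theorem IsHomogeneousNullBasis.exists_homogeneous_sum (h : IsHomogeneousNullBasis P ε v)
    {w : Fin n → Poly} (hw : P.mulVec w = 0) {d : ℕ} (hd : ∀ j, (w j).IsHomogeneous d) :
    ∃ c : Fin p → Poly, ∑ i, shiftComp d (ε i) (c i) • v i = w := by
  obtain ⟨c, rfl⟩ := h.exists_sum hw
  refine ⟨c, funext fun j => ?_⟩
  rw [← homogeneousComponent_sum_smul h.family.homogeneous]
  exact MvPolynomial.homogeneousComponent_eq_self (hd j)

theorem IsHomogeneousNullBasis.isNullBasis (h : IsHomogeneousNullBasis P ε v) :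
    IsNullBasis P ε v where
  monotone := h.monotone
  nullVector := fun i =>
    { homogeneous := h.family.homogeneous i
      mulVec_eq_zero := h.family.mem i
      coeff_ne_zero := by
        -- Otherwise `μ` divides the vector, and the quotient is a null vector outside the span.
        by_contra! hcon
        have hmu : ∀ j, mu ∣ v i j := fun j => by
          have := mu_dvd_sub (h.family.homogeneous i j)
          rwa [hcon j, map_zero, zero_mul, sub_zero] at this
        choose w hw using hmu
        have hw' : mu • w = v i := funext fun j => (hw j).symm
        have hPw : P.mulVec w = 0 := by
          have h1 : P.mulVec (v i) = 0 := h.family.mem i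
          rw [← hw', Matrix.mulVec_smul] at h1
          exact (smul_eq_zero.mp h1).resolve_left prime_mu.ne_zero
        obtain ⟨c, rfl⟩ := h.exists_sum hPw
        rw [Finset.smul_sum] at hw'
        simp only [smul_smul] at hw'
        have h2 := Fintype.linearIndependent_iff.mp h.family.linearIndependent
          (fun k => mu * c k - if k = i then 1 else 0) (by
            simp only [sub_smul, Finset.sum_sub_distrib, hw', ite_smul, one_smul, zero_smul,
              Finset.sum_ite_eq', Finset.mem_univ, if_true, sub_self]) i
        rw [if_pos rfl, sub_eq_zero] at h2
        exact prime_mu.not_isUnit (IsUnit.of_mul_eq_one _ h2) }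
  linearIndependent := h.family.linearIndependent
  spanning := fun w hw => ⟨1, one_ne_zero, by rw [one_smul]; exact h.le_span hw⟩

/-- Otherwise `i + 1` independent null vectors of degrees less than `ε i` would lie in the span of
the first `i` basis vectors. -/
theorem IsHomogeneousNullBasis.le_of_isNullBasis (h : IsHomogeneousNullBasis P ε v)
    {ε' : Fin p → ℕ} {v' : Fin p → Fin n → Poly} (h' : IsNullBasis P ε' v') (i : Fin p) :
    ε i ≤ ε' i := by
  by_contra! hlt
  have hT : ∀ k : Fin (i + 1), v' ⟨k, by omega⟩ ∈
      Submodule.span Poly (Set.range fun k : Fin i => v ⟨k, k.2.trans i.2⟩) := by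
    intro k
    have hk := h'.nullVector ⟨k, by omega⟩
    obtain ⟨c, hc⟩ := h.exists_homogeneous_sum hk.mulVec_eq_zero hk.homogeneous
    rw [← hc]
    refine Submodule.sum_mem _ fun l _ => ?_
    by_cases hl : l < i
    · exact Submodule.smul_mem _ _ (Submodule.subset_span ⟨⟨l, hl⟩, rfl⟩)
    · have h1 : ε' ⟨k, by omega⟩ ≤ ε' i := h'.monotone (Nat.le_of_lt_succ k.2)
      have h2 : ε i ≤ ε l := h.monotone (not_lt.mp hl)
      rw [shiftComp, if_neg (by omega), zero_smul]
      exact Submodule.zero_mem _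
  have hli : LinearIndependent Poly fun k : Fin (i + 1) => v' ⟨k, by omega⟩ :=
    h'.linearIndependent.comp (fun k : Fin (i + 1) => (⟨k, by omega⟩ : Fin p)) fun a b hab =>
      Fin.ext (Fin.mk.inj_iff.mp hab)
  exact absurd (card_le_of_mem_span hli hT) (by omega)

theorem IsHomogeneousNullBasis.isRightMinimalIndices (h : IsHomogeneousNullBasis P ε v) :
    IsRightMinimalIndices P ε :=
  ⟨v, h.isNullBasis, fun _ _ h' => h.le_of_isNullBasis h'⟩

/-- Two bases over the field of rational functions have the same size. -/
theorem IsNullBasis.card_le {p' : ℕ} {ε' : Fin p' → ℕ} {v' : Fin p' → Fin n → Poly}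
    (h : IsNullBasis P ε v) (h' : IsNullBasis P ε' v') : p' ≤ p := by
  have h1 := fun i => h.spanning (v' i) (h'.nullVector i).mulVec_eq_zero
  choose c hc hcv using h1
  have hli : LinearIndependent Poly fun i => c i • v' i := by
    refine Fintype.linearIndependent_iff.mpr fun g hg i => ?_
    simp only [smul_smul] at hg
    exact (mul_eq_zero.mp (Fintype.linearIndependent_iff.mp h'.linearIndependent _ hg
      i)).resolve_right (hc i)
  exact card_le_of_mem_span hli hcv

/-- The minimal indices are unique. -/
theorem IsRightMinimalIndices.eq {p' : ℕ} {ε' : Fin p' → ℕ}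
    (h : IsRightMinimalIndices P ε) (h' : IsRightMinimalIndices P ε') :
    ∃ e : p = p', ε = ε' ∘ Fin.cast e := by
  obtain ⟨v, hv, hmin⟩ := h
  obtain ⟨v', hv', hmin'⟩ := h'
  obtain rfl := le_antisymm (hv'.card_le hv) (hv.card_le hv')
  exact ⟨rfl, funext fun i => le_antisymm (hmin _ _ hv' i) (hmin' _ _ hv i)⟩

end

/-- The minimal indices are the degrees of a homogeneous basis over the polynomials. -/
theorem IsRightMinimalIndices.exists_isHomogeneousNullBasis {p : ℕ} {ψ : State m n}
    {ε : Fin p → ℕ} (h : IsRightMinimalIndices (pencil ψ) ε) :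
    ∃ v, IsHomogeneousNullBasis (pencil ψ) ε v := by
  obtain ⟨p', ε', v', hv'⟩ := TwoMN.exists_isHomogeneousNullBasis ψ
  obtain ⟨rfl, rfl⟩ := h.eq hv'.isRightMinimalIndices
  exact ⟨v', hv'⟩

/-! ### Invariance of the minimal indices -/

theorem constMat_mulVec_isHomogeneous {k l : ℕ} (B : Matrix (Fin k) (Fin l) ℂ) {w : Fin l → Poly}
    {d : ℕ} (hw : ∀ j, (w j).IsHomogeneous d) (i : Fin k) :
    ((constMat B).mulVec w i).IsHomogeneous d := by
  refine MvPolynomial.IsHomogeneous.sum _ _ _ fun j _ => ?_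
  have := (MvPolynomial.isHomogeneous_C (Fin 2) (B i j)).mul (hw j)
  rwa [zero_add] at this

theorem linSubst_isHomogeneous (A : Matrix (Fin 2) (Fin 2) ℂ) {c : Poly} {d : ℕ}
    (hc : c.IsHomogeneous d) : (linSubst A c).IsHomogeneous d := by
  have := hc.aeval (fun j => ∑ i, MvPolynomial.C (A i j) * MvPolynomial.X i) (n := 1) fun j =>
    MvPolynomial.IsHomogeneous.sum _ _ _ fun i _ => by
      have := (MvPolynomial.isHomogeneous_C (Fin 2) (A i j)).mul (MvPolynomial.isHomogeneous_X ℂ i)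
      rwa [zero_add] at this
  rwa [one_mul] at this

/-- Local equivalence maps `v` to `(Dᵀ)⁻¹ v(Aᵀ(μ, λ))`, which keeps degrees. -/
theorem IsHomogeneousNullBasis.transport {p : ℕ} {P Q : Matrix (Fin m) (Fin n) Poly}
    {ε : Fin p → ℕ} {v : Fin p → Fin n → Poly} (h : IsHomogeneousNullBasis P ε v)
    (A : GL (Fin 2) ℂ) (B : GL (Fin m) ℂ) (D : GL (Fin n) ℂ)
    (hQ : Q = constMat (B : Matrix (Fin m) (Fin m) ℂ) * P.map (linSubst A) *
        (constMat (D : Matrix (Fin n) (Fin n) ℂ)).transpose) :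
    ∃ v', IsHomogeneousNullBasis Q ε v' := by
  have hθ : ∀ c, linSubst A (linSubst (A⁻¹ : GL (Fin 2) ℂ) c) = c :=
    (linSubstEquiv A).apply_symm_apply
  have hθ' : ∀ c, linSubst (A⁻¹ : GL (Fin 2) ℂ) (linSubst A c) = c :=
    (linSubstEquiv A).symm_apply_apply
  set D' := (constMat (D : Matrix (Fin n) (Fin n) ℂ)).transpose with hD'
  set E := (constMat ((D⁻¹ : GL (Fin n) ℂ) : Matrix (Fin n) (Fin n) ℂ)).transpose with hE
  have hDE : D' * E = 1 := by
    rw [← Matrix.transpose_mul, constMat_inv_mul, Matrix.transpose_one]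
  have hED : E * D' = 1 := by
    rw [← Matrix.transpose_mul, ← constMat_mul, ← Units.val_mul, mul_inv_cancel, Units.val_one,
      constMat_one, Matrix.transpose_one]
  have hPθ : ∀ w, (P.map (linSubst A)).mulVec (fun j => linSubst A (w j)) =
      fun i => linSubst A (P.mulVec w i) := fun w => by
    funext i
    simp [Matrix.mulVec, dotProduct]
  let Φ : (Fin n → Poly) → Fin n → Poly := fun w => E.mulVec fun j => linSubst A (w j)
  have hΦsum : ∀ (c : Fin p → Poly) (u : Fin p → Fin n → Poly),
      Φ (∑ i, c i • u i) = ∑ i, linSubst A (c i) • Φ (u i) := by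
    intro c u
    have : (fun j => linSubst A ((∑ i, c i • u i) j)) =
        ∑ i, linSubst A (c i) • fun j => linSubst A (u i j) := by
      funext j
      simp
    simp only [Φ, this]
    rw [← Matrix.mulVecLin_apply, map_sum]
    simp only [map_smul, Matrix.mulVecLin_apply]
  have hΦ0 : ∀ w, Φ w = 0 → w = 0 := by
    intro w hw
    have h1 : (fun j => linSubst A (w j)) = 0 := by
      rw [← Matrix.one_mulVec fun j => linSubst A (w j), ← hDE, ← Matrix.mulVec_mulVec]
      exact (congrArg D'.mulVec hw).trans (Matrix.mulVec_zero _)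
    funext j
    rw [← hθ' (w j), congrFun h1 j, Pi.zero_apply, map_zero]
  refine ⟨fun i => Φ (v i), h.monotone, ⟨fun i j => ?_, fun i => ?_, ?_⟩, fun w hw => ?_⟩
  · exact constMat_mulVec_isHomogeneous
      ((D⁻¹ : GL (Fin n) ℂ) : Matrix (Fin n) (Fin n) ℂ).transpose
      (fun j => linSubst_isHomogeneous A (h.family.homogeneous i j)) j
  · have h1 : D'.mulVec (Φ (v i)) = fun j => linSubst A (v i j) := by
      rw [Matrix.mulVec_mulVec, hDE, Matrix.one_mulVec]
    rw [mem_nullModule, hQ, ← Matrix.mulVec_mulVec, h1, ← Matrix.mulVec_mulVec, hPθ,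
      mem_nullModule.mp (h.family.mem i)]
    simp only [Pi.zero_apply, map_zero]
    exact Matrix.mulVec_zero _
  · refine Fintype.linearIndependent_iff.mpr fun g hg i => ?_
    have h1 := hΦsum (fun i => linSubst (A⁻¹ : GL (Fin 2) ℂ) (g i)) v
    simp only [hθ] at h1
    have h2 := Fintype.linearIndependent_iff.mp h.family.linearIndependent _
      (hΦ0 _ (h1.trans hg)) i
    rw [← hθ (g i), h2, map_zero]
  · rw [mem_nullModule, hQ, ← Matrix.mulVec_mulVec, ← Matrix.mulVec_mulVec] at hw
    let w' : Fin n → Poly := fun j => linSubst (A⁻¹ : GL (Fin 2) ℂ) (D'.mulVec w j)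
    have hw' : (fun j => linSubst A (w' j)) = D'.mulVec w := funext fun j => hθ _
    have hΦw : Φ w' = w := by
      simp only [Φ, hw', Matrix.mulVec_mulVec, hED, Matrix.one_mulVec]
    have hPw : P.mulVec w' = 0 := by
      rw [← hw', hPθ] at hw
      have h1 := congrArg
        (constMat ((B⁻¹ : GL (Fin m) ℂ) : Matrix (Fin m) (Fin m) ℂ)).mulVec hw
      rw [Matrix.mulVec_mulVec, constMat_inv_mul, Matrix.one_mulVec, Matrix.mulVec_zero] at h1
      funext i
      rw [← hθ' (P.mulVec w' i), congrFun h1 i, Pi.zero_apply, map_zero]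
    obtain ⟨c, hc⟩ := h.exists_sum hPw
    rw [← hΦw, ← hc, hΦsum]
    exact Submodule.sum_mem _ fun i _ =>
      Submodule.smul_mem _ _ (Submodule.subset_span ⟨i, rfl⟩)

/-- The transposed state, with the roles of the second and third system exchanged. -/
def transposeState (ψ : State m n) : State n m := fun a => ψ (a.1, a.2.2, a.2.1)

theorem pencil_transposeState (ψ : State m n) :
    pencil (transposeState ψ) = (pencil ψ).transpose := rfl

theorem SLOCCEquiv.sameMinimalIndices {ψ φ : State m n} (h : SLOCCEquiv ψ φ) :
    SameMinimalIndices (pencil ψ) (pencil φ) := by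
  obtain ⟨A, B, D, h⟩ := sloccEquiv_iff.mp h
  refine ⟨?_, ?_⟩
  · obtain ⟨p, ε, v, hv⟩ := exists_isHomogeneousNullBasis ψ
    obtain ⟨v', hv'⟩ := hv.transport A B D h
    exact ⟨p, ε, hv.isRightMinimalIndices, hv'.isRightMinimalIndices⟩
  · obtain ⟨p, ε, v, hv⟩ := exists_isHomogeneousNullBasis (transposeState ψ)
    rw [pencil_transposeState] at hv
    obtain ⟨v', hv'⟩ := hv.transport (Q := (pencil φ).transpose) A D B (by
      rw [h, Matrix.transpose_mul, Matrix.transpose_mul, Matrix.transpose_transpose,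
        Matrix.transpose_map, Matrix.mul_assoc])
    exact ⟨p, ε, hv.isRightMinimalIndices, hv'.isRightMinimalIndices⟩

theorem SameMinimalIndices.trans_left {ψ ψ' φ : State m n}
    (h : SameMinimalIndices (pencil ψ) (pencil ψ'))
    (h' : SameMinimalIndices (pencil ψ) (pencil φ)) :
    SameMinimalIndices (pencil ψ') (pencil φ) := by
  obtain ⟨⟨p, ε, h1, h2⟩, s, ν, h3, h4⟩ := h
  obtain ⟨⟨p', ε', h1', h2'⟩, s', ν', h3', h4'⟩ := h'
  obtain ⟨rfl, rfl⟩ := h1.eq h1'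
  obtain ⟨rfl, rfl⟩ := h3.eq h3'
  exact ⟨⟨p, _, h2, h2'⟩, s, _, h4, h4'⟩

/-! ### Null vectors and null chains -/

/-- The homogeneous null vectors of degree `d`. -/
def nullVectors (ψ : State m n) (d : ℕ) : Submodule ℂ (Fin n → Poly) where
  carrier := {w | (∀ j, (w j).IsHomogeneous d) ∧ (pencil ψ).mulVec w = 0}
  add_mem' := fun ha hb => ⟨fun j => (ha.1 j).add (hb.1 j), by
    rw [Matrix.mulVec_add, ha.2, hb.2, add_zero]⟩
  zero_mem' := ⟨fun _ => MvPolynomial.isHomogeneous_zero _ _ _, Matrix.mulVec_zero _⟩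
  smul_mem' := fun c a ha => ⟨fun j => by
    rw [Pi.smul_apply, MvPolynomial.smul_eq_C_mul]
    have := (MvPolynomial.isHomogeneous_C (Fin 2) c).mul (ha.1 j)
    rwa [zero_add] at this, by
    rw [Matrix.mulVec_smul, ha.2, smul_zero]⟩

/-- The coordinates of the null vectors of degree `d` in the basis form a space that depends on the
degrees only. -/
theorem IsHomogeneousNullBasis.finrank_nullVectors_eq {p : ℕ} {ψ φ : State m n} {ε : Fin p → ℕ}
    {v v' : Fin p → Fin n → Poly} (h : IsHomogeneousNullBasis (pencil ψ) ε v)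
    (h' : IsHomogeneousNullBasis (pencil φ) ε v') (d : ℕ) :
    Module.finrank ℂ (nullVectors ψ d) = Module.finrank ℂ (nullVectors φ d) := by
  have hsmul : ∀ {k : ℕ} (a : ℂ) {c : Poly}, c.IsHomogeneous k → (a • c).IsHomogeneous k := by
    intro k a c hc
    rw [MvPolynomial.smul_eq_C_mul]
    have := (MvPolynomial.isHomogeneous_C (Fin 2) a).mul hc
    rwa [zero_add] at this
  let G : Submodule ℂ (Fin p → Poly) :=
    { carrier := {c | ∀ i, (c i).IsHomogeneous (d - ε i) ∧ (d < ε i → c i = 0)}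
      add_mem' := fun ha hb i => ⟨(ha i).1.add (hb i).1, fun hi => by
        rw [Pi.add_apply, (ha i).2 hi, (hb i).2 hi, add_zero]⟩
      zero_mem' := fun i => ⟨MvPolynomial.isHomogeneous_zero _ _ _, fun _ => rfl⟩
      smul_mem' := fun a c hc i => ⟨hsmul a (hc i).1, fun hi => by
        rw [Pi.smul_apply, (hc i).2 hi, smul_zero]⟩ }
  have key : ∀ {ψ : State m n} {v : Fin p → Fin n → Poly},
      IsHomogeneousNullBasis (pencil ψ) ε v →
      Module.finrank ℂ G = Module.finrank ℂ (nullVectors ψ d) := by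
    intro ψ v h
    let F : G →ₗ[ℂ] nullVectors ψ d :=
      { toFun := fun c => ⟨∑ i, c.1 i • v i, fun j => by
          rw [Finset.sum_apply]
          refine MvPolynomial.IsHomogeneous.sum _ _ _ fun i _ => ?_
          by_cases hi : d < ε i
          · rw [(c.2 i).2 hi, zero_smul]
            exact MvPolynomial.isHomogeneous_zero _ _ _
          · have := (c.2 i).1.mul (h.family.homogeneous i j)
            rwa [Nat.sub_add_cancel (not_lt.mp hi)] at this, by
          rw [← Matrix.mulVecLin_apply, map_sum]
          refine Finset.sum_eq_zero fun i _ => ?_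
          rw [map_smul, LinearMap.mem_ker.mp (h.family.mem i), smul_zero]⟩
        map_add' := fun a b => Subtype.ext (by simp [add_smul, Finset.sum_add_distrib])
        map_smul' := fun a b => Subtype.ext (by simp [Finset.smul_sum]) }
    refine (LinearEquiv.ofBijective F ⟨?_, ?_⟩).finrank_eq
    · intro a b hab
      refine Subtype.ext (funext fun i => sub_eq_zero.mp ?_)
      refine Fintype.linearIndependent_iff.mp h.family.linearIndependent
        (fun i => a.1 i - b.1 i) ?_ i
      simp only [sub_smul, Finset.sum_sub_distrib]
      exact sub_eq_zero.mpr (congrArg Subtype.val hab)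
    · rintro ⟨w, hw, hPw⟩
      obtain ⟨c, hc⟩ := h.exists_homogeneous_sum hPw hw
      refine ⟨⟨fun i => shiftComp d (ε i) (c i), fun i => ?_⟩,
        Subtype.ext hc⟩
      simp only [shiftComp]
      split_ifs with hi
      · exact ⟨MvPolynomial.homogeneousComponent_isHomogeneous _ _,
          fun h => absurd hi (not_le.mpr h)⟩
      · exact ⟨MvPolynomial.isHomogeneous_zero _ _ _, fun _ => rfl⟩
  exact (key h).symm.trans (key h')

/-- The exponent of `μ ^ a λ ^ b`. -/
def expo (a b : ℕ) : Fin 2 →₀ ℕ := Finsupp.single 0 a + Finsupp.single 1 b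

theorem expo_apply_zero (a b : ℕ) : expo a b 0 = a := by simp [expo]

theorem expo_apply_one (a b : ℕ) : expo a b 1 = b := by simp [expo]

theorem eq_expo (e : Fin 2 →₀ ℕ) : e = expo (e 0) (e 1) := by
  ext i
  fin_cases i
  · exact (expo_apply_zero _ _).symm
  · exact (expo_apply_one _ _).symm

theorem coeff_expo_mu_mul_succ (a b : ℕ) (c : Poly) :
    MvPolynomial.coeff (expo (a + 1) b) (mu * c) = MvPolynomial.coeff (expo a b) c := by
  have : expo (a + 1) b = expo a b + Finsupp.single 0 1 := by
    rw [eq_expo (expo a b + _)]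
    congr 1 <;> simp [expo]
  rw [mu, mul_comm, this, MvPolynomial.coeff_mul_X]

theorem coeff_expo_mu_mul_zero (b : ℕ) (c : Poly) :
    MvPolynomial.coeff (expo 0 b) (mu * c) = 0 := by
  rw [mu, MvPolynomial.coeff_X_mul', if_neg]
  simp [expo]

theorem coeff_expo_lam_mul_succ (a b : ℕ) (c : Poly) :
    MvPolynomial.coeff (expo a (b + 1)) (lam * c) = MvPolynomial.coeff (expo a b) c := by
  have : expo a (b + 1) = expo a b + Finsupp.single 1 1 := by
    rw [eq_expo (expo a b + _)]
    congr 1 <;> simp [expo]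
  rw [lam, mul_comm, this, MvPolynomial.coeff_mul_X]

theorem coeff_expo_lam_mul_zero (a : ℕ) (c : Poly) :
    MvPolynomial.coeff (expo a 0) (lam * c) = 0 := by
  rw [lam, MvPolynomial.coeff_X_mul', if_neg]
  simp [expo]

theorem eq_zero_of_coeff_expo {c : Poly} {d : ℕ} (hc : c.IsHomogeneous d)
    (h : ∀ k ≤ d, MvPolynomial.coeff (expo k (d - k)) c = 0) : c = 0 := by
  ext e
  rw [MvPolynomial.coeff_zero]
  by_contra hne
  have h1 := add_eq_of_mem_support hc (MvPolynomial.mem_support_iff.mpr hne)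
  refine hne ?_
  rw [eq_expo e, show e 1 = d - e 0 by omega]
  exact h _ (by omega)

/-- The sequence of the coefficient vectors of `w` at `μ ^ k λ ^ (d - k)`. -/
def coeffSeq (d : ℕ) : (Fin n → Poly) →ₗ[ℂ] (ℕ → Fin n → ℂ) where
  toFun w k j := if k ≤ d then MvPolynomial.coeff (expo k (d - k)) (w j) else 0
  map_add' a b := by
    funext k j
    by_cases h : k ≤ d <;> simp [h]
  map_smul' a b := by
    funext k j
    by_cases h : k ≤ d <;> simp [h]

theorem coeffSeq_apply (d : ℕ) (w : Fin n → Poly) (k : ℕ) (j : Fin n) :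
    coeffSeq d w k j = if k ≤ d then MvPolynomial.coeff (expo k (d - k)) (w j) else 0 := rfl

theorem coeff_pencil_mulVec (ψ : State m n) (w : Fin n → Poly) (e : Fin 2 →₀ ℕ) (i : Fin m) :
    MvPolynomial.coeff e ((pencil ψ).mulVec w i) =
      ∑ j, (ψ (0, i, j) * MvPolynomial.coeff e (mu * w j) +
        ψ (1, i, j) * MvPolynomial.coeff e (lam * w j)) := by
  simp only [Matrix.mulVec, dotProduct, MvPolynomial.coeff_sum]
  refine Finset.sum_congr rfl fun j _ => ?_
  rw [← MvPolynomial.coeff_C_mul, ← MvPolynomial.coeff_C_mul, ← MvPolynomial.coeff_add]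
  congr 1
  simp only [pencil, Matrix.of_apply]
  ring

theorem coeff_pencil_mulVec_zero (ψ : State m n) (w : Fin n → Poly) (d : ℕ) (i : Fin m) :
    MvPolynomial.coeff (expo 0 (d + 1)) ((pencil ψ).mulVec w i) =
      (ofState ψ).S (coeffSeq d w 0) i := by
  rw [coeff_pencil_mulVec]
  simp [coeff_expo_mu_mul_zero, coeff_expo_lam_mul_succ, Matrix.mulVec,
    dotProduct, coeffSeq_apply]

theorem coeff_pencil_mulVec_succ (ψ : State m n) (w : Fin n → Poly) {d k : ℕ} (hk : k ≤ d)
    (i : Fin m) : MvPolynomial.coeff (expo (k + 1) (d - k)) ((pencil ψ).mulVec w i) =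
      ((ofState ψ).R (coeffSeq d w k) + (ofState ψ).S (coeffSeq d w (k + 1))) i := by
  rw [coeff_pencil_mulVec]
  simp only [coeff_expo_mu_mul_succ, Finset.sum_add_distrib, Pi.add_apply,
    Matrix.mulVecLin_apply, Matrix.mulVec, dotProduct, Matrix.of_apply, coeffSeq_apply, if_pos hk]
  congr 1
  refine Finset.sum_congr rfl fun j _ => ?_
  rcases hk.eq_or_lt with rfl | hlt
  · rw [if_neg (by omega), Nat.sub_self, coeff_expo_lam_mul_zero]
  · rw [if_pos (Nat.succ_le_of_lt hlt), show d - k = d - (k + 1) + 1 by omega,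
      coeff_expo_lam_mul_succ]

theorem isHomogeneous_pencil_mulVec (ψ : State m n) {w : Fin n → Poly} {d : ℕ}
    (hw : ∀ j, (w j).IsHomogeneous d) (i : Fin m) :
    ((pencil ψ).mulVec w i).IsHomogeneous (d + 1) := by
  refine MvPolynomial.IsHomogeneous.sum _ _ _ fun j _ => ?_
  rw [add_comm]
  exact (isHomogeneous_pencil ψ i j).mul (hw j)

theorem coeffSeq_mem_nullChains_iff (ψ : State m n) {w : Fin n → Poly} {d : ℕ}
    (hw : ∀ j, (w j).IsHomogeneous d) :
    coeffSeq d w ∈ (ofState ψ).nullChains d ↔ (pencil ψ).mulVec w = 0 := by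
  have h0 : ∀ k, d < k → coeffSeq d w k = 0 := fun k hk => by
    funext j
    rw [coeffSeq_apply, if_neg (by omega)]
    rfl
  rw [LinPencil.mem_nullChains]
  constructor
  · rintro ⟨-, h1, h2⟩
    funext i
    refine eq_zero_of_coeff_expo (isHomogeneous_pencil_mulVec ψ hw i) fun k hk => ?_
    rcases k with _ | k
    · rw [Nat.sub_zero, coeff_pencil_mulVec_zero, h1]
      rfl
    · rw [Nat.add_sub_add_right, coeff_pencil_mulVec_succ ψ w (by omega), h2]
      rfl
  · intro h
    refine ⟨h0, ?_, fun k => ?_⟩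
    · funext i
      rw [← coeff_pencil_mulVec_zero, h]
      exact MvPolynomial.coeff_zero _
    · by_cases hk : k ≤ d
      · funext i
        rw [← coeff_pencil_mulVec_succ ψ w hk, h]
        exact MvPolynomial.coeff_zero _
      · rw [h0 k (by omega), h0 (k + 1) (by omega), map_zero, map_zero, add_zero]

theorem finrank_nullVectors (ψ : State m n) (d : ℕ) :
    Module.finrank ℂ (nullVectors ψ d) = Module.finrank ℂ ((ofState ψ).nullChains d) := by
  refine (LinearEquiv.ofBijective ((coeffSeq d).restrict
    (p := nullVectors ψ d) (q := (ofState ψ).nullChains d) fun w hw =>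
      (coeffSeq_mem_nullChains_iff ψ hw.1).mpr hw.2) ⟨?_, ?_⟩).finrank_eq
  · rw [← LinearMap.ker_eq_bot, LinearMap.ker_eq_bot']
    rintro ⟨w, hw, hPw⟩ h
    refine Subtype.ext (funext fun j => eq_zero_of_coeff_expo (hw j) fun k hk => ?_)
    have := congrFun (congrFun (congrArg Subtype.val h) k) j
    change coeffSeq d w k j = 0 at this
    rwa [coeffSeq_apply, if_pos hk] at this
  · rintro ⟨u, hu⟩
    let w : Fin n → Poly := fun j =>
      ∑ k ∈ Finset.range (d + 1), MvPolynomial.monomial (expo k (d - k)) (u k j)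
    have hw : ∀ j, (w j).IsHomogeneous d := fun j =>
      MvPolynomial.IsHomogeneous.sum _ _ _ fun k hk => by
        refine MvPolynomial.isHomogeneous_monomial _ ?_
        rw [Finsupp.degree_eq_sum, Fin.sum_univ_two, expo_apply_zero, expo_apply_one]
        have := Finset.mem_range.mp hk
        omega
    have hcoeff : coeffSeq d w = u := by
      funext k j
      rw [coeffSeq_apply]
      split_ifs with hk
      · rw [MvPolynomial.coeff_sum, Finset.sum_eq_single k]
        · rw [MvPolynomial.coeff_monomial, if_pos rfl]
        · intro l _ hl
          rw [MvPolynomial.coeff_monomial, if_neg]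
          intro h
          exact hl (by rw [← expo_apply_zero l (d - l), h, expo_apply_zero])
        · intro h
          exact absurd (Finset.mem_range.mpr (by omega)) h
      · rw [(LinPencil.mem_nullChains.mp hu).1 k (by omega)]
        rfl
    refine ⟨⟨w, hw, (coeffSeq_mem_nullChains_iff ψ hw).mp (by rwa [hcoeff])⟩, Subtype.ext hcoeff⟩

theorem finrank_nullChains_congr {p : ℕ} {ψ φ : State m n} {ε : Fin p → ℕ}
    (h : IsRightMinimalIndices (pencil ψ) ε) (h' : IsRightMinimalIndices (pencil φ) ε) (d : ℕ) :
    Module.finrank ℂ ((ofState ψ).nullChains d) = Module.finrank ℂ ((ofState φ).nullChains d) := by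
  obtain ⟨v, hv⟩ := h.exists_isHomogeneousNullBasis
  obtain ⟨v', hv'⟩ := h'.exists_isHomogeneousNullBasis
  rw [← finrank_nullVectors, ← finrank_nullVectors, hv.finrank_nullVectors_eq hv']

/-! ### Lifting the kernel of `S` -/

theorem noInfiniteElementaryDivisors_iff_dvdMinors {ψ : State m n} :
    NoInfiniteElementaryDivisors (pencil ψ) ↔
      ¬ DvdMinors mu (pencilRank (pencil ψ)) (pencil ψ) := by
  rw [noInfiniteElementaryDivisors_iff, dvdMinors_pencil_iff le_rfl]

theorem pencilRank_transpose (P : Matrix (Fin m) (Fin n) Poly) :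
    pencilRank P.transpose = pencilRank P :=
  pencilRank_congr fun _ => dvdMinors_transpose_iff

theorem NoInfiniteElementaryDivisors.transposeState {ψ : State m n}
    (h : NoInfiniteElementaryDivisors (pencil ψ)) :
    NoInfiniteElementaryDivisors (pencil (transposeState ψ)) := by
  rw [noInfiniteElementaryDivisors_iff_dvdMinors] at h ⊢
  rwa [pencil_transposeState, pencilRank_transpose, dvdMinors_transpose_iff]

/-- Up to the factor given by a minor of maximal size, every row is a combination of the rows of that
minor: expand a bordered minor along the additional column. -/
theorem exists_row_combination {A : Type*} [CommRing A] {P : Matrix (Fin m) (Fin n) A} {r : ℕ}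
    (hP : DvdMinors 0 (r + 1) P) (f : Fin r → Fin m) (g : Fin r → Fin n) (i : Fin m) :
    ∃ z : Fin r → A, ∀ j, (P.submatrix f g).det * P i j = ∑ b, z b * P (f b) j := by
  refine ⟨fun b => -((-1) ^ (b.succ : ℕ) *
    (P.submatrix ((Fin.cons i f : Fin (r + 1) → Fin m) ∘ b.succ.succAbove) g).det), fun j => ?_⟩
  have h1 := zero_dvd_iff.mp (hP (Fin.cons i f) (Fin.cons j g))
  rw [Matrix.det_succ_column_zero, Fin.sum_univ_succ] at h1
  simp only [Matrix.submatrix_apply, Fin.cons_zero, Fin.cons_succ, Fin.val_zero, pow_zero, one_mul,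
    Fin.succAbove_zero, Matrix.submatrix_submatrix] at h1
  have h2 : ((Fin.cons i f : Fin (r + 1) → Fin m) ∘ Fin.succ) = f := rfl
  have h3 : ((Fin.cons j g : Fin (r + 1) → Fin n) ∘ Fin.succ) = g := rfl
  rw [h2, h3] at h1
  rw [mul_comm, eq_neg_of_add_eq_zero_left h1, ← Finset.sum_neg_distrib]
  refine Finset.sum_congr rfl fun b _ => ?_
  ring

/-- Cramer's rule: for a minor `M` of maximal size of `P` and a vector `u` there is a null vector of
`P` congruent to `M u` modulo the entries of `P u`. -/
theorem exists_null_vector {A : Type*} [CommRing A] [IsDomain A] {P : Matrix (Fin m) (Fin n) A}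
    {r : ℕ} (hP : DvdMinors 0 (r + 1) P) {f : Fin r → Fin m} {g : Fin r → Fin n}
    (hM : (P.submatrix f g).det ≠ 0) {q : A} {u : Fin n → A} (hu : ∀ i, q ∣ P.mulVec u i) :
    ∃ w, P.mulVec w = 0 ∧ ∀ j, q ∣ (P.submatrix f g).det * u j - w j := by
  classical
  set N := P.submatrix f g with hN
  let t : Fin r → A := N.adjugate.mulVec fun b => P.mulVec u (f b)
  let E : Matrix (Fin n) (Fin r) A := (1 : Matrix (Fin n) (Fin n) A).submatrix id g
  have hE : ∀ i, P.mulVec (E.mulVec t) i = ∑ a, P i (g a) * t a := by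
    intro i
    have h1 : P * E = P.submatrix id g := by
      ext a b
      simp [E, Matrix.mul_apply, Matrix.one_apply]
    rw [Matrix.mulVec_mulVec, h1]
    rfl
  have hrow : ∀ b, P.mulVec (N.det • u - E.mulVec t) (f b) = 0 := by
    intro b
    rw [Matrix.mulVec_sub, Matrix.mulVec_smul, Pi.sub_apply, hE, Pi.smul_apply, smul_eq_mul]
    have h1 : N.mulVec t = N.det • fun b => P.mulVec u (f b) := by
      simp only [t]
      rw [Matrix.mulVec_mulVec, Matrix.mul_adjugate, Matrix.smul_mulVec, Matrix.one_mulVec]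
    rw [sub_eq_zero]
    exact (congrFun h1 b).symm
  refine ⟨N.det • u - E.mulVec t, funext fun i => ?_, fun j => ?_⟩
  · obtain ⟨z, hz⟩ := exists_row_combination hP f g i
    have h1 : N.det * P.mulVec (N.det • u - E.mulVec t) i =
        ∑ b, z b * P.mulVec (N.det • u - E.mulVec t) (f b) := by
      simp only [Matrix.mulVec, dotProduct, Finset.mul_sum, ← mul_assoc]
      rw [Finset.sum_comm]
      refine Finset.sum_congr rfl fun j _ => ?_
      rw [hz, Finset.sum_mul]
    simp only [hrow, mul_zero, Finset.sum_const_zero] at h1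
    exact (mul_eq_zero.mp h1).resolve_left hM
  · rw [Pi.sub_apply, Pi.smul_apply, smul_eq_mul, sub_sub_cancel]
    have hdvd : ∀ {k : ℕ} (X : Matrix (Fin k) (Fin r) A) {c : Fin r → A}, (∀ a, q ∣ c a) →
        ∀ i, q ∣ X.mulVec c i := by
      intro k X c hc i
      rw [Matrix.mulVec, dotProduct]
      exact Finset.dvd_sum fun a _ => (hc a).mul_left _
    exact hdvd E (hdvd _ fun b => hu (f b)) j

/-- For `S u = 0`, `μ` divides all entries of `(μ R + λ S) u`; Cramer's rule for a maximal minor `M`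
not divisible by `μ` gives a null vector whose coefficient at `λ ^ r` is that of `M` times `u`. -/
theorem kerLifts_ofState {ψ : State m n} (h : NoInfiniteElementaryDivisors (pencil ψ)) :
    (ofState ψ).KerLifts := by
  rw [noInfiniteElementaryDivisors_iff_dvdMinors] at h
  set r := pencilRank (pencil ψ) with hr
  unfold DvdMinors at h
  push Not at h
  obtain ⟨f, g, hfg⟩ := h
  have hP : DvdMinors 0 (r + 1) (pencil ψ) := by
    by_contra hcon
    have := le_pencilRank_iff.mpr hcon
    omega
  set M := ((pencil ψ).submatrix f g).det with hM
  have hM0 : M ≠ 0 := fun h0 => hfg (h0 ▸ dvd_zero mu)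
  set a := MvPolynomial.coeff (expo 0 r) M with ha
  have hexpo : expo 0 r = Finsupp.single 1 r := by simp [expo]
  have ha0 : a ≠ 0 := by
    intro h0
    have := mu_dvd_sub (det_submatrix_homogeneous ψ f g)
    rw [← hM, ← hexpo, ← ha, h0, map_zero, zero_mul, sub_zero] at this
    exact hfg this
  intro u hu
  have hmu : ∀ i, mu ∣ (pencil ψ).mulVec (fun j => MvPolynomial.C (u j)) i := by
    intro i
    have h1 : (pencil ψ).mulVec (fun j => MvPolynomial.C (u j)) i =
        mu * MvPolynomial.C ((ofState ψ).R u i) + lam * MvPolynomial.C ((ofState ψ).S u i) := by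
      simp only [pencil, Matrix.mulVec, dotProduct, Matrix.of_apply, Matrix.mulVecLin_apply,
        map_sum, map_mul, Finset.mul_sum, ← Finset.sum_add_distrib]
      exact Finset.sum_congr rfl fun j _ => by ring
    rw [h1, hu, Pi.zero_apply, map_zero, mul_zero, add_zero]
    exact dvd_mul_right _ _
  obtain ⟨w, hw, hwu⟩ := exists_null_vector hP hM0 hmu
  let w' : Fin n → Poly := fun j => MvPolynomial.homogeneousComponent r (w j)
  have hw' : ∀ j, (w' j).IsHomogeneous r := fun j =>
    MvPolynomial.homogeneousComponent_isHomogeneous r (w j)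
  have hPw' : (pencil ψ).mulVec w' = 0 :=
    (isGradedSaturated_nullModule ψ).component_mem (mem_nullModule.mpr hw) r
  refine ⟨r, a⁻¹ • coeffSeq r w', Submodule.smul_mem _ _
    ((coeffSeq_mem_nullChains_iff ψ hw').mpr hPw'), funext fun j => ?_⟩
  obtain ⟨s, hs⟩ := hwu j
  have h1 := congrArg (MvPolynomial.coeff (expo 0 r)) hs
  rw [coeff_expo_mu_mul_zero, MvPolynomial.coeff_sub, mul_comm, MvPolynomial.coeff_C_mul,
    sub_eq_zero] at h1
  rw [Pi.smul_apply, Pi.smul_apply, coeffSeq_apply, if_pos (Nat.zero_le r), Nat.sub_zero,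
    MvPolynomial.coeff_homogeneousComponent, if_pos, ← h1, smul_eq_mul, mul_comm (u j),
    inv_mul_cancel_left₀ ha0]
  rw [Finsupp.degree_eq_sum, Fin.sum_univ_two, expo_apply_zero, expo_apply_one, zero_add]

/-! ### Equivalence of states from equivalence of pencils -/

theorem SLOCCEquiv.trans {ψ φ χ : State m n} (h : SLOCCEquiv ψ φ) (h' : SLOCCEquiv φ χ) :
    SLOCCEquiv ψ χ := by
  obtain ⟨A, B, D, rfl⟩ := h
  obtain ⟨A', B', D', rfl⟩ := h'
  refine ⟨A' * A, B' * B, D' * D, ?_⟩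
  rw [Matrix.mulVec_mulVec, ← Matrix.mul_kronecker_mul, ← Matrix.mul_kronecker_mul]
  rfl

/-- The dual of the pencil of a state is the pencil of the transposed state. -/
theorem iso_dual_ofState (ψ : State m n) :
    LinPencil.Iso (ofState ψ).dual (ofState (transposeState ψ)) := by
  refine LinPencil.Iso.symm ⟨Module.piEquiv (Fin m) ℂ ℂ, Module.piEquiv (Fin n) ℂ ℂ,
    fun v => ?_, fun v => ?_⟩
  · refine LinearMap.pi_ext' fun j => LinearMap.ext_ring ?_
    simp [Module.piEquiv_apply_apply, transposeState, Matrix.mulVec, dotProduct,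
      Pi.single_apply, mul_comm]
  · refine LinearMap.pi_ext' fun j => LinearMap.ext_ring ?_
    simp [Module.piEquiv_apply_apply, transposeState, Matrix.mulVec, dotProduct,
      Pi.single_apply, mul_comm]

theorem pencil_eq (ψ : State m n) : pencil ψ =
    mu • constMat (Matrix.of fun i j => ψ (0, i, j)) +
      lam • constMat (Matrix.of fun i j => ψ (1, i, j)) := rfl

/-- A linear automorphism as an invertible matrix. -/
def glOfEquiv {k : ℕ} (f : (Fin k → ℂ) ≃ₗ[ℂ] (Fin k → ℂ)) : GL (Fin k) ℂ where
  val := LinearMap.toMatrix' f.toLinearMap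
  inv := LinearMap.toMatrix' f.symm.toLinearMap
  val_inv := by
    rw [← LinearMap.toMatrix'_comp, LinearEquiv.comp_symm, LinearMap.toMatrix'_id]
  inv_val := by
    rw [← LinearMap.toMatrix'_comp, LinearEquiv.symm_comp, LinearMap.toMatrix'_id]

theorem sloccEquiv_of_iso {ψ φ : State m n} (h : LinPencil.Iso (ofState ψ) (ofState φ)) :
    SLOCCEquiv ψ φ := by
  obtain ⟨f, g, hR, hS⟩ := h
  let D : GL (Fin n) ℂ :=
    ⟨(glOfEquiv f.symm : Matrix (Fin n) (Fin n) ℂ).transpose,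
      (glOfEquiv f : Matrix (Fin n) (Fin n) ℂ).transpose, by
        rw [← Matrix.transpose_mul]
        exact (congrArg Matrix.transpose (glOfEquiv f).val_inv).trans Matrix.transpose_one, by
        rw [← Matrix.transpose_mul]
        exact (congrArg Matrix.transpose (glOfEquiv f).inv_val).trans Matrix.transpose_one⟩
  have key : ∀ X Y : Matrix (Fin m) (Fin n) ℂ, (∀ v, g (X.mulVecLin v) = Y.mulVecLin (f v)) →
      Y = (glOfEquiv g : Matrix (Fin m) (Fin m) ℂ) * X *
        (glOfEquiv f.symm : Matrix (Fin n) (Fin n) ℂ) := by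
    intro X Y h
    have h1 : Y.mulVecLin = (g.toLinearMap ∘ₗ X.mulVecLin) ∘ₗ f.symm.toLinearMap := by
      refine LinearMap.ext fun v => ?_
      rw [LinearMap.comp_apply, LinearMap.comp_apply]
      exact ((h (f.symm v)).trans (by rw [LinearEquiv.apply_symm_apply])).symm
    have h2 := congrArg LinearMap.toMatrix' h1
    rwa [LinearMap.toMatrix'_comp, LinearMap.toMatrix'_comp, ← Matrix.toLin'_apply',
      ← Matrix.toLin'_apply', LinearMap.toMatrix'_toLin', LinearMap.toMatrix'_toLin'] at h2
  refine sloccEquiv_iff.mpr ⟨1, glOfEquiv g, D, ?_⟩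
  have h1 : (pencil ψ).map (linSubst ((1 : GL (Fin 2) ℂ) : Matrix (Fin 2) (Fin 2) ℂ)) =
      pencil ψ := by
    ext1 i j
    rw [Matrix.map_apply, Units.val_one, linSubst_one]
  have h2 : (constMat (D : Matrix (Fin n) (Fin n) ℂ)).transpose =
      constMat (glOfEquiv f.symm : Matrix (Fin n) (Fin n) ℂ) := rfl
  rw [h1, h2, pencil_eq, pencil_eq ψ, key _ _ hR, key _ _ hS, Matrix.mul_add, Matrix.add_mul,
    Matrix.mul_smul, Matrix.mul_smul, Matrix.smul_mul, Matrix.smul_mul, constMat_mul, constMat_mul,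
    constMat_mul, constMat_mul]

theorem sameChains_ofState {ψ φ : State m n} {p : ℕ} {ε : Fin p → ℕ}
    (H : ∀ z s k, DvdMinors (rootForm z ^ s) k (pencil ψ) ↔
      DvdMinors (rootForm z ^ s) k (pencil φ))
    (h : IsRightMinimalIndices (pencil ψ) ε) (h' : IsRightMinimalIndices (pencil φ) ε) :
    LinPencil.SameChains (ofState ψ) (ofState φ) where
  finrank_V := rfl
  chains := fun x s => finrank_chains_congr (fun s k => by
    rw [← neg_neg x, dvdMinors_polyPencil_iff, dvdMinors_polyPencil_iff, H]) s
  nullChains := finrank_nullChains_congr h h'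

/-- States whose pencils have no infinite elementary divisors are equivalent if the finite elementary
divisors, the ranks and the minimal indices agree; the operator `A` can be taken to be `1`. -/
theorem sloccEquiv_of_sameInvariants {ψ φ : State m n} {q : ℕ} {x : Fin q → ℂ}
    {e f : Fin q → ℕ → ℕ} (h : HasFiniteElementaryDivisors (pencil ψ) x e)
    (h' : HasFiniteElementaryDivisors (pencil φ) x f)
    (hI : NoInfiniteElementaryDivisors (pencil ψ)) (hI' : NoInfiniteElementaryDivisors (pencil φ))
    (hr : pencilRank (pencil ψ) = pencilRank (pencil φ))
    (hef : ∀ i, ∀ j < pencilRank (pencil ψ), e i j = f i j)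
    (hmin : SameMinimalIndices (pencil ψ) (pencil φ)) : SLOCCEquiv ψ φ := by
  have H := dvdMinors_rootForm_pow_iff h h' hr hef
  obtain ⟨⟨p, ε, h1, h2⟩, s, ν, h3, h4⟩ := hmin
  have H' : ∀ z s k, DvdMinors (rootForm z ^ s) k (pencil (transposeState ψ)) ↔
      DvdMinors (rootForm z ^ s) k (pencil (transposeState φ)) := fun z s k => by
    rw [pencil_transposeState, pencil_transposeState, dvdMinors_transpose_iff,
      dvdMinors_transpose_iff, H]
  refine sloccEquiv_of_iso (LinPencil.iso_of_sameChains _ _ _ rfl (sameChains_ofState H h1 h2)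
    ?_ (kerLifts_ofState hI) ?_ (kerLifts_ofState hI') ?_)
  · exact ((iso_dual_ofState ψ).sameChains.trans (sameChains_ofState H' h3 h4)).trans
      (iso_dual_ofState φ).sameChains.symm
  · exact (kerLifts_ofState hI.transposeState).of_iso (iso_dual_ofState ψ).symm
  · exact (kerLifts_ofState hI'.transposeState).of_iso (iso_dual_ofState φ).symm

theorem HasFiniteElementaryDivisors.comp_equiv {P : Matrix (Fin m) (Fin n) Poly} {q q' : ℕ}
    {y : Fin q' → ℂ} {f : Fin q' → ℕ → ℕ} (h : HasFiniteElementaryDivisors P y f)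
    (σ : Fin q ≃ Fin q') :
    HasFiniteElementaryDivisors P (fun i => y (σ i)) (fun i => f (σ i)) where
  injective := h.injective.comp σ.injective
  mem_iff := fun z => (σ.surjective.exists (p := fun i => y i = z)).symm.trans (h.mem_iff z)
  exponent := fun i => h.exponent (σ i)

end TwoMN

end

theorem mainTheorem1 (m n : ℕ) :
    (∀ (ψ φ : TwoMN.State m n) (q q' : ℕ)
        (x : Fin q → ℂ) (e : Fin q → ℕ → ℕ) (y : Fin q' → ℂ) (f : Fin q' → ℕ → ℕ),
      TwoMN.HasFiniteElementaryDivisors (TwoMN.pencil ψ) x e →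
      TwoMN.NoInfiniteElementaryDivisors (TwoMN.pencil ψ) →
      TwoMN.HasFiniteElementaryDivisors (TwoMN.pencil φ) y f →
      TwoMN.NoInfiniteElementaryDivisors (TwoMN.pencil φ) →
      (TwoMN.SLOCCEquiv ψ φ ↔
        TwoMN.pencilRank (TwoMN.pencil ψ) = TwoMN.pencilRank (TwoMN.pencil φ) ∧
        TwoMN.SameMinimalIndices (TwoMN.pencil ψ) (TwoMN.pencil φ) ∧
        ∃ σ : Fin q ≃ Fin q',
          (∀ i, ∀ j < TwoMN.pencilRank (TwoMN.pencil ψ), e i j = f (σ i) j) ∧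
          ∃ a b c d : ℂ, a * d - b * c ≠ 0 ∧
            ∀ i, b * x i + d ≠ 0 ∧ (a * x i + c) / (b * x i + d) = y (σ i))) ∧
    (∀ χ : TwoMN.State m n, ∃ χ' : TwoMN.State m n, TwoMN.SLOCCEquiv χ χ' ∧
      TwoMN.NoInfiniteElementaryDivisors (TwoMN.pencil χ') ∧
      ∃ (q : ℕ) (x : Fin q → ℂ) (e : Fin q → ℕ → ℕ),
        TwoMN.HasFiniteElementaryDivisors (TwoMN.pencil χ') x e) := by
  refine ⟨fun ψ φ q q' x e y f hx hIψ hy hIφ => ⟨fun h => ?_, ?_⟩, fun χ => ?_⟩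
  · obtain ⟨A, hA⟩ := h.exists_minorsSubst
    have hd := hA.denom_ne_zero hx hIφ
    obtain ⟨σ, hσ, hef⟩ := (hA.hasFiniteElementaryDivisors hx hIψ hd).exists_equiv hy
    rw [hA.pencilRank_eq] at hef
    refine ⟨hA.pencilRank_eq.symm, h.sameMinimalIndices, σ, hef, A 0 0, A 1 0, A 0 1, A 1 1, ?_,
      fun i => ⟨hd i, (hσ i).symm⟩⟩
    rw [mul_comm (A 1 0)]
    exact TwoMN.det_ne_zero A
  · rintro ⟨hr, hmin, σ, hef, a, b, c, d, hdet, hxy⟩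
    let A : GL (Fin 2) ℂ := Matrix.GeneralLinearGroup.mkOfDetNeZero !![a, c; b, d] (by
      rwa [Matrix.det_fin_two_of, mul_comm c])
    have hd : ∀ i, A 1 0 * x i + A 1 1 ≠ 0 := fun i => (hxy i).1
    obtain ⟨ψ', hψ', hA⟩ : ∃ ψ', TwoMN.SLOCCEquiv ψ ψ' ∧ TwoMN.MinorsSubst A ψ ψ' :=
      ⟨_, ⟨A, 1, 1, rfl⟩, TwoMN.minorsSubst_mulVec ψ A 1 1⟩
    have hx' := hA.hasFiniteElementaryDivisors hx hIψ hd
    have hxy' : (fun i => (A 0 0 * x i + A 0 1) / (A 1 0 * x i + A 1 1)) = fun i => y (σ i) :=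
      funext fun i => (hxy i).2
    rw [hxy'] at hx'
    refine hψ'.trans (TwoMN.sloccEquiv_of_sameInvariants hx' (hy.comp_equiv σ)
      (hA.noInfiniteElementaryDivisors hx hIψ hd) hIφ (hA.pencilRank_eq.trans hr) ?_
      (hψ'.sameMinimalIndices.trans_left hmin))
    rw [hA.pencilRank_eq]
    exact hef
  · obtain ⟨χ', h, hI⟩ := TwoMN.exists_sloccEquiv_noInfiniteElementaryDivisors χ
    exact ⟨χ', h, hI, TwoMN.exists_hasFiniteElementaryDivisors χ'⟩
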